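/- Let $\mathfrak h$ be the Lie algebra of the two-dimensional torus, equipped with an inner product (that is, a two-dimensional real inner product space), with orthogonal group $O(\mathfrak h)$. Let $(\mathfrak g,G)$ be one of $(\mathfrak{so}(n),SO(n))$ with $n=5$ or $n\ge 7$; $(\mathfrak{su}(n),SU(n))$ with $n\ge 4$; or $(\mathfrak{sp}(n),Sp(n))$ (compact form) with $n\ge 3$. Two linear maps $j,j':\mathfrak h\to\mathfrak g$ are called isospectral if for every $z\in\mathfrak h$ there is $A_z\in G$ with $j(z)=\mathrm{Ad}(A_z)j'(z)$. They are called equivalent if there are $A\in G$ and $C\in O(\mathfrak h)$ with $j(z)=\mathrm{Ad}(A)j'(C(z))$ for all $z\in\mathfrak h$. Let $L$ be the real vector space of all linear maps $\mathfrak h\to\mathfrak g$. Then there are a positive integer $d$, depending only on $\mathfrak g$, and a nonempty Zariski open set $\mathcal O\subset L$ such that each $j_0\in\mathcal O$ is contained in a continuous $d$-parameter family of linear maps which are isospectral but pairwise not equivalent. That is, there are a connected open set $U\subset\mathbb R^d$ and a continuous map $\varphi:U\to L$ with $j_0\in\varphi(U)$ such that $\varphi(s)$ and $\varphi(t)$ are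 isospectral for all $s,t\in U$ and not equivalent whenever $s\ne t$. Here $d$ satisfies $$d\ \ge\ \frac{n(n-1)}2-\Big[\frac n2\Big]\Big(\Big[\frac n2\Big]+2\Big)\quad\text{for }\mathfrak{so}(n),$$ $$d\ \ge\ n^2-1-\frac{n^2+3n}{2}\quad\text{for }\mathfrak{su}(n),$$ $$d\ \ge\ n^2-n\quad\text{for }\mathfrak{sp}(n),$$ where $[x]$ is the largest integer not exceeding $x$. Moreover $d$ can be chosen so that, in addition, $d>1$ for $\mathfrak{so}(n)$ ($n=5$ or $n\ge7$), $d=1$ for $\mathfrak{su}(4)$, $d>1$ for $\mathfrak{su}(n)$ ($n\ge5$), and $d>1$ for $\mathfrak{sp}(n)$ ($n\ge3$). -/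

import Mathlib

open scoped Matrix

universe u

attribute [local instance] LieRing.ofAssociativeRing

namespace IsospectralMaps

/-- The Lie algebra `su(n)`: traceless skew-Hermitian complex `n × n` matrices, as a real
Lie algebra. -/
def su (n : ℕ) : LieSubalgebra ℝ (Matrix (Fin n) (Fin n) ℂ) where
  carrier := {X | Xᴴ = -X ∧ X.trace = 0}
  zero_mem' := by simp
  add_mem' := by
    rintro X Y ⟨hX, hX'⟩ ⟨hY, hY'⟩
    refine ⟨?_, ?_⟩
    · rw [Matrix.conjTranspose_add, hX, hY]; abel
    · rw [Matrix.trace_add, hX', hY', add_zero]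
  smul_mem' := by
    rintro c X ⟨hX, hX'⟩
    refine ⟨?_, ?_⟩
    · rw [Matrix.conjTranspose_smul, hX]; simp
    · rw [Matrix.trace_smul, hX', smul_zero]
  lie_mem' := by
    rintro X Y ⟨hX, -⟩ ⟨hY, -⟩
    refine ⟨?_, ?_⟩
    · rw [Ring.lie_def, Matrix.conjTranspose_sub, Matrix.conjTranspose_mul,
        Matrix.conjTranspose_mul, hX, hY]
      noncomm_ring
    · rw [Ring.lie_def, Matrix.trace_sub, Matrix.trace_mul_comm, sub_self]

/-- The compact Lie algebra `sp(n)` in its standard complex `2n × 2n` form: skew-Hermitian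
matrices lying in the complex symplectic Lie algebra `sp(2n, ℂ)`, as a real Lie algebra. -/
def sp (n : ℕ) : LieSubalgebra ℝ (Matrix (Fin n ⊕ Fin n) (Fin n ⊕ Fin n) ℂ) where
  carrier := {X | Xᴴ = -X ∧ X ∈ LieAlgebra.Symplectic.sp (Fin n) ℂ}
  zero_mem' := by
    refine ⟨by simp, zero_mem _⟩
  add_mem' := by
    rintro X Y ⟨hX, hX'⟩ ⟨hY, hY'⟩
    refine ⟨?_, add_mem hX' hY'⟩
    rw [Matrix.conjTranspose_add, hX, hY]; abel
  smul_mem' := by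
    rintro c X ⟨hX, hX'⟩
    refine ⟨?_, ?_⟩
    · rw [Matrix.conjTranspose_smul, hX]; simp
    · exact (LieAlgebra.Symplectic.sp (Fin n) ℂ).smul_mem (c : ℂ) hX'
  lie_mem' := by
    rintro X Y ⟨hX, hX'⟩ ⟨hY, hY'⟩
    refine ⟨?_, (LieAlgebra.Symplectic.sp (Fin n) ℂ).lie_mem hX' hY'⟩
    rw [Ring.lie_def, Matrix.conjTranspose_sub, Matrix.conjTranspose_mul,
      Matrix.conjTranspose_mul, hX, hY]
    noncomm_ring

/-- The compact symplectic group `Sp(n) = U(2n) ∩ Sp(2n, ℂ)`. -/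
def Sp (n : ℕ) : Submonoid (Matrix (Fin n ⊕ Fin n) (Fin n ⊕ Fin n) ℂ) :=
  Matrix.unitaryGroup (Fin n ⊕ Fin n) ℂ ⊓ Matrix.symplecticGroup (Fin n) ℂ

/-- A subset of a real vector space is Zariski open if it is the complement of the common zero
set of a family of real polynomial functions (polynomials in the linear functionals). -/
def IsZariskiOpen {V : Type*} [AddCommGroup V] [Module ℝ V] (O : Set V) : Prop :=
  ∃ S : Set (MvPolynomial (Module.Dual ℝ V) ℝ),
    O = {v | ∀ p ∈ S, MvPolynomial.eval (fun l : Module.Dual ℝ V => l v) p = 0}ᶜ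

section Maps

variable {ι 𝕜 h : Type*} [Fintype ι] [DecidableEq ι] [CommRing 𝕜] [Algebra ℝ 𝕜]
  [NormedAddCommGroup h] [InnerProductSpace ℝ h]
  {g : LieSubalgebra ℝ (Matrix ι ι 𝕜)}

/-- `j` and `j'` are isospectral with respect to the matrix group `G`, whose adjoint action on
its Lie algebra `g` is conjugation: for every `z` there is `A ∈ G` with
`j z = Ad(A) (j' z)`. -/
def Isospectral (G : Submonoid (Matrix ι ι 𝕜)) (j j' : h →ₗ[ℝ] g) : Prop :=
  ∀ z : h, ∃ A ∈ G, (j z : Matrix ι ι 𝕜) = A * (j' z : Matrix ι ι 𝕜) * A⁻¹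

/-- `j` and `j'` are equivalent with respect to `G`: there are a single `A ∈ G` and a linear
isometry `C` of `h` with `j z = Ad(A) (j' (C z))` for all `z`. -/
def Equivalent (G : Submonoid (Matrix ι ι 𝕜)) (j j' : h →ₗ[ℝ] g) : Prop :=
  ∃ A ∈ G, ∃ C : h ≃ₗᵢ[ℝ] h, ∀ z : h,
    (j z : Matrix ι ι 𝕜) = A * (j' (C z) : Matrix ι ι 𝕜) * A⁻¹

/-- `j₀` is contained in a continuous `d`-parameter family of linear maps `h → g` that are
isospectral but pairwise (for distinct parameters) not equivalent. The parameters range over a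
connected open subset of `ℝ^d`; as `h` and `g` are finite-dimensional, continuity in the space
of linear maps is continuity of each evaluation. -/
def InIsospectralFamily [TopologicalSpace 𝕜] (G : Submonoid (Matrix ι ι 𝕜)) (d : ℕ)
    (j₀ : h →ₗ[ℝ] g) : Prop :=
  ∃ (U : Set (EuclideanSpace ℝ (Fin d))) (φ : EuclideanSpace ℝ (Fin d) → (h →ₗ[ℝ] g)),
    IsOpen U ∧ IsConnected U ∧
    (∀ z : h, ContinuousOn (fun t => (φ t z : Matrix ι ι 𝕜)) U) ∧
    j₀ ∈ φ '' U ∧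
    (∀ s ∈ U, ∀ t ∈ U, Isospectral G (φ s) (φ t)) ∧
    (∀ s ∈ U, ∀ t ∈ U, s ≠ t → ¬ Equivalent G (φ s) (φ t))

end Maps

end IsospectralMaps

/-! Fix an orthonormal basis of `h`, so that a linear map `j` is a pair `(X, Y)` in `g × g`, a space
of dimension `2 dim g`. The theorem is a dimension count made rigorous near a generic pair.

Isospectrality as a finite system. Along a connected family in `g`, equal characteristic polynomials
imply conjugacy under `G`. The coefficient of degree `k` in the matrix entries, evaluated on `X +
tY`, is a polynomial in `t` of degree at most `k`, so its values at `t = 0, ..., k` determine it. If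
`D` is the set of degrees whose coefficient does not vanish identically on `g`, isospectrality near
a pair amounts to at most `∑ k ∈ D, (k + 1)` real equations (`charpoly_eq_of_charCoeff_eq`).

Removing conjugation. A generic pair has only scalars in its centralizer, so its orbit has dimension
`dim g` and a transverse affine slice also has dimension `dim g` (`exists_slice`). By compactness of
`G` a small piece of the slice meets each orbit at most once (`exists_nhds_slice`). Where the
invariants restricted to the slice have maximal rank, their level set contains a family of dimension
at least `dim g - ∑ k ∈ D, (k + 1)` (`exists_level_family`).

Removing `O(h)`. If isospectral maps are related by `A` and `C`, then `C` preserves the form `re tr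
(j z)²`. The sign of `reflInv` excludes `det C = -1`, its nonvanishing makes the form non-scalar and
hence `C = ±1`, and the sign of `oddInv` excludes `C = -1` (`exists_conj_of_equivalent`). Both signs
are locally constant.

All genericity conditions are nonvanishing of polynomial functions on the space of maps, so their
conjunction is Zariski open, and it is nonempty once each holds somewhere.
`exists_isZariskiOpen_inIsospectralFamily` carries this out abstractly. The classical algebras then
need a conjugacy theorem, a dimension bound, and explicit pairs showing that the conditions can be
met. -/

namespace IsospectralMaps

/-! ### Polynomial functions on a real vector space and generic conditions. -/

section PolynomialFunctions

variable {V : Type*} [AddCommGroup V] [Module ℝ V]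

/-- The algebra of real polynomial functions on a real vector space. -/
noncomputable def polyFun (V : Type*) [AddCommGroup V] [Module ℝ V] : Subalgebra ℝ (V → ℝ) :=
  Algebra.adjoin ℝ (Set.range fun l : Module.Dual ℝ V => (l : V → ℝ))

theorem linear_mem_polyFun (l : V →ₗ[ℝ] ℝ) : (fun v => l v) ∈ polyFun V :=
  Algebra.subset_adjoin ⟨l, rfl⟩

theorem const_mem_polyFun (c : ℝ) : (fun _ => c) ∈ polyFun V :=
  (polyFun V).algebraMap_mem c

theorem exists_mvPolynomial_of_mem_polyFun {f : V → ℝ} (hf : f ∈ polyFun V) :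
    ∃ p : MvPolynomial (Module.Dual ℝ V) ℝ,
      ∀ v, f v = MvPolynomial.eval (fun l : Module.Dual ℝ V => l v) p := by
  induction hf using Algebra.adjoin_induction with
  | mem f hf =>
    obtain ⟨l, rfl⟩ := hf
    exact ⟨MvPolynomial.X l, fun v => by simp⟩
  | algebraMap r => exact ⟨MvPolynomial.C r, fun v => by simp⟩
  | add f g _ _ hf hg =>
    obtain ⟨p, hp⟩ := hf
    obtain ⟨q, hq⟩ := hg
    exact ⟨p + q, fun v => by simp [hp, hq]⟩
  | mul f g _ _ hf hg =>
    obtain ⟨p, hp⟩ := hf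
    obtain ⟨q, hq⟩ := hg
    exact ⟨p * q, fun v => by simp [hp, hq]⟩

theorem isZariskiOpen_of_mem_polyFun {f : V → ℝ} (hf : f ∈ polyFun V) :
    IsZariskiOpen {v | f v ≠ 0} := by
  obtain ⟨p, hp⟩ := exists_mvPolynomial_of_mem_polyFun hf
  refine ⟨{p}, ?_⟩
  ext v
  simp [hp]

theorem exists_polynomial_on_line {f : V → ℝ} (hf : f ∈ polyFun V) (a b : V) :
    ∃ q : Polynomial ℝ, ∀ t : ℝ, f (a + t • b) = q.eval t := by
  induction hf using Algebra.adjoin_induction with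
  | mem f hf =>
    obtain ⟨l, rfl⟩ := hf
    exact ⟨Polynomial.C (l a) + Polynomial.X * Polynomial.C (l b), fun t => by simp; ring⟩
  | algebraMap r => exact ⟨Polynomial.C r, fun v => by simp⟩
  | add f g _ _ hf hg =>
    obtain ⟨p, hp⟩ := hf
    obtain ⟨q, hq⟩ := hg
    exact ⟨p + q, fun v => by simp [hp, hq]⟩
  | mul f g _ _ hf hg =>
    obtain ⟨p, hp⟩ := hf
    obtain ⟨q, hq⟩ := hg
    exact ⟨p * q, fun v => by simp [hp, hq]⟩

/-- On the line joining the two points both functions become nonzero one-variable polynomials, whose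
product is nonzero. This allows several generic conditions to be imposed at once. -/
theorem exists_mul_ne_zero {f g : V → ℝ} (hf : f ∈ polyFun V) (hg : g ∈ polyFun V)
    (hf0 : ∃ a, f a ≠ 0) (hg0 : ∃ b, g b ≠ 0) : ∃ v, (f * g) v ≠ 0 := by
  obtain ⟨a, ha⟩ := hf0
  obtain ⟨b, hb⟩ := hg0
  obtain ⟨p, hp⟩ := exists_polynomial_on_line hf a (b - a)
  obtain ⟨q, hq⟩ := exists_polynomial_on_line hg a (b - a)
  have hp0 : p ≠ 0 := by
    rintro rfl
    exact ha (by simpa using hp 0)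
  have hq0 : q ≠ 0 := by
    rintro rfl
    exact hb (by simpa using hq 1)
  by_contra! h
  refine mul_ne_zero hp0 hq0 (Polynomial.funext fun t => ?_)
  rw [Polynomial.eval_mul, ← hp, ← hq]
  simpa using h (a + t • (b - a))

section Calculus

variable {E : Type*} [NormedAddCommGroup E] [NormedSpace ℝ E] [FiniteDimensional ℝ E]

theorem contDiff_of_mem_polyFun {f : V → ℝ} (hf : f ∈ polyFun V) (ω : E →ₗ[ℝ] V) (v : V)
    {n : WithTop ℕ∞} : ContDiff ℝ n fun x => f (v + ω x) := by
  induction hf using Algebra.adjoin_induction with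
  | mem f hf =>
    obtain ⟨l, rfl⟩ := hf
    have : (fun x => l (v + ω x)) = fun x => l v + LinearMap.toContinuousLinearMap (l ∘ₗ ω) x := by
      ext x; simp
    rw [this]
    fun_prop
  | algebraMap r => exact contDiff_const
  | add f g _ _ hf hg => exact hf.add hg
  | mul f g _ _ hf hg => exact hf.mul hg

/-- The Leibniz rule reduces this to linear functionals, whose derivative is constant. It makes the
rank of a derivative amenable to Zariski open conditions. -/
theorem fderiv_mem_polyFun {f : V → ℝ} (hf : f ∈ polyFun V) (ω : E →ₗ[ℝ] V) (y : E) :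
    (fun v => fderiv ℝ (fun x => f (v + ω x)) 0 y) ∈ polyFun V := by
  induction hf using Algebra.adjoin_induction with
  | mem f hf =>
    obtain ⟨l, rfl⟩ := hf
    have : (fun v => fderiv ℝ (fun x => l (v + ω x)) 0 y) = fun _ => l (ω y) := by
      ext v
      have : (fun x => l (v + ω x)) =
          fun x => l v + LinearMap.toContinuousLinearMap (l ∘ₗ ω) x := by
        ext x; simp
      rw [this, fderiv_const_add, ContinuousLinearMap.fderiv]
      simp
    rw [this]
    exact const_mem_polyFun _
  | algebraMap r =>
    have : (fun v => fderiv ℝ (fun x => algebraMap ℝ (V → ℝ) r (v + ω x)) 0 y) = fun _ => 0 := by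
      ext v
      simp
    rw [this]
    exact const_mem_polyFun 0
  | add f g hf' hg' hf hg =>
    refine Set.mem_of_eq_of_mem (funext fun v => ?_) (add_mem hf hg)
    have h1 := (contDiff_of_mem_polyFun hf' ω v (n := 1)).differentiable one_ne_zero 0
    have h2 := (contDiff_of_mem_polyFun hg' ω v (n := 1)).differentiable one_ne_zero 0
    simp only [Pi.add_apply]
    rw [fderiv_fun_add h1 h2]
    rfl
  | mul f g hf' hg' hf hg =>
    refine Set.mem_of_eq_of_mem (funext fun v => ?_) (add_mem (mul_mem hf' hg) (mul_mem hg' hf))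
    have h1 := (contDiff_of_mem_polyFun hf' ω v (n := 1)).differentiable one_ne_zero 0
    have h2 := (contDiff_of_mem_polyFun hg' ω v (n := 1)).differentiable one_ne_zero 0
    simp only [Pi.mul_apply, Pi.add_apply]
    rw [fderiv_fun_mul h1 h2]
    simp

end Calculus

/-- Injectivity of a linear map depending polynomially on a parameter is a Zariski open
condition. -/
theorem exists_polyFun_injective {P Q : Type*} [AddCommGroup P] [Module ℝ P]
    [FiniteDimensional ℝ P] [AddCommGroup Q] [Module ℝ Q] (A : V → P →ₗ[ℝ] Q)
    (hA : ∀ (p : P) (l : Q →ₗ[ℝ] ℝ), (fun v => l (A v p)) ∈ polyFun V)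
    {v₁ : V} (h₁ : Function.Injective (A v₁)) :
    ∃ D ∈ polyFun V, D v₁ ≠ 0 ∧ ∀ v, D v ≠ 0 → Function.Injective (A v) := by
  -- With `B` a left inverse at `v₁`, the function `det (B ∘ A v)` is polynomial in `v`, equals `1`
  -- at `v₁`, and certifies injectivity wherever it is nonzero.
  obtain ⟨B, hB⟩ := (A v₁).exists_leftInverse_of_injective (LinearMap.ker_eq_bot.2 h₁)
  let b := Module.finBasis ℝ P
  refine ⟨fun v => LinearMap.det (B ∘ₗ A v), ?_, by simp [hB], fun v hv => ?_⟩
  · have : (fun v => LinearMap.det (B ∘ₗ A v)) =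
        ∑ σ : Equiv.Perm (Fin (Module.finrank ℝ P)), (algebraMap ℝ (V → ℝ) (Equiv.Perm.sign σ : ℤ)) *
          ∏ i, fun v => (b.coord (σ i) ∘ₗ B) (A v (b i)) := by
      ext v
      rw [← LinearMap.det_toMatrix b, Matrix.det_apply']
      simp [LinearMap.toMatrix_apply]
    rw [this]
    refine sum_mem fun σ _ => mul_mem (Subalgebra.algebraMap_mem _ _) (prod_mem fun i _ => hA _ _)
  · have h := (LinearMap.equivOfDetNeZero (B ∘ₗ A v) hv).injective
    have h' : Function.Injective (B ∘ A v) := h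
    exact h'.of_comp

/-- The algebra of polynomial functions with values in `ℝ` or `ℂ`. -/
noncomputable def polyFunK (𝕜 V : Type*) [RCLike 𝕜] [AddCommGroup V] [Module ℝ V] :
    Subalgebra ℝ (V → 𝕜) where
  carrier := {f | (fun v => RCLike.re (f v)) ∈ polyFun V ∧ (fun v => RCLike.im (f v)) ∈ polyFun V}
  mul_mem' := by
    rintro f g ⟨h1, h2⟩ ⟨h3, h4⟩
    refine ⟨?_, ?_⟩
    · convert sub_mem (mul_mem h1 h3) (mul_mem h2 h4) using 1
      ext v; simp
    · convert add_mem (mul_mem h1 h4) (mul_mem h2 h3) using 1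
      ext v; simp
  add_mem' := by
    rintro f g ⟨h1, h2⟩ ⟨h3, h4⟩
    refine ⟨?_, ?_⟩
    · convert add_mem h1 h3 using 1
      ext v; simp
    · convert add_mem h2 h4 using 1
      ext v; simp
  algebraMap_mem' r := by
    refine ⟨?_, ?_⟩
    · convert const_mem_polyFun (V := V) r using 1
      ext v; simp
    · convert const_mem_polyFun (V := V) 0 using 1
      ext v; simp

variable {𝕜 : Type*} [RCLike 𝕜]

theorem linear_mem_polyFunK (l : V →ₗ[ℝ] 𝕜) : (fun v => l v) ∈ polyFunK 𝕜 V :=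
  ⟨linear_mem_polyFun (RCLike.reLm ∘ₗ l), linear_mem_polyFun (RCLike.imLm ∘ₗ l)⟩

variable {ι : Type*} [Fintype ι]

theorem mul_entry_mem_polyFunK {A B : V → Matrix ι ι 𝕜}
    (hA : ∀ a b, (fun v => A v a b) ∈ polyFunK 𝕜 V)
    (hB : ∀ a b, (fun v => B v a b) ∈ polyFunK 𝕜 V) (a b : ι) :
    (fun v => (A v * B v) a b) ∈ polyFunK 𝕜 V := by
  have : (fun v => (A v * B v) a b) = ∑ c, (fun v => A v a c) * fun v => B v c b := by
    ext v; simp [Matrix.mul_apply]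
  rw [this]
  exact sum_mem fun c _ => mul_mem (hA _ _) (hB _ _)

theorem trace_mem_polyFunK {A : V → Matrix ι ι 𝕜}
    (hA : ∀ a b, (fun v => A v a b) ∈ polyFunK 𝕜 V) : (fun v => (A v).trace) ∈ polyFunK 𝕜 V := by
  have : (fun v => (A v).trace) = ∑ c, (fun v => A v c c) := by
    ext v; simp [Matrix.trace]
  rw [this]
  exact sum_mem fun c _ => hA _ _

theorem charpoly_coeff_mem_polyFunK [DecidableEq ι] {A : V → Matrix ι ι 𝕜}
    (hA : ∀ a b, (fun v => A v a b) ∈ polyFunK 𝕜 V) (k : ℕ) :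
    (fun v => (A v).charpoly.coeff k) ∈ polyFunK 𝕜 V := by
  have : (fun v => (A v).charpoly.coeff k) =
      MvPolynomial.aeval (fun (p : ι × ι) (v : V) => A v p.1 p.2)
        ((Matrix.charpoly.univ ℝ ι).coeff k) := by
    ext v
    have h := Matrix.charpoly.univ_coeff_eval₂Hom ι (algebraMap ℝ 𝕜) (fun p => A v p.1 p.2) k
    have h2 : Matrix.of (Function.curry fun p : ι × ι => A v p.1 p.2) = A v := rfl
    rw [h2] at h
    rw [← h]
    change _ = Pi.evalRingHom (fun _ => 𝕜) v _
    exact (MvPolynomial.hom_eval₂ _ (algebraMap ℝ (V → 𝕜)) (Pi.evalRingHom (fun _ => 𝕜) v)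
      fun (p : ι × ι) (v : V) => A v p.1 p.2).symm
  rw [this]
  rw [MvPolynomial.aeval_def, MvPolynomial.eval₂_eq]
  refine sum_mem fun d _ => mul_mem (Subalgebra.algebraMap_mem _ _)
    (prod_mem fun i _ => pow_mem (hA _ _) _)

end PolynomialFunctions

/-! ### Level sets of maps of maximal rank. -/

theorem exists_injective_linearMap {E : Type*} [AddCommGroup E] [Module ℝ E]
    [FiniteDimensional ℝ E] {d : ℕ} (hd : d ≤ Module.finrank ℝ E) :
    ∃ L : EuclideanSpace ℝ (Fin d) →ₗ[ℝ] E, Function.Injective L := by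
  have h := (Module.finBasis ℝ E).linearIndependent.comp (Fin.castLE hd)
    (Fin.castLE_injective hd)
  exact ⟨Fintype.linearCombination ℝ (Module.finBasis ℝ E ∘ Fin.castLE hd) ∘ₗ
    (WithLp.linearEquiv 2 ℝ (Fin d → ℝ)).toLinearMap,
    (linearIndependent_iff_injective_fintypeLinearCombination.1 h).comp (WithLp.linearEquiv 2 ℝ _).injective⟩

open Filter Topology in
/-- A map whose rank is maximal at the origin is constant along a family of the expected
dimension through the origin. -/
theorem exists_level_family {E F : Type*} [NormedAddCommGroup E] [NormedSpace ℝ E]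
    [FiniteDimensional ℝ E] [NormedAddCommGroup F] [NormedSpace ℝ F] [FiniteDimensional ℝ F]
    {f : E → F} (hf : ContDiff ℝ 1 f) (P : Submodule ℝ E)
    (hP : ∀ p ∈ P, fderiv ℝ f 0 p = 0 → p = 0)
    (hrank : ∀ x, Module.finrank ℝ (fderiv ℝ f x).range ≤ Module.finrank ℝ P)
    {d : ℕ} (hd : d + Module.finrank ℝ P ≤ Module.finrank ℝ E) {N : Set E} (hN : N ∈ 𝓝 0) :
    ∃ ε > 0, ∃ ψ : EuclideanSpace ℝ (Fin d) → E,
      ContinuousOn ψ (Metric.ball 0 ε) ∧ Set.InjOn ψ (Metric.ball 0 ε) ∧ ψ 0 = 0 ∧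
      ∀ u ∈ Metric.ball 0 ε, f (ψ u) = f 0 ∧ ψ u ∈ N := by
  set A₀ := fderiv ℝ f 0 with hA₀
  -- `S` takes values in `P` and inverts `A₀` on `P`; only the components of `f` seen by `S` will be
  -- controlled directly.
  obtain ⟨π, hπ⟩ := ((A₀ : E →ₗ[ℝ] F) ∘ₗ P.subtype).exists_leftInverse_of_injective <| by
    rw [LinearMap.ker_eq_bot']
    intro p hp
    exact Subtype.ext (hP p p.2 hp)
  let S : F →L[ℝ] E := LinearMap.toContinuousLinearMap (P.subtype ∘ₗ π)
  have hSP : ∀ y, S y ∈ P := fun y => (π y).2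
  have hSA : ∀ p ∈ P, S (A₀ p) = p := fun p hp =>
    congrArg Subtype.val (LinearMap.congr_fun hπ ⟨p, hp⟩)
  -- This change of coordinates is tangent to the identity at `0` and satisfies `S (A₀ (h x)) = S (f
  -- x) - S (f 0)`, so it straightens the level sets of `S ∘ f`.
  let h : E → E := fun x => x + S (f x - f 0 - A₀ x)
  have hfd : ∀ x, HasFDerivAt f (fderiv ℝ f x) x := fun x =>
    (hf.differentiable one_ne_zero x).hasFDerivAt
  have hh : ContDiff ℝ 1 h := by fun_prop
  have hh' : ∀ x, HasFDerivAt h (ContinuousLinearMap.id ℝ E + S.comp (fderiv ℝ f x - A₀)) x :=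
    fun x => (hasFDerivAt_id x).add
      (S.hasFDerivAt.comp x (((hfd x).sub_const (f 0)).sub A₀.hasFDerivAt))
  have h0 : h 0 = 0 := by simp [h]
  have hh0 : HasFDerivAt h ((ContinuousLinearEquiv.refl ℝ E : E ≃L[ℝ] E) : E →L[ℝ] E) 0 := by
    convert hh' 0 using 1
    ext x
    simp [hA₀]
  let e := ContDiffAt.toOpenPartialHomeomorph h hh.contDiffAt hh0 one_ne_zero
  have hesrc : (0 : E) ∈ e.source := ContDiffAt.mem_toOpenPartialHomeomorph_source _ hh0 one_ne_zero
  have hee : ∀ x, e x = h x := fun x => rfl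
  have hetgt : (0 : E) ∈ e.target := by
    have := e.map_source hesrc
    rwa [hee, h0] at this
  have hesymm0 : e.symm 0 = 0 := by
    have := e.left_inv hesrc
    rwa [hee, h0] at this
  have hsm : ContDiffAt ℝ 1 e.symm 0 := by
    refine e.contDiffAt_symm hetgt (f₀' := ContinuousLinearEquiv.refl ℝ E) ?_ ?_
    · rw [hesymm0]; exact hh0
    · rw [hesymm0]; exact hh.contDiffAt
  have hev1 : ∀ᶠ y in 𝓝 (0 : E), ContDiffAt ℝ 1 e.symm y := hsm.eventually (by simp)
  have hev2 : ∀ᶠ y in 𝓝 (0 : E), y ∈ e.target := e.open_target.mem_nhds hetgt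
  have hcont : ContinuousAt e.symm 0 := hsm.continuousAt
  have hev3 : ∀ᶠ y in 𝓝 (0 : E), e.symm y ∈ N :=
    hcont.eventually_mem (by rwa [hesymm0])
  have hev4 : ∀ᶠ y in 𝓝 (0 : E), ‖S.comp (fderiv ℝ f (e.symm y) - A₀)‖ < 1 := by
    have hc : Continuous fun x => ‖S.comp (fderiv ℝ f x - A₀)‖ := by
      have := hf.continuous_fderiv one_ne_zero
      fun_prop
    have h1 : ∀ᶠ x in 𝓝 (e.symm 0), ‖S.comp (fderiv ℝ f x - A₀)‖ < 1 := by
      refine hc.continuousAt.eventually_lt continuousAt_const ?_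
      simp [hesymm0, hA₀]
    exact hcont.eventually h1
  obtain ⟨r, hr, hball⟩ := Metric.eventually_nhds_iff_ball.1
    (hev1.and (hev2.and (hev3.and hev4)))
  -- The kernel of `S ∘ A₀` has dimension at least `dim E - dim P`, which leaves room for `d`
  -- parameters.
  have hK : d ≤ Module.finrank ℝ ((S.comp A₀ : E →L[ℝ] E) : E →ₗ[ℝ] E).ker := by
    have h1 := LinearMap.finrank_range_add_finrank_ker ((S.comp A₀ : E →L[ℝ] E) : E →ₗ[ℝ] E)
    have h2 : Module.finrank ℝ ((S.comp A₀ : E →L[ℝ] E) : E →ₗ[ℝ] E).range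
        ≤ Module.finrank ℝ P := by
      refine Submodule.finrank_mono ?_
      rintro _ ⟨x, rfl⟩
      exact hSP _
    omega
  obtain ⟨L, hL⟩ := exists_injective_linearMap hK
  let L' : EuclideanSpace ℝ (Fin d) →L[ℝ] E :=
    LinearMap.toContinuousLinearMap (Submodule.subtype _ ∘ₗ L)
  have hL'inj : Function.Injective L' := Subtype.val_injective.comp hL
  have hL'ker : ∀ u, S (A₀ (L' u)) = 0 := fun u => (L u).2
  obtain ⟨ε, hε, hεr⟩ : ∃ ε > 0, ∀ u ∈ Metric.ball (0 : EuclideanSpace ℝ (Fin d)) ε,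
      L' u ∈ Metric.ball (0 : E) r :=
    Metric.eventually_nhds_iff_ball.1
      (L'.continuous.continuousAt.eventually_mem (by simpa using Metric.ball_mem_nhds 0 hr))
  have hright : ∀ u ∈ Metric.ball (0 : EuclideanSpace ℝ (Fin d)) ε,
      h (e.symm (L' u)) = L' u := fun u hu => e.right_inv (hball _ (hεr u hu)).2.1
  have hSf : ∀ u ∈ Metric.ball (0 : EuclideanSpace ℝ (Fin d)) ε,
      S (f (e.symm (L' u))) = S (f 0) := by
    intro u hu
    have h1 := congrArg (fun x => S (A₀ x)) (hright u hu)
    simp only [h, map_add] at h1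
    rw [hL'ker, hSA _ (hSP _), map_sub, map_sub] at h1
    refine sub_eq_zero.1 (Eq.trans ?_ h1)
    abel
  have hdiff : ∀ u ∈ Metric.ball (0 : EuclideanSpace ℝ (Fin d)) ε,
      DifferentiableAt ℝ (fun u => e.symm (L' u)) u := fun u hu =>
    ((hball _ (hεr u hu)).1.differentiableAt one_ne_zero).comp u L'.differentiableAt
  -- Near `0` the map `S ∘ D` stays injective on `P`, so `D` maps `P` onto a space of dimension `dim
  -- P`. By the rank bound this is the whole range of `D`, hence `S` is injective on that range.
  have hinj : ∀ u ∈ Metric.ball (0 : EuclideanSpace ℝ (Fin d)) ε, ∀ x,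
      S (fderiv ℝ f (e.symm (L' u)) x) = 0 → fderiv ℝ f (e.symm (L' u)) x = 0 := by
    intro u hu
    set D := fderiv ℝ f (e.symm (L' u)) with hD
    have hlt := (hball _ (hεr u hu)).2.2.2
    have hPinj : ∀ p ∈ P, S (D p) = 0 → p = 0 := by
      intro p hp h1
      by_contra hne
      have h2 := (S.comp (D - A₀)).le_opNorm p
      simp only [ContinuousLinearMap.comp_apply, sub_apply, map_sub, h1,
        hSA p hp, zero_sub, norm_neg] at h2
      have h3 : 0 < ‖p‖ := norm_pos_iff.2 hne
      nlinarith
    have hrk : Module.finrank ℝ P ≤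
        Module.finrank ℝ (P.map (D : E →ₗ[ℝ] F)) := by
      have h1 : Function.Injective ((D : E →ₗ[ℝ] F) ∘ₗ P.subtype) := by
        rw [← LinearMap.ker_eq_bot, LinearMap.ker_eq_bot']
        intro p hp
        refine Subtype.ext (hPinj p p.2 ?_)
        have hp' : D p = 0 := hp
        rw [hp', map_zero]
      rw [← LinearMap.finrank_range_of_inj h1, LinearMap.range_comp, Submodule.range_subtype]
    have hmap : P.map (D : E →ₗ[ℝ] F) = D.range := by
      refine Submodule.eq_of_le_of_finrank_le ?_ ((hrank _).trans hrk)
      rintro _ ⟨p, -, rfl⟩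
      exact ⟨p, rfl⟩
    intro x hx
    have hxr : D x ∈ P.map (D : E →ₗ[ℝ] F) := by rw [hmap]; exact ⟨x, rfl⟩
    obtain ⟨p, hp, hpx⟩ := hxr
    have hpx' : D p = D x := hpx
    rw [← hpx'] at hx ⊢
    rw [hPinj p hp hx, map_zero]
  -- Constancy of `S ∘ f` along the family makes `S` kill the derivative of `f` there, so this
  -- derivative vanishes by `hinj`.
  have hconst : ∀ u ∈ Metric.ball (0 : EuclideanSpace ℝ (Fin d)) ε,
      f (e.symm (L' u)) = f (e.symm (L' 0)) := by
    intro u hu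
    refine Metric.isOpen_ball.is_const_of_fderiv_eq_zero (𝕜 := ℝ)
      (f := fun u => f (e.symm (L' u)))
      (convex_ball (0 : EuclideanSpace ℝ (Fin d)) ε).isPreconnected ?_ ?_ hu
      (Metric.mem_ball_self hε)
    · intro v hv
      exact ((hfd _).differentiableAt.comp v (hdiff v hv)).differentiableWithinAt
    · intro v hv
      have h1 : HasFDerivAt (fun u => f (e.symm (L' u))) _ v :=
        (hfd (e.symm (L' v))).comp v (hdiff v hv).hasFDerivAt
      have h2 := S.hasFDerivAt.comp v h1
      have h3 : HasFDerivAt (S ∘ fun u => f (e.symm (L' u))) 0 v :=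
        (hasFDerivAt_const (𝕜 := ℝ) (S (f 0)) v).congr_of_eventuallyEq
          (Filter.eventually_of_mem (Metric.isOpen_ball.mem_nhds hv) hSf)
      have h4 := h2.unique h3
      rw [h1.fderiv]
      ext1 w
      exact hinj v hv _ (by simpa using DFunLike.congr_fun h4 w)
  refine ⟨ε, hε, fun u => e.symm (L' u), fun u hu => (hdiff u hu).continuousAt.continuousWithinAt,
    fun u hu v hv huv => ?_, by simp [hesymm0], fun u hu => ⟨?_, (hball _ (hεr u hu)).2.2.1⟩⟩
  · apply hL'inj
    rw [← hright u hu, ← hright v hv]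
    exact congrArg h huv
  · rw [hconst u hu]
    simp [hesymm0]

/-! ### A slice for simultaneous conjugation. -/

section Slice

attribute [local instance] Matrix.linftyOpNormedRing Matrix.linftyOpNormedSpace
  Matrix.linftyOpNormedAddCommGroup

open Filter Topology in
/-- Near a pair of matrices with trivial centralizer, an affine slice transverse to the
infinitesimal conjugation action meets each conjugation orbit of a compact group at most once. -/
theorem exists_nhds_slice {𝕜 ι E : Type*} [RCLike 𝕜] [Fintype ι] [DecidableEq ι] [Nonempty ι]
    [NormedAddCommGroup E] [NormedSpace ℝ E] [FiniteDimensional ℝ E]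
    (G : Set (Matrix ι ι 𝕜)) (hGc : IsCompact G) (hGu : ∀ A ∈ G, IsUnit A)
    (X Y : Matrix ι ι 𝕜) (ω₁ ω₂ : E →ₗ[ℝ] Matrix ι ι 𝕜)
    (hcent : ∀ A : Matrix ι ι 𝕜, A * X = X * A → A * Y = Y * A → ∃ c : 𝕜, A = c • 1)
    (hΦ : ∀ (B : Matrix ι ι 𝕜) (e : E), B.trace = 0 → B * X - X * B + ω₁ e = 0 →
      B * Y - Y * B + ω₂ e = 0 → B = 0 ∧ e = 0) :
    ∃ N ∈ 𝓝 (0 : E), ∀ w ∈ N, ∀ w' ∈ N, ∀ A ∈ G,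
      A * (X + ω₁ w) = (X + ω₁ w') * A → A * (Y + ω₂ w) = (Y + ω₂ w') * A → w = w' := by
  -- The linearized conjugation problem. Recording the trace removes the scalar matrices, and
  -- injectivity in finite dimension gives the quantitative bound `‖p‖ ≤ K ‖Φ p‖`.
  let Φ : Matrix ι ι 𝕜 × E →ₗ[ℝ] (Matrix ι ι 𝕜 × Matrix ι ι 𝕜) × 𝕜 :=
    { toFun := fun p => ((p.1 * X - X * p.1 + ω₁ p.2, p.1 * Y - Y * p.1 + ω₂ p.2), p.1.trace)
      map_add' := by
        rintro ⟨a, b⟩ ⟨a', b'⟩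
        ext1
        · ext1 <;> simp only [Prod.mk_add_mk, add_mul, mul_add, map_add] <;> abel
        · simp [Matrix.trace_add]
      map_smul' := by
        rintro r ⟨a, b⟩
        ext1
        · ext1 <;> simp [smul_sub, smul_add]
        · simp [Matrix.trace_smul] }
  obtain ⟨K, hK0, hK⟩ := Φ.exists_antilipschitzWith <| by
    rw [LinearMap.ker_eq_bot']
    rintro ⟨B, e⟩ h
    simp only [Φ, LinearMap.coe_mk, AddHom.coe_mk, Prod.mk_eq_zero] at h
    obtain ⟨h1, h2⟩ := hΦ B e h.2 h.1.1 h.1.2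
    rw [h1, h2]; rfl
  have hK' : ∀ p, ‖p‖ ≤ K * ‖Φ p‖ := fun p => by
    simpa using hK.le_mul_dist p 0
  -- Otherwise there are conjugated slice points tending to `0`; by compactness the conjugating
  -- matrices subconverge to some `a` commuting with `X` and `Y`, hence to a nonzero scalar.
  by_contra! hcon
  have hcon' : ∀ k : ℕ, ∃ w w' : E, ∃ A, ‖w‖ < 1 / (k + 1 : ℝ) ∧ ‖w'‖ < 1 / (k + 1 : ℝ) ∧ A ∈ G ∧
      A * (X + ω₁ w) = (X + ω₁ w') * A ∧ A * (Y + ω₂ w) = (Y + ω₂ w') * A ∧ w ≠ w' := by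
    intro k
    obtain ⟨w, hw, w', hw', A, hA, h1, h2, h3⟩ :=
      hcon (Metric.ball 0 (1 / (k + 1 : ℝ))) (Metric.ball_mem_nhds _ (by positivity))
    exact ⟨w, w', A, by simpa using hw, by simpa using hw', hA, h1, h2, h3⟩
  choose w w' A hw hw' hA hX hY hne using hcon'
  have : FirstCountableTopology (Matrix ι ι 𝕜) :=
    inferInstanceAs (FirstCountableTopology (ι → ι → 𝕜))
  obtain ⟨a, haG, φ, hφ, hlim⟩ := hGc.tendsto_subseq hA
  have hzero : ∀ (v : ℕ → E), (∀ k, ‖v k‖ < 1 / (k + 1 : ℝ)) → Tendsto (v ∘ φ) atTop (𝓝 0) :=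
    fun v hv => (squeeze_zero_norm (fun k => (hv k).le)
      tendsto_one_div_add_atTop_nhds_zero_nat).comp hφ.tendsto_atTop
  have hωlim : ∀ (ω : E →ₗ[ℝ] Matrix ι ι 𝕜) (v : ℕ → E), (∀ k, ‖v k‖ < 1 / (k + 1 : ℝ)) →
      Tendsto (fun k => ω (v (φ k))) atTop (𝓝 0) := by
    intro ω v hv
    have := (LinearMap.continuous_of_finiteDimensional ω).tendsto 0
    rw [map_zero] at this
    exact this.comp (hzero v hv)
  have hcomm : ∀ (Z : Matrix ι ι 𝕜) (ω : E →ₗ[ℝ] Matrix ι ι 𝕜),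
      (∀ k, A k * (Z + ω (w k)) = (Z + ω (w' k)) * A k) → a * Z = Z * a := by
    intro Z ω h
    have h1 : Tendsto (fun k => A (φ k) * (Z + ω (w (φ k)))) atTop (𝓝 (a * (Z + 0))) :=
      hlim.mul ((hωlim ω w hw).const_add Z)
    have h2 : Tendsto (fun k => (Z + ω (w' (φ k))) * A (φ k)) atTop (𝓝 ((Z + 0) * a)) :=
      ((hωlim ω w' hw').const_add Z).mul hlim
    simp only [h] at h1
    simpa using tendsto_nhds_unique h1 h2
  obtain ⟨c, hc⟩ := hcent a (hcomm X ω₁ hX) (hcomm Y ω₂ hY)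
  have hc0 : c ≠ 0 := by
    rintro rfl
    have := hGu a haG
    rw [hc, zero_smul] at this
    exact not_isUnit_zero this
  have hcard : (Fintype.card ι : 𝕜) ≠ 0 := by exact_mod_cast Fintype.card_ne_zero
  -- Dividing `A` by its mean diagonal entry leaves the conjugation unchanged and makes `e k`
  -- traceless.
  let t : ℕ → 𝕜 := fun k => (A (φ k)).trace / Fintype.card ι
  have htlim : Tendsto t atTop (𝓝 c) := by
    have h1 : Tendsto (fun k => (A (φ k)).trace) atTop (𝓝 a.trace) :=
      ((Continuous.matrix_trace continuous_id).tendsto a).comp hlim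
    have h2 := h1.div_const (Fintype.card ι : 𝕜)
    rwa [hc, Matrix.trace_smul, Matrix.trace_one, smul_eq_mul, mul_div_cancel_right₀ _ hcard]
      at h2
  let e : ℕ → Matrix ι ι 𝕜 := fun k => (t k)⁻¹ • A (φ k) - 1
  have helim : Tendsto e atTop (𝓝 0) := by
    have h1 : Tendsto (fun k => (t k)⁻¹ • A (φ k)) atTop (𝓝 (c⁻¹ • a)) :=
      (htlim.inv₀ hc0).smul hlim
    have h2 := h1.sub_const (1 : Matrix ι ι 𝕜)
    rwa [hc, smul_smul, inv_mul_cancel₀ hc0, one_smul, sub_self] at h2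
  -- The first-order terms of the intertwining relation form `Φ`; what remains is bilinear in `e k`
  -- and the small displacements.
  have hkey : ∀ k (Z : Matrix ι ι 𝕜) (ω : E →ₗ[ℝ] Matrix ι ι 𝕜),
      (∀ k, A k * (Z + ω (w k)) = (Z + ω (w' k)) * A k) → t k ≠ 0 →
      e k * Z - Z * e k + ω (w (φ k) - w' (φ k)) = ω (w' (φ k)) * e k - e k * ω (w (φ k)) := by
    intro k Z ω h ht
    have h1 : (e k + 1) * (Z + ω (w (φ k))) = (Z + ω (w' (φ k))) * (e k + 1) := by
      simp only [e, sub_add_cancel, smul_mul_assoc, mul_smul_comm, h]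
    rw [← sub_eq_zero] at h1 ⊢
    rw [← h1, map_sub]
    noncomm_ring
  have hbound : Tendsto (fun k => (K : ℝ) * ((‖ω₁ (w' (φ k))‖ + ‖ω₁ (w (φ k))‖) +
      (‖ω₂ (w' (φ k))‖ + ‖ω₂ (w (φ k))‖))) atTop (𝓝 0) := by
    have h1 := (((hωlim ω₁ w' hw').norm.add (hωlim ω₁ w hw).norm).add
      ((hωlim ω₂ w' hw').norm.add (hωlim ω₂ w hw).norm)).const_mul (K : ℝ)
    simpa using h1
  obtain ⟨k, hk1, hk2⟩ := ((htlim.eventually_ne hc0).and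
    (hbound.eventually_lt_const one_pos)).exists
  have htr : (e k).trace = 0 := by
    simp only [e, Matrix.trace_sub, Matrix.trace_smul, Matrix.trace_one, smul_eq_mul]
    have : (A (φ k)).trace = t k * Fintype.card ι := by
      simp only [t]; field_simp
    rw [this, inv_mul_cancel_left₀ hk1, sub_self]
  have h1 := hK' (e k, w (φ k) - w' (φ k))
  have h2 : ‖Φ (e k, w (φ k) - w' (φ k))‖ ≤ ((‖ω₁ (w' (φ k))‖ + ‖ω₁ (w (φ k))‖) +
      (‖ω₂ (w' (φ k))‖ + ‖ω₂ (w (φ k))‖)) * ‖e k‖ := by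
    have hb : ∀ (ω : E →ₗ[ℝ] Matrix ι ι 𝕜), ‖ω (w' (φ k)) * e k - e k * ω (w (φ k))‖ ≤
        (‖ω (w' (φ k))‖ + ‖ω (w (φ k))‖) * ‖e k‖ := fun ω =>
      (norm_sub_le _ _).trans <| (add_le_add (norm_mul_le _ _) (norm_mul_le _ _)).trans
        (by rw [add_mul, mul_comm ‖e k‖])
    have hΦe : Φ (e k, w (φ k) - w' (φ k)) =
        ((ω₁ (w' (φ k)) * e k - e k * ω₁ (w (φ k)), ω₂ (w' (φ k)) * e k - e k * ω₂ (w (φ k))),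
          (e k).trace) := by
      rw [← hkey k X ω₁ hX hk1, ← hkey k Y ω₂ hY hk1]
      rfl
    rw [hΦe, htr]
    refine max_le (max_le ((hb ω₁).trans ?_) ((hb ω₂).trans ?_)) ?_
    · exact mul_le_mul_of_nonneg_right (le_add_of_nonneg_right (by positivity)) (norm_nonneg _)
    · exact mul_le_mul_of_nonneg_right (le_add_of_nonneg_left (by positivity)) (norm_nonneg _)
    · change ‖(0 : 𝕜)‖ ≤ _
      rw [norm_zero]
      positivity
  have h3 : ‖e k‖ ≤ ‖(e k, w (φ k) - w' (φ k))‖ := le_max_left _ _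
  have h4 : ‖w (φ k) - w' (φ k)‖ ≤ ‖(e k, w (φ k) - w' (φ k))‖ := le_max_right _ _
  have h5 := h1.trans (mul_le_mul_of_nonneg_left h2 K.2)
  rw [← mul_assoc] at h5
  -- The bound now reads `‖e k‖ ≤ θ ‖e k‖` with `θ < 1`.
  have h6 : ‖e k‖ = 0 := by
    by_contra h
    have : 0 < ‖e k‖ := lt_of_le_of_ne (norm_nonneg _) (Ne.symm h)
    nlinarith
  rw [h6, mul_zero] at h5
  exact hne (φ k) (sub_eq_zero.1 (norm_le_zero_iff.1 (h4.trans h5)))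

end Slice

/-! ### Coefficients of the characteristic polynomial along a line. -/

section CharpolyCoefficients

variable {ι : Type*} [Fintype ι] [DecidableEq ι]

theorem charpoly_coeff_eq_eval {R : Type*} [CommRing R] (M : Matrix ι ι R) (i : ℕ) :
    M.charpoly.coeff i =
      MvPolynomial.eval (fun p : ι × ι => M p.1 p.2) ((Matrix.charpoly.univ R ι).coeff i) :=
  (Matrix.charpoly.univ_coeff_eval₂Hom ι (RingHom.id R) (fun p : ι × ι => M p.1 p.2) i).symm

theorem charpoly_coeff_smul {R : Type*} [CommRing R] (c : R) (M : Matrix ι ι R) {k : ℕ}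
    (hk : k ≤ Fintype.card ι) :
    (c • M).charpoly.coeff (Fintype.card ι - k) =
      c ^ k * M.charpoly.coeff (Fintype.card ι - k) := by
  have hhom := Matrix.charpoly.univ_coeff_isHomogeneous (n := ι) R (Fintype.card ι - k) k (by omega)
  rw [charpoly_coeff_eq_eval (c • M), charpoly_coeff_eq_eval M, MvPolynomial.eval_eq',
    MvPolynomial.eval_eq', Finset.mul_sum]
  refine Finset.sum_congr rfl fun d hd => ?_
  have hdeg : ∑ i, d i = k := by
    have h := hhom (MvPolynomial.mem_support_iff.1 hd)
    rw [← h, Finsupp.weight_apply, Finsupp.sum_fintype] <;> simp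
  simp only [Matrix.smul_apply, smul_eq_mul, mul_pow, Finset.prod_mul_distrib,
    Finset.prod_pow_eq_pow_sum, hdeg]
  ring

/-- The coefficient is homogeneous of degree `k` in the matrix entries. The degree bound is why `k +
1` conditions suffice for it. -/
theorem exists_polynomial_charpoly_coeff {R : Type*} [CommRing R] [Nontrivial R]
    (A B : Matrix ι ι R) {k : ℕ} (hk : k ≤ Fintype.card ι) :
    ∃ q : Polynomial R, q.natDegree ≤ k ∧
      ∀ t, q.eval t = (A + t • B).charpoly.coeff (Fintype.card ι - k) := by
  have hhom := Matrix.charpoly.univ_coeff_isHomogeneous (n := ι) R (Fintype.card ι - k) k (by omega)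
  refine ⟨MvPolynomial.aeval (fun p : ι × ι => Polynomial.C (A p.1 p.2) +
    Polynomial.X * Polynomial.C (B p.1 p.2))
      ((Matrix.charpoly.univ R ι).coeff (Fintype.card ι - k)), ?_, fun t => ?_⟩
  · refine (MvPolynomial.aeval_natDegree_le (n := 1) _ hhom.totalDegree_le _ fun i => ?_).trans
      (by simp)
    compute_degree!
  · rw [charpoly_coeff_eq_eval (A + t • B), ← Polynomial.coe_evalRingHom, MvPolynomial.aeval_def,
      MvPolynomial.hom_eval₂, MvPolynomial.eval, MvPolynomial.coe_eval₂Hom]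
    exact congrArg₂ (fun f g => MvPolynomial.eval₂ f g
      ((Matrix.charpoly.univ R ι).coeff (Fintype.card ι - k)))
      (RingHom.ext fun x => by simp) (funext fun x => by simp; ring)

variable {𝕜 : Type*} [RCLike 𝕜]

theorem charpoly_neg_coeff {R : Type*} [CommRing R] (M : Matrix ι ι R) {k : ℕ}
    (hk : k ≤ Fintype.card ι) :
    (-M).charpoly.coeff (Fintype.card ι - k) =
      (-1) ^ k * M.charpoly.coeff (Fintype.card ι - k) := by
  rw [← charpoly_coeff_smul (-1) M hk, neg_one_smul]

/-- Conjugating the entries of a skew-Hermitian matrix gives `-Mᵀ`, and transposition preserves the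
characteristic polynomial. Thus the coefficient is real for even `k` and imaginary for odd `k`. -/
theorem star_charpoly_coeff {M : Matrix ι ι 𝕜} (hM : Mᴴ = -M) {k : ℕ}
    (hk : k ≤ Fintype.card ι) :
    star (M.charpoly.coeff (Fintype.card ι - k)) =
      (-1) ^ k * M.charpoly.coeff (Fintype.card ι - k) := by
  rw [← charpoly_neg_coeff M hk, ← hM]
  have h : Mᴴ = Matrix.map Mᵀ (starRingEnd 𝕜) := rfl
  rw [h, Matrix.charpoly_map, Matrix.charpoly_transpose, Polynomial.coeff_map]
  rfl

/-- A real number that determines the degree `k` coefficient of the characteristic polynomial of a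
skew-Hermitian matrix: that coefficient is real or purely imaginary. -/
noncomputable def charCoeff (k : ℕ) (M : Matrix ι ι 𝕜) : ℝ :=
  RCLike.re (M.charpoly.coeff (Fintype.card ι - k)) +
    RCLike.im (M.charpoly.coeff (Fintype.card ι - k))

theorem charpoly_coeff_eq_of_charCoeff_eq {M M' : Matrix ι ι 𝕜} (hM : Mᴴ = -M) (hM' : M'ᴴ = -M')
    {k : ℕ} (hk : k ≤ Fintype.card ι) (h : charCoeff k M = charCoeff k M') :
    M.charpoly.coeff (Fintype.card ι - k) = M'.charpoly.coeff (Fintype.card ι - k) := by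
  have h1 := star_charpoly_coeff hM hk
  have h2 := star_charpoly_coeff hM' hk
  unfold charCoeff at h
  generalize M.charpoly.coeff (Fintype.card ι - k) = z at *
  generalize M'.charpoly.coeff (Fintype.card ι - k) = z' at *
  rcases neg_one_pow_eq_or 𝕜 k with hs | hs <;> rw [hs] at h1 h2
  · rw [one_mul] at h1 h2
    have i1 := RCLike.conj_eq_iff_im.1 h1
    have i2 := RCLike.conj_eq_iff_im.1 h2
    refine RCLike.ext (by linarith) (by linarith)
  · have i1 := congrArg RCLike.re h1
    have i2 := congrArg RCLike.re h2
    simp only [RCLike.star_def, RCLike.conj_re, neg_mul, one_mul, map_neg] at i1 i2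
    refine RCLike.ext (by linarith) (by linarith)

/-- Interpolation at the nodes `0, ..., k` turns isospectrality on the whole plane spanned by the
pair into finitely many real equations. -/
theorem charpoly_eq_of_charCoeff_eq {D : Finset ℕ} {g : Submodule ℝ (Matrix ι ι 𝕜)}
    (hskew : ∀ X ∈ g, Xᴴ = -X)
    (hD : ∀ X ∈ g, ∀ k, 0 < k → k ≤ Fintype.card ι → k ∉ D →
      X.charpoly.coeff (Fintype.card ι - k) = 0)
    {X Y X' Y' : Matrix ι ι 𝕜} (hX : X ∈ g) (hY : Y ∈ g) (hX' : X' ∈ g) (hY' : Y' ∈ g)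
    (h : ∀ k ∈ D, ∀ i ≤ k, charCoeff k (X + (i : ℝ) • Y) = charCoeff k (X' + (i : ℝ) • Y'))
    (a b : ℝ) : (a • X + b • Y).charpoly = (a • X' + b • Y').charpoly := by
  have hmem : ∀ {Z T : Matrix ι ι 𝕜} (s t : ℝ), Z ∈ g → T ∈ g → s • Z + t • T ∈ g :=
    fun s t hZ hT => add_mem (g.smul_mem s hZ) (g.smul_mem t hT)
  have hcast : ∀ (t : ℝ) (Z : Matrix ι ι 𝕜), (t : 𝕜) • Z = t • Z := fun t Z => by
    ext i j
    simp [RCLike.real_smul_eq_coe_mul]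
  ext m
  rcases lt_trichotomy m (Fintype.card ι) with hm | rfl | hm
  · obtain ⟨k, hk0, hk, rfl⟩ : ∃ k, 0 < k ∧ k ≤ Fintype.card ι ∧ m = Fintype.card ι - k :=
      ⟨Fintype.card ι - m, by omega, by omega, by omega⟩
    by_cases hkD : k ∈ D
    · have key : ∀ t : 𝕜, (X + t • Y).charpoly.coeff (Fintype.card ι - k) =
          (X' + t • Y').charpoly.coeff (Fintype.card ι - k) := by
        obtain ⟨q, hq, hqe⟩ := exists_polynomial_charpoly_coeff X Y hk
        obtain ⟨q', hq', hqe'⟩ := exists_polynomial_charpoly_coeff X' Y' hk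
        have hqq : q = q' := by
          rw [← sub_eq_zero]
          refine Polynomial.eq_zero_of_natDegree_lt_card_of_eval_eq_zero (q - q')
            (f := fun i : Fin (k + 1) => ((i : ℕ) : 𝕜)) ?_ ?_ ?_
          · intro i j hij
            exact Fin.ext (Nat.cast_injective hij)
          · intro i
            have hi := h k hkD i (Nat.lt_succ_iff.1 i.2)
            rw [Polynomial.eval_sub, hqe, hqe', sub_eq_zero]
            have := charpoly_coeff_eq_of_charCoeff_eq
              (hskew _ (by simpa using hmem 1 (i : ℝ) hX hY))
              (hskew _ (by simpa using hmem 1 (i : ℝ) hX' hY')) hk hi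
            rw [← hcast, ← hcast] at this
            simpa using this
          · rw [Fintype.card_fin]
            exact (Polynomial.natDegree_sub_le_of_le hq hq').trans_lt (by simp)
        intro t
        rw [← hqe, ← hqe', hqq]
      -- For `s ≠ 0` homogeneity reduces `sX + bY` to the affine line already treated. Polynomial
      -- identity in `s` then covers `s = 0`, the direction that line misses.
      have key2 : ∀ s : 𝕜, s ≠ 0 → (b • Y + s • X).charpoly.coeff (Fintype.card ι - k) =
          (b • Y' + s • X').charpoly.coeff (Fintype.card ι - k) := by
        intro s hs
        have h1 : ∀ Z T : Matrix ι ι 𝕜, b • T + s • Z = s • (Z + (s⁻¹ * b) • T) := by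
          intro Z T
          rw [smul_add, smul_smul, mul_inv_cancel_left₀ hs, hcast, add_comm]
        rw [h1, h1, charpoly_coeff_smul _ _ hk, charpoly_coeff_smul _ _ hk, key]
      obtain ⟨q, hq, hqe⟩ := exists_polynomial_charpoly_coeff (b • Y) X hk
      obtain ⟨q', hq', hqe'⟩ := exists_polynomial_charpoly_coeff (b • Y') X' hk
      have hqq : q = q' := by
        refine Polynomial.eq_of_infinite_eval_eq q q' ?_
        refine Set.Infinite.mono (s := {0}ᶜ) ?_ (Set.finite_singleton (0 : 𝕜)).infinite_compl
        intro s hs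
        change q.eval s = q'.eval s
        rw [hqe, hqe', key2 s hs]
      rw [add_comm, ← hcast a X, ← hqe, hqq, hqe', hcast, add_comm]
    · rw [hD _ (hmem a b hX hY) k hk0 hk hkD, hD _ (hmem a b hX' hY') k hk0 hk hkD]
  · have h1 : ∀ Z : Matrix ι ι 𝕜, Z.charpoly.coeff (Fintype.card ι) = 1 := fun Z => by
      have := (Matrix.charpoly_monic Z).coeff_natDegree
      rwa [Matrix.charpoly_natDegree_eq_dim] at this
    rw [h1, h1]
  · rw [Polynomial.coeff_eq_zero_of_natDegree_lt, Polynomial.coeff_eq_zero_of_natDegree_lt] <;>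
      rwa [Matrix.charpoly_natDegree_eq_dim]

end CharpolyCoefficients

/-! ### Trace invariants detecting the action of `O(2)`. -/

section Invariants

variable {ι : Type*} [Fintype ι] {𝕜 : Type*} [RCLike 𝕜]

/-- An invariant of pairs of matrices which is odd under a simultaneous change of sign. -/
noncomputable def oddInv (X Y : Matrix ι ι 𝕜) : ℝ :=
  RCLike.re (X * Y * (X * X) * (Y * Y * Y)).trace

/-- An invariant of pairs of matrices which changes sign under orthogonal substitutions of
determinant `-1`: the commutator of two covariant quadratic forms. -/
noncomputable def reflInv (X Y : Matrix ι ι 𝕜) : ℝ :=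
  RCLike.re ((X * Y + Y * X) * ((X * Y - Y * X) * (X * Y - Y * X))).trace *
      (RCLike.re (X * X).trace - RCLike.re (Y * Y).trace) -
    2 * RCLike.re (X * Y).trace *
      (RCLike.re (X * X * ((X * Y - Y * X) * (X * Y - Y * X))).trace -
        RCLike.re (Y * Y * ((X * Y - Y * X) * (X * Y - Y * X))).trace)

theorem oddInv_neg (X Y : Matrix ι ι 𝕜) : oddInv (-X) (-Y) = -oddInv X Y := by
  simp [oddInv]

variable [DecidableEq ι]

theorem conj_mul_conj {A : Matrix ι ι 𝕜} (hA : A⁻¹ * A = 1) (X Y : Matrix ι ι 𝕜) :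
    A * X * A⁻¹ * (A * Y * A⁻¹) = A * (X * Y) * A⁻¹ := by
  rw [mul_assoc (A * X), mul_assoc A Y, ← mul_assoc A⁻¹, hA, one_mul]
  simp only [mul_assoc]

theorem conj_add_conj (A X Y : Matrix ι ι 𝕜) :
    A * X * A⁻¹ + A * Y * A⁻¹ = A * (X + Y) * A⁻¹ := by
  rw [mul_add, add_mul]

theorem conj_sub_conj (A X Y : Matrix ι ι 𝕜) :
    A * X * A⁻¹ - A * Y * A⁻¹ = A * (X - Y) * A⁻¹ := by
  rw [mul_sub, sub_mul]

theorem trace_conj {A : Matrix ι ι 𝕜} (hA : A⁻¹ * A = 1) (X : Matrix ι ι 𝕜) :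
    (A * X * A⁻¹).trace = X.trace := by
  rw [Matrix.trace_mul_comm, ← mul_assoc, hA, one_mul]

theorem oddInv_conj {A : Matrix ι ι 𝕜} (hA : A⁻¹ * A = 1) (X Y : Matrix ι ι 𝕜) :
    oddInv (A * X * A⁻¹) (A * Y * A⁻¹) = oddInv X Y := by
  simp only [oddInv, conj_mul_conj hA, trace_conj hA]

theorem reflInv_conj {A : Matrix ι ι 𝕜} (hA : A⁻¹ * A = 1) (X Y : Matrix ι ι 𝕜) :
    reflInv (A * X * A⁻¹) (A * Y * A⁻¹) = reflInv X Y := by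
  simp only [reflInv, conj_mul_conj hA, conj_add_conj, conj_sub_conj, trace_conj hA]

-- Here `(b, d) = δ (-c, a)` with `δ = ±1` the determinant. The commutator of the pair is multiplied
-- by `δ`, so its square `T` is unchanged, and `re tr (z²)` and `re tr (z² T)` transform as
-- quadratic forms. The commutator of their symmetric `2 × 2` matrices is skew, and its single entry
-- is multiplied by `δ`.
omit [DecidableEq ι] in
theorem reflInv_orthogonal (X Y : Matrix ι ι 𝕜) {a b c d : ℝ} (h1 : a ^ 2 + c ^ 2 = 1)
    (h2 : b ^ 2 + d ^ 2 = 1) (h3 : a * b + c * d = 0) :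
    reflInv (a • X + c • Y) (b • X + d • Y) = (a * d - b * c) * reflInv X Y := by
  obtain ⟨δ, hδ⟩ : ∃ δ, δ = a * d - b * c := ⟨_, rfl⟩
  have hb : b = -δ * c := by rw [hδ]; linear_combination (-b) * h1 + a * h3
  have hd : d = δ * a := by rw [hδ]; linear_combination (-d) * h1 + c * h3
  have hδ2 : δ ^ 2 = 1 := by
    rw [hb, hd] at h2
    linear_combination h2 - δ ^ 2 * h1
  rw [← hδ]
  clear h2 h3
  clear hδ
  subst hb hd
  have hK : (a • X + c • Y) * ((-δ * c) • X + (δ * a) • Y) -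
      ((-δ * c) • X + (δ * a) • Y) * (a • X + c • Y) = δ • (X * Y - Y * X) := by
    have h : δ • (X * Y - Y * X) = (δ * (a ^ 2 + c ^ 2)) • (X * Y - Y * X) := by rw [h1, mul_one]
    rw [h]
    simp only [add_mul, mul_add, smul_mul_assoc, mul_smul_comm]
    module
  have hKK : δ • (X * Y - Y * X) * δ • (X * Y - Y * X) =
      (X * Y - Y * X) * (X * Y - Y * X) := by
    rw [smul_mul_smul_comm, ← sq, hδ2, one_smul]
  have hXX : (a • X + c • Y) * (a • X + c • Y) =
      a ^ 2 • (X * X) + (a * c) • (X * Y + Y * X) + c ^ 2 • (Y * Y) := by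
    simp only [add_mul, mul_add, smul_mul_assoc, mul_smul_comm]
    module
  have hYY : ((-δ * c) • X + (δ * a) • Y) * ((-δ * c) • X + (δ * a) • Y) =
      c ^ 2 • (X * X) - (a * c) • (X * Y + Y * X) + a ^ 2 • (Y * Y) := by
    have h : c ^ 2 • (X * X) - (a * c) • (X * Y + Y * X) + a ^ 2 • (Y * Y) =
      δ ^ 2 • (c ^ 2 • (X * X) - (a * c) • (X * Y + Y * X) + a ^ 2 • (Y * Y)) := by
      rw [hδ2, one_smul]
    rw [h]
    simp only [add_mul, mul_add, smul_mul_assoc, mul_smul_comm]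
    module
  have hXY : (a • X + c • Y) * ((-δ * c) • X + (δ * a) • Y) +
      ((-δ * c) • X + (δ * a) • Y) * (a • X + c • Y) =
      δ • (-(2 * a * c) • (X * X) + (a ^ 2 - c ^ 2) • (X * Y + Y * X) +
        (2 * a * c) • (Y * Y)) := by
    simp only [add_mul, mul_add, smul_mul_assoc, mul_smul_comm]
    module
  have hsym : ∀ A B : Matrix ι ι 𝕜, 2 * RCLike.re (A * B).trace =
      RCLike.re (A * B + B * A).trace := fun A B => by
    rw [Matrix.trace_add, Matrix.trace_mul_comm B A, map_add, two_mul]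
  unfold reflInv
  rw [hsym, hsym X Y, hK, hKK, hXX, hYY, hXY]
  generalize (X * Y - Y * X) * (X * Y - Y * X) = T
  generalize X * X = U
  generalize Y * Y = W
  generalize X * Y + Y * X = Z
  simp only [add_mul, sub_mul, smul_mul_assoc, Matrix.trace_add, Matrix.trace_sub,
    Matrix.trace_smul, map_add, map_sub, RCLike.smul_re]
  linear_combination (δ * ((Z * T).trace |> RCLike.re) *
    (RCLike.re U.trace - RCLike.re W.trace) - δ * RCLike.re Z.trace *
    (RCLike.re (U * T).trace - RCLike.re (W * T).trace)) * (a ^ 2 + c ^ 2 + 1) * h1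

end Invariants

/-! ### Reduction of equivalence to conjugation. -/

section Equivalence

variable {ι 𝕜 : Type*} [Fintype ι] [DecidableEq ι] [RCLike 𝕜]
  {h : Type*} [NormedAddCommGroup h] [InnerProductSpace ℝ h]
  {g : LieSubalgebra ℝ (Matrix ι ι 𝕜)}

/-- For isospectral maps on which the invariants `reflInv` and `oddInv` are nonzero with equal
signs, equivalence amounts to conjugation by one element of the group. -/
theorem exists_conj_of_equivalent {G : Submonoid (Matrix ι ι 𝕜)}
    (hG : ∀ A ∈ G, A⁻¹ * A = 1) (e : OrthonormalBasis (Fin 2) ℝ h) {j j' : h →ₗ[ℝ] g}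
    (hiso : Isospectral G j j') (heq : Equivalent G j j')
    (hr : 0 < reflInv (j (e 0) : Matrix ι ι 𝕜) (j (e 1)) *
      reflInv (j' (e 0) : Matrix ι ι 𝕜) (j' (e 1)))
    (ho : 0 < oddInv (j (e 0) : Matrix ι ι 𝕜) (j (e 1)) *
      oddInv (j' (e 0) : Matrix ι ι 𝕜) (j' (e 1))) :
    ∃ A ∈ G, (j (e 0) : Matrix ι ι 𝕜) = A * (j' (e 0) : Matrix ι ι 𝕜) * A⁻¹ ∧
      (j (e 1) : Matrix ι ι 𝕜) = A * (j' (e 1) : Matrix ι ι 𝕜) * A⁻¹ := by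
  obtain ⟨A, hA, C, hC⟩ := heq
  have hAA := hG A hA
  obtain ⟨a, ha⟩ : ∃ a, a = inner ℝ (e 0) (C (e 0)) := ⟨_, rfl⟩
  obtain ⟨b, hb⟩ : ∃ a, a = inner ℝ (e 0) (C (e 1)) := ⟨_, rfl⟩
  obtain ⟨c, hc⟩ : ∃ a, a = inner ℝ (e 1) (C (e 0)) := ⟨_, rfl⟩
  obtain ⟨d, hd⟩ : ∃ a, a = inner ℝ (e 1) (C (e 1)) := ⟨_, rfl⟩
  have hC0 : C (e 0) = a • e 0 + c • e 1 := by
    rw [ha, hc, ← Fin.sum_univ_two fun i => inner ℝ (e i) (C (e 0)) • e i, e.sum_repr']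
  have hC1 : C (e 1) = b • e 0 + d • e 1 := by
    rw [hb, hd, ← Fin.sum_univ_two fun i => inner ℝ (e i) (C (e 1)) • e i, e.sum_repr']
  have e00 : inner ℝ (e 0) (e 0) = (1 : ℝ) := by simp
  have e11 : inner ℝ (e 1) (e 1) = (1 : ℝ) := by simp
  have e01 : inner ℝ (e 0) (e 1) = (0 : ℝ) := e.inner_eq_zero (by simp)
  have e10 : inner ℝ (e 1) (e 0) = (0 : ℝ) := e.inner_eq_zero (by simp)
  have h1 : a ^ 2 + c ^ 2 = 1 := by
    have := C.inner_map_map (e 0) (e 0)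
    rw [hC0] at this
    simp only [inner_add_left, inner_add_right, inner_smul_left, inner_smul_right, e00, e11, e01,
      e10] at this
    simp at this
    linarith
  have h2 : b ^ 2 + d ^ 2 = 1 := by
    have := C.inner_map_map (e 1) (e 1)
    rw [hC1] at this
    simp only [inner_add_left, inner_add_right, inner_smul_left, inner_smul_right, e00, e11, e01,
      e10] at this
    simp at this
    linarith
  have h3 : a * b + c * d = 0 := by
    have := C.inner_map_map (e 0) (e 1)
    rw [hC0, hC1] at this
    simp only [inner_add_left, inner_add_right, inner_smul_left, inner_smul_right, e00, e11, e01,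
      e10] at this
    simp at this
    linarith
  have hX := hC (e 0)
  have hY := hC (e 1)
  rw [hC0] at hX
  rw [hC1] at hY
  have hlin : ∀ s t : ℝ, ((j' (s • e 0 + t • e 1) : g) : Matrix ι ι 𝕜) =
      s • (j' (e 0) : Matrix ι ι 𝕜) + t • (j' (e 1) : Matrix ι ι 𝕜) := fun s t => by
    rw [map_add, map_smul, map_smul]
    rfl
  rw [hlin] at hX hY
  -- Isospectrality makes the two trace forms coincide, so the isometry `C` must preserve one
  -- quadratic form on the plane.
  have hq : ∀ z, RCLike.re ((j z : Matrix ι ι 𝕜) * j z).trace =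
      RCLike.re ((j' z : Matrix ι ι 𝕜) * j' z).trace := by
    intro z
    obtain ⟨B, hB, hz⟩ := hiso z
    rw [hz, conj_mul_conj (hG B hB), trace_conj (hG B hB)]
  have q0 := hq (e 0)
  have q1 := hq (e 1)
  have q2 := hq (e 0 + e 1)
  have hadd : ∀ i : h →ₗ[ℝ] g, ((i (e 0 + e 1) : g) : Matrix ι ι 𝕜) =
      (i (e 0) : Matrix ι ι 𝕜) + (i (e 1) : Matrix ι ι 𝕜) := fun i => by
    rw [map_add]
    rfl
  rw [hadd, hadd] at q2
  clear hlin hadd hq hC hiso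
  generalize (j (e 0) : Matrix ι ι 𝕜) = X at *
  generalize (j (e 1) : Matrix ι ι 𝕜) = Y at *
  generalize (j' (e 0) : Matrix ι ι 𝕜) = X' at *
  generalize (j' (e 1) : Matrix ι ι 𝕜) = Y' at *
  have hq2 : RCLike.re (X * Y).trace = RCLike.re (X' * Y').trace := by
    simp only [add_mul, mul_add, Matrix.trace_add, map_add, Matrix.trace_mul_comm Y X,
      Matrix.trace_mul_comm Y' X'] at q2
    linarith
  have hrefl : reflInv X Y = (a * d - b * c) * reflInv X' Y' := by
    rw [hX, hY, reflInv_conj hAA, reflInv_orthogonal X' Y' h1 h2 h3]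
  have hdet2 : (a * d - b * c) ^ 2 = 1 := by
    linear_combination (b ^ 2 + d ^ 2) * h1 + h2 - (a * b + c * d) * h3
  have hdet : a * d - b * c = 1 := by
    rcases mul_self_eq_one_iff.1 ((sq _).symm.trans hdet2) with h | h
    · exact h
    · rw [hrefl, h] at hr
      nlinarith [sq_nonneg (reflInv X' Y')]
  have hbc : b = -c := by linear_combination (-b) * h1 + a * h3 - c * hdet
  have hda : d = a := by linear_combination (-d) * h1 + c * h3 + a * hdet
  subst hda
  rw [hbc] at hY
  clear h2 h3 hdet hdet2
  have p0 : RCLike.re (X * X).trace = d ^ 2 * RCLike.re (X' * X').trace +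
      2 * (d * c) * RCLike.re (X' * Y').trace + c ^ 2 * RCLike.re (Y' * Y').trace := by
    rw [hX, conj_mul_conj hAA, trace_conj hAA]
    simp only [add_mul, mul_add, smul_mul_assoc, mul_smul_comm, Matrix.trace_add,
      Matrix.trace_smul, map_add, RCLike.smul_re, Matrix.trace_mul_comm Y' X']
    ring
  have p1 : RCLike.re (X * Y).trace = -(d * c) * RCLike.re (X' * X').trace +
      (d ^ 2 - c ^ 2) * RCLike.re (X' * Y').trace + (d * c) * RCLike.re (Y' * Y').trace := by
    rw [hX, hY, conj_mul_conj hAA, trace_conj hAA]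
    simp only [add_mul, mul_add, smul_mul_assoc, mul_smul_comm, Matrix.trace_add,
      Matrix.trace_smul, map_add, RCLike.smul_re, Matrix.trace_mul_comm Y' X']
    ring
  -- A rotation other than `±1` preserves only multiples of the norm form (`f3`, `f4`), and for such
  -- a form `reflInv` vanishes.
  have hc0 : c = 0 := by
    by_contra hne
    rw [q0] at p0
    rw [hq2] at p1
    have f1 : c * (RCLike.re (Y' * Y').trace - RCLike.re (X' * X').trace) +
        2 * d * RCLike.re (X' * Y').trace = 0 := by
      refine (mul_eq_zero.1 (?_ : c * _ = 0)).resolve_left hne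
      linear_combination -p0 - h1 * RCLike.re (X' * X').trace
    have f2 : d * (RCLike.re (Y' * Y').trace - RCLike.re (X' * X').trace) -
        2 * c * RCLike.re (X' * Y').trace = 0 := by
      refine (mul_eq_zero.1 (?_ : c * _ = 0)).resolve_left hne
      linear_combination -p1 - h1 * RCLike.re (X' * Y').trace
    have f3 : RCLike.re (X' * Y').trace = 0 := by
      linear_combination (d / 2) * f1 - (c / 2) * f2 - RCLike.re (X' * Y').trace * h1
    have f4 : RCLike.re (X' * X').trace - RCLike.re (Y' * Y').trace = 0 := by
      linear_combination (-c) * f1 - d * f2 -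
        (RCLike.re (X' * X').trace - RCLike.re (Y' * Y').trace) * h1
    have f5 : reflInv X' Y' = 0 := by
      simp only [reflInv, f3, f4, mul_zero, zero_mul, sub_zero]
    rw [f5, mul_zero] at hr
    exact lt_irrefl 0 hr
  subst hc0
  have hd1 : d ^ 2 = 1 := by linarith
  rcases mul_self_eq_one_iff.1 ((sq _).symm.trans hd1) with h | h
  · refine ⟨A, hA, ?_, ?_⟩
    · simpa [h] using hX
    · simpa [h] using hY
  -- The case `C = -1`, which would reverse the sign of `oddInv`.
  · exfalso
    have hX2 : X = A * (-X') * A⁻¹ := by simpa [h] using hX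
    have hY2 : Y = A * (-Y') * A⁻¹ := by simpa [h] using hY
    rw [hX2, hY2, oddInv_conj hAA, oddInv_neg] at ho
    nlinarith [sq_nonneg (oddInv X' Y')]

end Equivalence

/-! ### Polynomiality of the invariants and generic maximal rank. -/

section PolynomialInvariants

variable {V : Type*} [AddCommGroup V] [Module ℝ V] {𝕜 ι : Type*} [RCLike 𝕜] [Fintype ι]

omit [Fintype ι] in
theorem entry_mem_polyFunK (A : V →ₗ[ℝ] Matrix ι ι 𝕜) (a b : ι) :
    (fun v => A v a b) ∈ polyFunK 𝕜 V :=
  linear_mem_polyFunK ((Matrix.entryLinearMap ℝ 𝕜 a b) ∘ₗ A)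

theorem charCoeff_mem_polyFun [DecidableEq ι] (A : V →ₗ[ℝ] Matrix ι ι 𝕜) (k : ℕ) :
    (fun v => charCoeff k (A v)) ∈ polyFun V :=
  have h := charpoly_coeff_mem_polyFunK (entry_mem_polyFunK A) (Fintype.card ι - k)
  add_mem h.1 h.2

theorem oddInv_mem_polyFun (A B : V →ₗ[ℝ] Matrix ι ι 𝕜) :
    (fun v => oddInv (A v) (B v)) ∈ polyFun V :=
  have hA := entry_mem_polyFunK A
  have hB := entry_mem_polyFunK B
  (trace_mem_polyFunK <| mul_entry_mem_polyFunK (mul_entry_mem_polyFunK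
    (mul_entry_mem_polyFunK hA hB) (mul_entry_mem_polyFunK hA hA))
    (mul_entry_mem_polyFunK (mul_entry_mem_polyFunK hB hB) hB)).1

theorem reflInv_mem_polyFun (A B : V →ₗ[ℝ] Matrix ι ι 𝕜) :
    (fun v => reflInv (A v) (B v)) ∈ polyFun V := by
  have hA := entry_mem_polyFunK A
  have hB := entry_mem_polyFunK B
  have hAA := mul_entry_mem_polyFunK hA hA
  have hAB := mul_entry_mem_polyFunK hA hB
  have hBA := mul_entry_mem_polyFunK hB hA
  have hBB := mul_entry_mem_polyFunK hB hB
  have hK : ∀ a b, (fun v => (A v * B v - B v * A v) a b) ∈ polyFunK 𝕜 V := fun a b =>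
    sub_mem (hAB a b) (hBA a b)
  have hS : ∀ a b, (fun v => (A v * B v + B v * A v) a b) ∈ polyFunK 𝕜 V := fun a b =>
    add_mem (hAB a b) (hBA a b)
  have hKK := mul_entry_mem_polyFunK hK hK
  exact sub_mem
    (mul_mem (trace_mem_polyFunK (mul_entry_mem_polyFunK hS hKK)).1
      (sub_mem (trace_mem_polyFunK hAA).1 (trace_mem_polyFunK hBB).1))
    (mul_mem (mul_mem (const_mem_polyFun 2) (trace_mem_polyFunK hAB).1)
      (sub_mem (trace_mem_polyFunK (mul_entry_mem_polyFunK hAA hKK)).1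
        (trace_mem_polyFunK (mul_entry_mem_polyFunK hBB hKK)).1))

/-- The rank of the derivative along a subspace of a polynomial map is maximal on a nonempty Zariski
open set. -/
theorem exists_polyFun_maximal_rank {κ : Type*} [Fintype κ] [DecidableEq κ] {E : Type*} [NormedAddCommGroup E]
    [NormedSpace ℝ E] [FiniteDimensional ℝ E] (ω : E →ₗ[ℝ] V) (F : κ → V → ℝ)
    (hF : ∀ i, F i ∈ polyFun V) :
    ∃ (P : Submodule ℝ E) (D : V → ℝ), D ∈ polyFun V ∧ (∃ v, D v ≠ 0) ∧
      Module.finrank ℝ P ≤ Fintype.card κ ∧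
      (∀ v, Module.finrank ℝ
        (fderiv ℝ (fun x => fun i => F i (v + ω x)) 0).range ≤ Module.finrank ℝ P) ∧
      ∀ v, D v ≠ 0 → ∀ p ∈ P, fderiv ℝ (fun x => fun i => F i (v + ω x)) 0 p = 0 → p = 0 := by
  let A : V → E →ₗ[ℝ] (κ → ℝ) := fun v => fderiv ℝ (fun x => fun i => F i (v + ω x)) 0
  have hbdd : ∀ v, Module.finrank ℝ (A v).range ≤ Fintype.card κ := fun v => by
    simpa using Submodule.finrank_le (A v).range
  obtain ⟨v₁, hv₁⟩ : ∃ v₁, ∀ v, Module.finrank ℝ (A v).range ≤ Module.finrank ℝ (A v₁).range := by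
    have hfin : (Set.range fun v => Module.finrank ℝ (A v).range).Finite :=
      (Set.finite_Iic (Fintype.card κ)).subset (by rintro _ ⟨v, rfl⟩; exact hbdd v)
    obtain ⟨_, ⟨v₁, rfl⟩, h⟩ := hfin.exists_maximal (Set.range_nonempty _)
    refine ⟨v₁, fun v => ?_⟩
    by_contra hlt
    exact hlt (h ⟨v, rfl⟩ (not_le.1 hlt).le)
  -- At a point of maximal rank the derivative is injective on a complement `P` of its kernel;
  -- injectivity on this fixed `P` is then a polynomial condition on the base point.
  obtain ⟨P, hP⟩ := Submodule.exists_isCompl (A v₁).ker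
  have hdim : Module.finrank ℝ P = Module.finrank ℝ (A v₁).range := by
    have h1 := LinearMap.finrank_range_add_finrank_ker (A v₁)
    have h2 := Submodule.finrank_add_eq_of_isCompl hP
    omega
  have hcoord : ∀ v x i, A v x i = fderiv ℝ (fun x => F i (v + ω x)) 0 x := by
    intro v x i
    have h : HasFDerivAt (fun x => fun i => F i (v + ω x))
        (ContinuousLinearMap.pi fun i => fderiv ℝ (fun x => F i (v + ω x)) 0) 0 :=
      hasFDerivAt_pi.2 fun i =>
        ((contDiff_of_mem_polyFun (hF i) ω v (n := 1)).differentiable one_ne_zero 0).hasFDerivAt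
    change fderiv ℝ (fun x => fun i => F i (v + ω x)) 0 x i = _
    rw [h.fderiv]
    rfl
  obtain ⟨D, hD, hD₁, hDinj⟩ := exists_polyFun_injective (fun v => A v ∘ₗ P.subtype)
    (v₁ := v₁) (fun p l => by
      have : (fun v => l ((A v ∘ₗ P.subtype) p)) =
          ∑ i, (fun _ : V => l (Pi.single i 1)) *
            fun v => fderiv ℝ (fun x => F i (v + ω x)) 0 (p : E) := by
        ext v
        have h := congrArg l (pi_eq_sum_univ' (A v p))
        simp only [hcoord, map_sum, map_smul] at h
        rw [LinearMap.comp_apply, Submodule.subtype_apply, h, Finset.sum_apply]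
        refine Finset.sum_congr rfl fun i _ => ?_
        rw [smul_eq_mul, mul_comm]
        rfl
      rw [this]
      exact sum_mem fun i _ => mul_mem (const_mem_polyFun _) (fderiv_mem_polyFun (hF i) ω p))
    (by
      rw [← LinearMap.ker_eq_bot, LinearMap.ker_eq_bot']
      intro p hp
      exact Subtype.ext (Submodule.disjoint_def.1 hP.disjoint p hp p.2))
  refine ⟨P, D, hD, ⟨v₁, hD₁⟩, hdim ▸ hbdd v₁, fun v => hdim ▸ hv₁ v, fun v hv p hp h => ?_⟩
  have := hDinj v hv (a₁ := ⟨p, hp⟩) (a₂ := 0) (by rw [map_zero]; exact h)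
  exact congrArg Subtype.val this

end PolynomialInvariants

/-! ### The abstract deformation theorem. -/

section Deformations

variable {ι 𝕜 : Type*} [Fintype ι] [DecidableEq ι] [RCLike 𝕜]

/-- The commutator with a fixed matrix as a real linear map. -/
noncomputable def commutatorMap (X : Matrix ι ι 𝕜) : Matrix ι ι 𝕜 →ₗ[ℝ] Matrix ι ι 𝕜 :=
  LinearMap.mulRight ℝ X - LinearMap.mulLeft ℝ X

theorem commutatorMap_apply (X B : Matrix ι ι 𝕜) : commutatorMap X B = B * X - X * B := rfl

/-- The infinitesimal action on a pair of matrices together with a displacement of the pair and the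
trace. -/
noncomputable def sliceMap {E : Type*} [AddCommGroup E] [Module ℝ E] (ω₁ ω₂ : E →ₗ[ℝ] Matrix ι ι 𝕜)
    (X Y : Matrix ι ι 𝕜) :
    Matrix ι ι 𝕜 × E →ₗ[ℝ] (Matrix ι ι 𝕜 × Matrix ι ι 𝕜) × 𝕜 :=
  ((commutatorMap X ∘ₗ LinearMap.fst ℝ _ _ + ω₁ ∘ₗ LinearMap.snd ℝ _ _).prod
    (commutatorMap Y ∘ₗ LinearMap.fst ℝ _ _ + ω₂ ∘ₗ LinearMap.snd ℝ _ _)).prod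
    (Matrix.traceLinearMap ι ℝ 𝕜 ∘ₗ LinearMap.fst ℝ _ _)

theorem sliceMap_apply {E : Type*} [AddCommGroup E] [Module ℝ E] (ω₁ ω₂ : E →ₗ[ℝ] Matrix ι ι 𝕜)
    (X Y B : Matrix ι ι 𝕜) (x : E) :
    sliceMap ω₁ ω₂ X Y (B, x) = ((B * X - X * B + ω₁ x, B * Y - Y * B + ω₂ x), B.trace) := rfl

variable [Nonempty ι]

omit [Nonempty ι] in
theorem sliceMap_injective_iff {E : Type*} [AddCommGroup E] [Module ℝ E]
    (ω₁ ω₂ : E →ₗ[ℝ] Matrix ι ι 𝕜) (X Y : Matrix ι ι 𝕜) :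
    Function.Injective (sliceMap ω₁ ω₂ X Y) ↔
      ∀ (B : Matrix ι ι 𝕜) (x : E), B.trace = 0 → B * X - X * B + ω₁ x = 0 →
        B * Y - Y * B + ω₂ x = 0 → B = 0 ∧ x = 0 := by
  rw [injective_iff_map_eq_zero]
  refine ⟨fun h B x h1 h2 h3 => Prod.mk_eq_zero.1 (h (B, x) ?_), fun h p hp => ?_⟩
  · rw [sliceMap_apply, h1, h2, h3]; rfl
  · obtain ⟨B, x⟩ := p
    rw [sliceMap_apply] at hp
    simp only [Prod.mk_eq_zero] at hp
    exact Prod.mk_eq_zero.2 (h B x hp.2 hp.1.1 hp.1.2)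

/-- Subtracting from `A` the scalar with the same trace gives an element of the kernel. Hence one
open condition ensures both transversality and trivial centralizer. -/
theorem eq_smul_one_of_sliceMap_injective {E : Type*} [AddCommGroup E] [Module ℝ E]
    {ω₁ ω₂ : E →ₗ[ℝ] Matrix ι ι 𝕜} {X Y : Matrix ι ι 𝕜}
    (h : Function.Injective (sliceMap ω₁ ω₂ X Y)) (A : Matrix ι ι 𝕜) (hX : A * X = X * A)
    (hY : A * Y = Y * A) : ∃ c : 𝕜, A = c • 1 := by
  have hcard : (Fintype.card ι : 𝕜) ≠ 0 := by exact_mod_cast Fintype.card_ne_zero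
  refine ⟨A.trace / Fintype.card ι, sub_eq_zero.1
    ((sliceMap_injective_iff ω₁ ω₂ X Y).1 h _ 0 ?_ ?_ ?_).1⟩
  · rw [Matrix.trace_sub, Matrix.trace_smul, Matrix.trace_one, smul_eq_mul,
      div_mul_cancel₀ _ hcard, sub_self]
  · simp [sub_mul, mul_sub, hX]
  · simp [sub_mul, mul_sub, hY]

theorem eq_zero_of_eq_smul_one_of_trace_eq_zero {B : Matrix ι ι 𝕜} {c : 𝕜} (h : B = c • 1)
    (htr : B.trace = 0) : B = 0 := by
  have hcard : (Fintype.card ι : 𝕜) ≠ 0 := by exact_mod_cast Fintype.card_ne_zero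
  rw [h, Matrix.trace_smul, Matrix.trace_one, smul_eq_mul] at htr
  rw [h, (mul_eq_zero.1 htr).resolve_right hcard, zero_smul]

variable {g : LieSubalgebra ℝ (Matrix ι ι 𝕜)}

/-- At a pair in `g` with trivial centralizer there is a complement of the tangent space of the
conjugation orbit; its dimension is that of `g`. -/
theorem exists_slice (π : Matrix ι ι 𝕜 →ₗ[ℝ] Matrix ι ι 𝕜) (hπg : ∀ B, π B ∈ g)
    (hπid : ∀ Z ∈ g, π Z = Z) (hπlie : ∀ B, ∀ X ∈ g, π (B * X - X * B) = π B * X - X * π B)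
    (htr : ∀ Z ∈ g, Z.trace = 0) {X Y : Matrix ι ι 𝕜} (hX : X ∈ g) (hY : Y ∈ g)
    (hcent : ∀ A : Matrix ι ι 𝕜, A * X = X * A → A * Y = Y * A → ∃ c : 𝕜, A = c • 1) :
    ∃ ω : EuclideanSpace ℝ (Fin (Module.finrank ℝ g)) →ₗ[ℝ] g × g,
      Function.Injective (sliceMap (g.toSubmodule.subtype ∘ₗ LinearMap.fst ℝ g g ∘ₗ ω)
        (g.toSubmodule.subtype ∘ₗ LinearMap.snd ℝ g g ∘ₗ ω) X Y) := by
  have : FiniteDimensional ℝ (Matrix ι ι 𝕜) := Module.Finite.matrix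
  have : FiniteDimensional ℝ g := FiniteDimensional.finiteDimensional_submodule g.toSubmodule
  let a : ∀ Z ∈ g, g →ₗ[ℝ] g := fun Z hZ =>
    LinearMap.codRestrict g.toSubmodule (commutatorMap Z ∘ₗ g.toSubmodule.subtype)
      fun T => g.lie_mem T.2 hZ
  have hinj : Function.Injective ((a X hX).prod (a Y hY)) := by
    rw [injective_iff_map_eq_zero]
    intro T hT
    have h1 : (T : Matrix ι ι 𝕜) * X - X * T = 0 := congrArg Subtype.val (congrArg Prod.fst hT)
    have h2 : (T : Matrix ι ι 𝕜) * Y - Y * T = 0 := congrArg Subtype.val (congrArg Prod.snd hT)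
    obtain ⟨c, hc⟩ := hcent T (sub_eq_zero.1 h1) (sub_eq_zero.1 h2)
    exact Subtype.ext (eq_zero_of_eq_smul_one_of_trace_eq_zero hc (htr _ T.2))
  -- The tangent space of the orbit is a copy of `g` in `g × g`, so its complement `W` again has
  -- dimension `dim g`.
  obtain ⟨W, hW⟩ := Submodule.exists_isCompl ((a X hX).prod (a Y hY)).range
  have hdim : Module.finrank ℝ g = Module.finrank ℝ W := by
    have h1 := LinearMap.finrank_range_of_inj hinj
    have h2 := Submodule.finrank_add_eq_of_isCompl hW
    rw [Module.finrank_prod, h1] at h2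
    omega
  obtain ⟨L, hL⟩ := exists_injective_linearMap hdim.le
  refine ⟨W.subtype ∘ₗ L, (sliceMap_injective_iff _ _ X Y).2 fun B x hB h1 h2 => ?_⟩
  obtain ⟨w, hw⟩ : ∃ w, w = L x := ⟨_, rfl⟩
  have h1' : B * X - X * B + ((w : g × g).1 : Matrix ι ι 𝕜) = 0 := by rw [hw]; exact h1
  have h2' : B * Y - Y * B + ((w : g × g).2 : Matrix ι ι 𝕜) = 0 := by rw [hw]; exact h2
  -- `B` is an arbitrary traceless matrix. Applying the equivariant projection moves the relation
  -- into `g × g`, where `W` is transverse to the orbit; so the displacement is zero and `B` is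
  -- central.
  have k1 := congrArg π h1'
  have k2 := congrArg π h2'
  rw [map_add, map_zero, hπlie B X hX, hπid _ (w : g × g).1.2] at k1
  rw [map_add, map_zero, hπlie B Y hY, hπid _ (w : g × g).2.2] at k2
  have hsum : (a X hX).prod (a Y hY) ⟨π B, hπg B⟩ + (w : g × g) = 0 :=
    Prod.ext (Subtype.ext k1) (Subtype.ext k2)
  have hw0 : (w : g × g) = 0 := by
    refine Submodule.disjoint_def.1 hW.disjoint _ ?_ w.2
    rw [← neg_eq_of_add_eq_zero_right hsum]
    exact neg_mem ⟨_, rfl⟩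
  rw [hw0] at h1' h2'
  have h1'' : B * X - X * B = 0 := by simpa using h1'
  have h2'' : B * Y - Y * B = 0 := by simpa using h2'
  obtain ⟨c, hc⟩ := hcent B (sub_eq_zero.1 h1'') (sub_eq_zero.1 h2'')
  refine ⟨eq_zero_of_eq_smul_one_of_trace_eq_zero hc hB, hL ?_⟩
  rw [map_zero, ← hw]
  exact Subtype.ext hw0

omit [Nonempty ι] in
theorem sliceMap_mem_polyFun {V E : Type*} [AddCommGroup V] [Module ℝ V] [AddCommGroup E]
    [Module ℝ E] (ω₁ ω₂ : E →ₗ[ℝ] Matrix ι ι 𝕜) (A₁ A₂ : V →ₗ[ℝ] Matrix ι ι 𝕜)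
    (p : Matrix ι ι 𝕜 × E) (l : (Matrix ι ι 𝕜 × Matrix ι ι 𝕜) × 𝕜 →ₗ[ℝ] ℝ) :
    (fun v => l (sliceMap ω₁ ω₂ (A₁ v) (A₂ v) p)) ∈ polyFun V := by
  obtain ⟨B, x⟩ := p
  have h : (fun v => l (sliceMap ω₁ ω₂ (A₁ v) (A₂ v) (B, x))) =
      (fun v => (l ∘ₗ LinearMap.inl ℝ _ _ ∘ₗ ((-commutatorMap B ∘ₗ A₁).prod
        (-commutatorMap B ∘ₗ A₂))) v) + fun _ => l ((ω₁ x, ω₂ x), B.trace) := by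
    ext v
    rw [Pi.add_apply, LinearMap.comp_apply, ← map_add]
    congr 1
    simp [sliceMap_apply, commutatorMap_apply]
  rw [h]
  exact add_mem (linear_mem_polyFun _) (const_mem_polyFun _)

open Filter Topology in
/-- Existence of isospectral deformations for a compact matrix group `G` acting by conjugation on a
space `g` of traceless skew-Hermitian matrices with an equivariant projection, in terms of the
degrees of the nonvanishing coefficients of the characteristic polynomial. -/
theorem exists_isZariskiOpen_inIsospectralFamily (G : Submonoid (Matrix ι ι 𝕜))
    (hGc : IsCompact (G : Set (Matrix ι ι 𝕜))) (hGu : ∀ A ∈ G, IsUnit A)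
    (π : Matrix ι ι 𝕜 →ₗ[ℝ] Matrix ι ι 𝕜) (hπg : ∀ B, π B ∈ g)
    (hπid : ∀ Z ∈ g, π Z = Z) (hπlie : ∀ B, ∀ X ∈ g, π (B * X - X * B) = π B * X - X * π B)
    (htr : ∀ Z ∈ g, Z.trace = 0) (hskew : ∀ Z ∈ g, Zᴴ = -Z) (D : Finset ℕ)
    (hD : ∀ X ∈ g, ∀ k, 0 < k → k ≤ Fintype.card ι → k ∉ D →
      X.charpoly.coeff (Fintype.card ι - k) = 0)
    (hiso : ∀ S : Set (Matrix ι ι 𝕜), IsPreconnected S → (∀ X ∈ S, X ∈ g) →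
      (∀ X ∈ S, ∀ Y ∈ S, X.charpoly = Y.charpoly) →
      ∀ X ∈ S, ∀ Y ∈ S, ∃ A ∈ G, X = A * Y * A⁻¹)
    (hcent : ∃ X ∈ g, ∃ Y ∈ g, ∀ A : Matrix ι ι 𝕜, A * X = X * A → A * Y = Y * A →
      ∃ c : 𝕜, A = c • 1)
    (hrefl : ∃ X ∈ g, ∃ Y ∈ g, reflInv X Y ≠ 0) (hodd : ∃ X ∈ g, ∃ Y ∈ g, oddInv X Y ≠ 0)
    {d : ℕ} (hd : d + ∑ k ∈ D, (k + 1) ≤ Module.finrank ℝ g)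
    (h : Type u) [NormedAddCommGroup h] [InnerProductSpace ℝ h] (hh : Module.finrank ℝ h = 2) :
    ∃ O : Set (h →ₗ[ℝ] g), O.Nonempty ∧ IsZariskiOpen O ∧
      ∀ j₀ ∈ O, InIsospectralFamily G d j₀ := by
  have : FiniteDimensional ℝ (Matrix ι ι 𝕜) := Module.Finite.matrix
  have : FiniteDimensional ℝ h := FiniteDimensional.of_finrank_eq_succ hh
  let e : OrthonormalBasis (Fin 2) ℝ h := (stdOrthonormalBasis ℝ h).reindex (finCongr hh)
  let V := h →ₗ[ℝ] g
  let A₁ : V →ₗ[ℝ] Matrix ι ι 𝕜 := g.toSubmodule.subtype ∘ₗ LinearMap.applyₗ (e 0)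
  let A₂ : V →ₗ[ℝ] Matrix ι ι 𝕜 := g.toSubmodule.subtype ∘ₗ LinearMap.applyₗ (e 1)
  have hA₁ : ∀ v, A₁ v ∈ g := fun v => (v (e 0)).2
  have hA₂ : ∀ v, A₂ v ∈ g := fun v => (v (e 1)).2
  let mk : g × g →ₗ[ℝ] V := (e.toBasis.constr ℝ).toLinearMap ∘ₗ
    LinearMap.pi ![LinearMap.fst ℝ g g, LinearMap.snd ℝ g g]
  have hmk0 : ∀ p, mk p (e 0) = p.1 := fun p => by
    have := e.toBasis.constr_basis ℝ
      (LinearMap.pi ![LinearMap.fst ℝ g g, LinearMap.snd ℝ g g] p) 0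
    rwa [e.coe_toBasis] at this
  have hmk1 : ∀ p, mk p (e 1) = p.2 := fun p => by
    have := e.toBasis.constr_basis ℝ
      (LinearMap.pi ![LinearMap.fst ℝ g g, LinearMap.snd ℝ g g] p) 1
    rwa [e.coe_toBasis] at this
  have hmkA₁ : ∀ p, A₁ (mk p) = p.1 := fun p => congrArg Subtype.val (hmk0 p)
  have hmkA₂ : ∀ p, A₂ (mk p) = p.2 := fun p => congrArg Subtype.val (hmk1 p)
  have hz : ∀ (v : V) z, (v z : Matrix ι ι 𝕜) =
      inner ℝ (e 0) z • A₁ v + inner ℝ (e 1) z • A₂ v := fun v z => by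
    conv_lhs => rw [← e.sum_repr' z, Fin.sum_univ_two, map_add, map_smul, map_smul]
    rfl
  obtain ⟨X₁, hX₁, Y₁, hY₁, hc₁⟩ := hcent
  obtain ⟨ω₀, hω₀⟩ := exists_slice π hπg hπid hπlie htr hX₁ hY₁ hc₁
  let ω := mk ∘ₗ ω₀
  have hω₁ : g.toSubmodule.subtype ∘ₗ LinearMap.fst ℝ g g ∘ₗ ω₀ = A₁ ∘ₗ ω :=
    LinearMap.ext fun x => (hmkA₁ (ω₀ x)).symm
  have hω₂ : g.toSubmodule.subtype ∘ₗ LinearMap.snd ℝ g g ∘ₗ ω₀ = A₂ ∘ₗ ω :=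
    LinearMap.ext fun x => (hmkA₂ (ω₀ x)).symm
  rw [hω₁, hω₂] at hω₀
  obtain ⟨D₁, hD₁, hD₁0, hD₁inj⟩ := exists_polyFun_injective
    (fun v => sliceMap (A₁ ∘ₗ ω) (A₂ ∘ₗ ω) (A₁ v) (A₂ v))
    (fun p l => sliceMap_mem_polyFun (A₁ ∘ₗ ω) (A₂ ∘ₗ ω) A₁ A₂ p l)
    (v₁ := mk (⟨X₁, hX₁⟩, ⟨Y₁, hY₁⟩)) (by rw [hmkA₁, hmkA₂]; exact hω₀)
  -- One equation for each degree `k` in `D` and each node `0, ..., k`.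
  let κ := Σ k : D, Fin ((k : ℕ) + 1)
  let F : κ → V → ℝ := fun i v => charCoeff i.1 (A₁ v + ((i.2 : ℕ) : ℝ) • A₂ v)
  have hF : ∀ i, F i ∈ polyFun V := fun i =>
    charCoeff_mem_polyFun (A₁ + ((i.2 : ℕ) : ℝ) • A₂) i.1
  have hκ : Fintype.card κ = ∑ k ∈ D, (k + 1) := by
    simp only [κ, Fintype.card_sigma, Fintype.card_fin]
    exact Finset.sum_coe_sort D fun k => k + 1
  obtain ⟨P, D₂, hD₂, hD₂0, hPκ, hrank, hP⟩ := exists_polyFun_maximal_rank ω F hF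
  have hD₃ := reflInv_mem_polyFun A₁ A₂
  have hD₄ := oddInv_mem_polyFun A₁ A₂
  obtain ⟨X₃, hX₃, Y₃, hY₃, h₃⟩ := hrefl
  obtain ⟨X₄, hX₄, Y₄, hY₄, h₄⟩ := hodd
  have hne := exists_mul_ne_zero (mul_mem (mul_mem hD₁ hD₂) hD₃) hD₄
    (exists_mul_ne_zero (mul_mem hD₁ hD₂) hD₃
      (exists_mul_ne_zero hD₁ hD₂ ⟨_, hD₁0⟩ hD₂0)
      ⟨mk (⟨X₃, hX₃⟩, ⟨Y₃, hY₃⟩), by rwa [hmkA₁, hmkA₂]⟩)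
    ⟨mk (⟨X₄, hX₄⟩, ⟨Y₄, hY₄⟩), by rwa [hmkA₁, hmkA₂]⟩
  refine ⟨_, hne, isZariskiOpen_of_mem_polyFun
    (mul_mem (mul_mem (mul_mem hD₁ hD₂) hD₃) hD₄), fun j₀ hj₀ => ?_⟩
  replace hj₀ : D₁ j₀ * D₂ j₀ * reflInv (A₁ j₀) (A₂ j₀) * oddInv (A₁ j₀) (A₂ j₀) ≠ 0 := hj₀
  simp only [ne_eq, mul_eq_zero, not_or] at hj₀
  obtain ⟨⟨⟨hj1, hj2⟩, hj3⟩, hj4⟩ := hj₀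
  have hΦ := hD₁inj j₀ hj1
  obtain ⟨N, hN, hslice⟩ := exists_nhds_slice (G : Set (Matrix ι ι 𝕜)) hGc hGu (A₁ j₀) (A₂ j₀)
    (A₁ ∘ₗ ω) (A₂ ∘ₗ ω) (eq_smul_one_of_sliceMap_injective hΦ)
    ((sliceMap_injective_iff _ _ _ _).1 hΦ)
  -- On a small piece of the slice the two sign invariants keep the signs they have at `j₀`, as the
  -- comparison of two members of the family requires.
  have hsign : ∀ {f : V → ℝ}, f ∈ polyFun V → f j₀ ≠ 0 →
      ∀ᶠ x in 𝓝 (0 : EuclideanSpace ℝ (Fin (Module.finrank ℝ g))), 0 < f j₀ * f (j₀ + ω x) := by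
    intro f hf hf0
    have hc : Continuous fun x => f j₀ * f (j₀ + ω x) :=
      continuous_const.mul (contDiff_of_mem_polyFun hf ω j₀ (n := 1)).continuous
    refine hc.continuousAt.eventually_const_lt ?_
    simp only [map_zero, add_zero]
    exact mul_self_pos.2 hf0
  have hsmooth : ContDiff ℝ 1 fun x => fun i => F i (j₀ + ω x) :=
    contDiff_pi.2 fun i => contDiff_of_mem_polyFun (hF i) ω j₀
  obtain ⟨ε, hε, ψ, hψc, hψi, hψ0, hψ⟩ := exists_level_family hsmooth P (hP j₀ hj2)
    (fun x => by
      -- Translation identifies the derivative at `x` with the derivative at `0` based at `j₀ + ω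
      -- x`, to which the global rank bound applies.
      have hx : fderiv ℝ (fun x => fun i => F i (j₀ + ω x)) x =
          fderiv ℝ (fun y => fun i => F i (j₀ + ω x + ω y)) 0 := by
        have := fderiv_comp_add_left (𝕜 := ℝ) (f := fun x => fun i => F i (j₀ + ω x))
          (x := 0) x
        rw [add_zero] at this
        rw [← this]
        simp only [map_add, add_assoc]
      rw [hx]
      exact hrank (j₀ + ω x))
    (d := d) (by rw [finrank_euclideanSpace, Fintype.card_fin]; omega)
    (Filter.inter_mem hN (Filter.inter_mem (hsign hD₃ hj3) (hsign hD₄ hj4)))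
  let φ : EuclideanSpace ℝ (Fin d) → V := fun t => j₀ + ω (ψ t)
  have hcont : ∀ z : h, ContinuousOn (fun t => (φ t z : Matrix ι ι 𝕜)) (Metric.ball 0 ε) := by
    intro z
    have hlin : Continuous (g.toSubmodule.subtype ∘ₗ LinearMap.applyₗ z ∘ₗ ω) :=
      LinearMap.continuous_of_finiteDimensional _
    exact continuousOn_const.add (hlin.comp_continuousOn hψc)
  have hchar : ∀ s ∈ Metric.ball 0 ε, ∀ t ∈ Metric.ball 0 ε, ∀ z,
      (φ s z : Matrix ι ι 𝕜).charpoly = (φ t z : Matrix ι ι 𝕜).charpoly := by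
    intro s hs t ht z
    rw [hz, hz]
    refine charpoly_eq_of_charCoeff_eq (g := g.toSubmodule) hskew hD (hA₁ _) (hA₂ _) (hA₁ _)
      (hA₂ _) (fun k hk i hi => ?_) _ _
    have := congrFun ((hψ s hs).1.trans (hψ t ht).1.symm) ⟨⟨k, hk⟩, ⟨i, Nat.lt_succ_of_le hi⟩⟩
    exact this
  have hisospec : ∀ s ∈ Metric.ball 0 ε, ∀ t ∈ Metric.ball 0 ε, Isospectral G (φ s) (φ t) := by
    intro s hs t ht z
    refine hiso ((fun t => (φ t z : Matrix ι ι 𝕜)) '' Metric.ball 0 ε)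
      ((convex_ball 0 ε).isPreconnected.image _ (hcont z)) ?_ ?_ _ ⟨s, hs, rfl⟩ _ ⟨t, ht, rfl⟩
    · rintro _ ⟨r, -, rfl⟩
      exact (φ r z).2
    · rintro _ ⟨r, hr, rfl⟩ _ ⟨r', hr', rfl⟩
      exact hchar r hr r' hr' z
  have hpos : ∀ {a b c : ℝ}, 0 < a * b → 0 < a * c → 0 < b * c := by
    intro a b c h1 h2
    have h3 := mul_pos h1 h2
    by_contra! h4
    nlinarith [mul_nonneg (mul_self_nonneg a) (neg_nonneg.2 h4)]
  refine ⟨Metric.ball 0 ε, φ, Metric.isOpen_ball,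
    (convex_ball 0 ε).isConnected ⟨0, Metric.mem_ball_self hε⟩, hcont,
    ⟨0, Metric.mem_ball_self hε, by simp [φ, hψ0]⟩, hisospec, fun s hs t ht hst heq => hst ?_⟩
  have hinv : ∀ A ∈ G, A⁻¹ * A = 1 := fun A hA =>
    Matrix.nonsing_inv_mul A ((Matrix.isUnit_iff_isUnit_det A).1 (hGu A hA))
  obtain ⟨A, hA, h1, h2⟩ := exists_conj_of_equivalent hinv e (hisospec s hs t ht) heq
    (hpos (hψ s hs).2.2.1 (hψ t ht).2.2.1) (hpos (hψ s hs).2.2.2 (hψ t ht).2.2.2)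
  refine (hψi ht hs (hslice _ (hψ t ht).2.1 _ (hψ s hs).2.1 A hA ?_ ?_)).symm
  · change A * ((φ t) (e 0) : Matrix ι ι 𝕜) = ((φ s) (e 0) : Matrix ι ι 𝕜) * A
    rw [h1, mul_assoc _ A⁻¹, hinv A hA, mul_one]
  · change A * ((φ t) (e 1) : Matrix ι ι 𝕜) = ((φ s) (e 1) : Matrix ι ι 𝕜) * A
    rw [h2, mul_assoc _ A⁻¹, hinv A hA, mul_one]

end Deformations

/-! ### Conjugacy of skew-Hermitian matrices with a real or quaternionic structure. -/

section Conjugacy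

variable {ι : Type*} [Fintype ι] [DecidableEq ι]

theorem charpoly_smul_eq {R : Type*} [CommRing R] [Nontrivial R] (c : R) {X Y : Matrix ι ι R}
    (h : X.charpoly = Y.charpoly) : (c • X).charpoly = (c • Y).charpoly := by
  ext m
  rcases le_or_gt m (Fintype.card ι) with hm | hm
  · obtain ⟨k, hk, rfl⟩ : ∃ k, k ≤ Fintype.card ι ∧ m = Fintype.card ι - k :=
      ⟨Fintype.card ι - m, by omega, by omega⟩
    rw [charpoly_coeff_smul c X hk, charpoly_coeff_smul c Y hk, h]
  · rw [Polynomial.coeff_eq_zero_of_natDegree_lt, Polynomial.coeff_eq_zero_of_natDegree_lt] <;>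
      rwa [Matrix.charpoly_natDegree_eq_dim]

/-- Multiplication by `i` gives Hermitian matrices with the same ordered eigenvalues; composing
their diagonalizing unitaries gives the conjugation. -/
theorem exists_unitary_conj {X Y : Matrix ι ι ℂ} (hX : Xᴴ = -X) (hY : Yᴴ = -Y)
    (h : X.charpoly = Y.charpoly) :
    ∃ U ∈ Matrix.unitaryGroup ι ℂ, X = U * Y * star U := by
  have hH : ∀ {Z : Matrix ι ι ℂ}, Zᴴ = -Z → (Complex.I • Z).IsHermitian := fun hZ => by
    rw [Matrix.IsHermitian, Matrix.conjTranspose_smul, hZ]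
    simp
  have heig := (Matrix.IsHermitian.eigenvalues_eq_eigenvalues_iff (hH hX) (hH hY)).2
    (charpoly_smul_eq _ h)
  have h1 := (hH hX).spectral_theorem
  have h2 := (hH hY).spectral_theorem
  rw [heig] at h1
  rw [Unitary.conjStarAlgAut_apply] at h1 h2
  generalize (hH hX).eigenvectorUnitary = U at *
  generalize (hH hY).eigenvectorUnitary = V at *
  generalize Matrix.diagonal (RCLike.ofReal (K := ℂ) ∘ (hH hY).eigenvalues) = T at *
  have hU : star (U : Matrix ι ι ℂ) * U = 1 := Unitary.coe_star_mul_self U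
  have hV : star (V : Matrix ι ι ℂ) * V = 1 := Unitary.coe_star_mul_self V
  refine ⟨(U * star V : Matrix.unitaryGroup ι ℂ), SetLike.coe_mem _, ?_⟩
  have hI : Function.Injective fun Z : Matrix ι ι ℂ => Complex.I • Z :=
    smul_right_injective _ Complex.I_ne_zero
  apply hI
  change Complex.I • X = Complex.I • _
  rw [← smul_mul_assoc, ← mul_smul_comm, h2, h1]
  simp only [Unitary.coe_star, Submonoid.coe_mul, star_mul, star_star]
  calc (U : Matrix ι ι ℂ) * T * star U
      = U * 1 * T * 1 * star U := by simp
    _ = U * (star (V : Matrix ι ι ℂ) * V) * T * (star (V : Matrix ι ι ℂ) * V) * star U := by rw [hV]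
    _ = _ := by
        simp only [mul_assoc]
        rfl

open scoped ComplexOrder in
/-- A positive semidefinite matrix has a Hermitian square root which is a real polynomial in it. -/
theorem exists_sqrt_mem_adjoin {S : Matrix ι ι ℂ} (hS : S.PosSemidef) :
    ∃ R ∈ Algebra.adjoin ℝ {S}, Rᴴ = R ∧ R * R = S := by
  have hH := hS.isHermitian
  -- A real polynomial agreeing with the square root on the spectrum.
  let q : Polynomial ℝ := Lagrange.interpolate (Finset.univ.image hH.eigenvalues) id Real.sqrt
  have hq : ∀ i, q.eval (hH.eigenvalues i) = √(hH.eigenvalues i) := fun i =>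
    Lagrange.eval_interpolate_at_node (v := id) Real.sqrt Function.injective_id.injOn
      (Finset.mem_image_of_mem _ (Finset.mem_univ i))
  have hdiag : ∀ v : ι → ℝ, Polynomial.aeval (Matrix.diagonal fun i => (v i : ℂ)) q =
      Matrix.diagonal fun i => ((q.eval (v i) : ℝ) : ℂ) := by
    intro v
    have h1 := Polynomial.aeval_algHom_apply (Matrix.diagonalAlgHom ℝ (n := ι) (α := ℂ))
      (fun i => (v i : ℂ)) q
    rw [Matrix.diagonalAlgHom_apply] at h1
    rw [h1, Matrix.diagonalAlgHom_apply]
    congr 1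
    ext i
    have h2 := Polynomial.aeval_algHom_apply (Pi.evalAlgHom ℝ (fun _ : ι => ℂ) i)
      (fun i => (v i : ℂ)) q
    rw [Pi.evalAlgHom_apply, Pi.evalAlgHom_apply] at h2
    rw [← h2]
    have h3 := Polynomial.aeval_algebraMap_apply ℂ (v i) q
    simpa using h3
  have hspec := hH.spectral_theorem
  rw [Unitary.conjStarAlgAut_apply] at hspec
  have hU : star (hH.eigenvectorUnitary : Matrix ι ι ℂ) * hH.eigenvectorUnitary = 1 :=
    Unitary.coe_star_mul_self _
  have hU' : (hH.eigenvectorUnitary : Matrix ι ι ℂ) * star (hH.eigenvectorUnitary : Matrix ι ι ℂ) = 1 :=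
    Unitary.coe_mul_star_self _
  have hR : Polynomial.aeval S q = (hH.eigenvectorUnitary : Matrix ι ι ℂ) *
      Matrix.diagonal (fun i => ((√(hH.eigenvalues i) : ℝ) : ℂ)) *
      star (hH.eigenvectorUnitary : Matrix ι ι ℂ) := by
    have h1 := Polynomial.aeval_algHom_apply
      ((Unitary.conjStarAlgAut ℂ (Matrix ι ι ℂ) hH.eigenvectorUnitary).toAlgEquiv.toAlgHom.restrictScalars ℝ)
      (Matrix.diagonal fun i => (hH.eigenvalues i : ℂ)) q
    rw [hdiag] at h1
    simp only [hq] at h1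
    refine Eq.trans ?_ (h1.trans ?_)
    · exact congrArg (fun Z => Polynomial.aeval Z q) hH.spectral_theorem
    · rfl
  refine ⟨Polynomial.aeval S q, Polynomial.aeval_mem_adjoin_singleton _ _, ?_, ?_⟩
  · rw [hR, Matrix.star_eq_conjTranspose]
    simp only [Matrix.conjTranspose_mul, Matrix.conjTranspose_conjTranspose,
      Matrix.diagonal_conjTranspose, mul_assoc]
    congr 3
    ext i
    simp
  · rw [hR]
    conv_rhs => rw [hspec]
    generalize (hH.eigenvectorUnitary : Matrix ι ι ℂ) = U at *
    calc _ = U * Matrix.diagonal (fun i => ((√(hH.eigenvalues i) : ℝ) : ℂ)) * (star U * U) *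
          Matrix.diagonal (fun i => ((√(hH.eigenvalues i) : ℝ) : ℂ)) * star U := by
          simp only [mul_assoc]
      _ = _ := by
          rw [hU, mul_one, mul_assoc U, Matrix.diagonal_mul_diagonal]
          congr 3
          ext i
          rw [Function.comp_apply, ← Complex.ofReal_mul,
            Real.mul_self_sqrt (hS.eigenvalues_nonneg i)]
          rfl

/-- The real algebra of complex matrices commuting with the antilinear operator `v ↦ K (conj v)`. -/
def antilinearCentralizer (K : Matrix ι ι ℂ) : Subalgebra ℝ (Matrix ι ι ℂ) where
  carrier := {A | K * A.map (starRingEnd ℂ) = A * K}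
  mul_mem' := by
    intro A B hA hB
    change K * (A * B).map (starRingEnd ℂ) = _
    rw [Matrix.map_mul, ← mul_assoc, hA, mul_assoc, hB, mul_assoc]
  add_mem' := by
    intro A B hA hB
    change K * (A + B).map (starRingEnd ℂ) = _
    rw [Matrix.map_add _ (map_add _), mul_add, hA, hB, add_mul]
  algebraMap_mem' r := by
    have h : (algebraMap ℝ (Matrix ι ι ℂ) r) = (r : ℂ) • 1 := by
      rw [Algebra.algebraMap_eq_smul_one]
      ext i j
      simp
    have h2 : ((r : ℂ) • (1 : Matrix ι ι ℂ)).map (starRingEnd ℂ) = (r : ℂ) • 1 := by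
      ext i j
      by_cases hij : i = j <;> simp [hij]
    change K * (algebraMap ℝ (Matrix ι ι ℂ) r).map (starRingEnd ℂ) = _ * K
    rw [h, h2]
    simp

theorem mem_antilinearCentralizer {K A : Matrix ι ι ℂ} :
    A ∈ antilinearCentralizer K ↔ K * A.map (starRingEnd ℂ) = A * K := Iff.rfl

omit [Fintype ι] [DecidableEq ι] in
theorem map_conj_map_conj (A : Matrix ι ι ℂ) :
    (A.map (starRingEnd ℂ)).map (starRingEnd ℂ) = A := by
  ext i j
  simp

omit [DecidableEq ι] in
theorem map_conj_mul (A B : Matrix ι ι ℂ) : (A * B).map (starRingEnd ℂ) =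
    A.map (starRingEnd ℂ) * B.map (starRingEnd ℂ) := Matrix.map_mul

omit [Fintype ι] [DecidableEq ι] in
theorem map_conj_eq {A : Matrix ι ι ℂ} : A.map (starRingEnd ℂ) = Aᴴᵀ := by
  ext i j
  simp

section Structure

variable {K : Matrix ι ι ℂ} {ε : ℝ} (hε : ε * ε = 1) (hK : K.map (starRingEnd ℂ) = K)
  (hKK : K * K = ε • 1) (hKs : Kᴴ = ε • K)

include hε hKK in
theorem map_conj_mul_eq {A : Matrix ι ι ℂ} (hA : A ∈ antilinearCentralizer K) :
    A.map (starRingEnd ℂ) * K = K * A := by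
  have h := congrArg (fun Z => ε • (K * Z * K)) (mem_antilinearCentralizer.1 hA)
  beta_reduce at h
  rw [← mul_assoc K K, hKK, mul_assoc K (A * K), mul_assoc A K, hKK] at h
  simpa [smul_smul, hε] using h

include hε hKK hKs in
theorem conjTranspose_mem_antilinearCentralizer {A : Matrix ι ι ℂ}
    (hA : A ∈ antilinearCentralizer K) : Aᴴ ∈ antilinearCentralizer K := by
  have h := congrArg (fun Z => ε • Zᴴ) (map_conj_mul_eq hε hKK hA)
  simp only [Matrix.conjTranspose_mul, hKs] at h
  rw [smul_mul_assoc, mul_smul_comm, smul_smul, smul_smul, hε, one_smul, one_smul] at h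
  rw [mem_antilinearCentralizer, ← h]
  congr 1

theorem inv_mem_antilinearCentralizer {A B : Matrix ι ι ℂ} (hAB : A * B = 1)
    (hA : A ∈ antilinearCentralizer K) : B ∈ antilinearCentralizer K := by
  have hBA : B * A = 1 := mul_eq_one_comm.1 hAB
  rw [mem_antilinearCentralizer] at hA ⊢
  have h : A.map (starRingEnd ℂ) * B.map (starRingEnd ℂ) = 1 := by
    rw [← map_conj_mul, hAB]
    ext i j
    simp [Matrix.one_apply, apply_ite]
  calc K * B.map (starRingEnd ℂ) = B * (A * K) * B.map (starRingEnd ℂ) := by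
        rw [← mul_assoc B, hBA, one_mul]
    _ = B * K := by rw [← hA, mul_assoc B, mul_assoc K, h, mul_one]

include hε hK hKK in
/-- Symmetrization with respect to the antilinear structure `K`. -/
theorem add_conj_mem_antilinearCentralizer (U : Matrix ι ι ℂ) :
    U + ε • (K * U.map (starRingEnd ℂ) * K) ∈ antilinearCentralizer K := by
  have h : (U + ε • (K * U.map (starRingEnd ℂ) * K)).map (starRingEnd ℂ) =
      U.map (starRingEnd ℂ) + ε • (K * U * K) := by
    have h2 : ∀ Z : Matrix ι ι ℂ, (ε • Z).map (starRingEnd ℂ) = ε • Z.map (starRingEnd ℂ) :=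
      fun Z => by ext i j; simp
    rw [Matrix.map_add _ (map_add _), h2, map_conj_mul, map_conj_mul, hK, map_conj_map_conj]
  rw [mem_antilinearCentralizer, h, mul_add, add_mul, mul_smul_comm, smul_mul_assoc,
    mul_assoc (K * U.map (starRingEnd ℂ)) K K, hKK, mul_assoc K U K, ← mul_assoc K K, hKK]
  simp only [smul_mul_assoc, mul_smul_comm, one_mul, mul_one, smul_smul, hε, one_smul]
  rw [add_comm]

open scoped ComplexOrder in
include hε hK hKK hKs in
/-- Skew-Hermitian matrices compatible with the antilinear structure `K` and with the same
characteristic polynomial are conjugate by a compatible unitary matrix. -/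
theorem exists_compatible_unitary_conj {X Y : Matrix ι ι ℂ} (hX : Xᴴ = -X) (hY : Yᴴ = -Y)
    (hXK : X ∈ antilinearCentralizer K) (hYK : Y ∈ antilinearCentralizer K)
    (h : X.charpoly = Y.charpoly) :
    ∃ O ∈ antilinearCentralizer K, O ∈ Matrix.unitaryGroup ι ℂ ∧ X = O * Y * star O := by
  obtain ⟨U, hU, hXU⟩ := exists_unitary_conj hX hY h
  have hUU : star U * U = 1 := Matrix.mem_unitaryGroup_iff'.1 hU
  have hint : X * U = U * Y := by rw [hXU, mul_assoc, hUU, mul_one]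
  let σ : Matrix ι ι ℂ → Matrix ι ι ℂ := fun U => ε • (K * U.map (starRingEnd ℂ) * K)
  have hσ : X * σ U = σ U * Y := by
    have h1 := congrArg (fun Z => ε • (K * Z.map (starRingEnd ℂ) * K)) hint
    simp only [map_conj_mul] at h1
    rw [← mul_assoc K, mem_antilinearCentralizer.1 hXK, ← mul_assoc K,
      mul_assoc (K * U.map (starRingEnd ℂ)) _ K, map_conj_mul_eq hε hKK hYK] at h1
    simpa only [σ, mul_smul_comm, smul_mul_assoc, mul_assoc] using h1
  have hσI : σ (Complex.I • U) = -(Complex.I • σ U) := by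
    have h1 : (Complex.I • U).map (starRingEnd ℂ) = -(Complex.I • U.map (starRingEnd ℂ)) := by
      ext i j; simp
    simp only [σ, h1, mul_neg, neg_mul, mul_smul_comm, smul_mul_assoc, smul_neg]
    rw [smul_comm]
  -- `P` and `Q` are compatible intertwiners with `P - iQ = 2U`. Thus `det (P + zQ)` is nonzero at
  -- `z = -i`, and as a polynomial in `z` it cannot vanish at every real `z`.
  obtain ⟨P, hP⟩ : ∃ P, P = U + σ U := ⟨_, rfl⟩
  obtain ⟨Q, hQ⟩ : ∃ Q, Q = Complex.I • U + σ (Complex.I • U) := ⟨_, rfl⟩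
  have hPK : P ∈ antilinearCentralizer K := hP ▸ add_conj_mem_antilinearCentralizer hε hK hKK U
  have hQK : Q ∈ antilinearCentralizer K := hQ ▸ add_conj_mem_antilinearCentralizer hε hK hKK _
  have hPi : X * P = P * Y := by rw [hP, mul_add, add_mul, hint, hσ]
  have hQi : X * Q = Q * Y := by
    rw [hQ, hσI]
    simp only [mul_add, add_mul, mul_neg, neg_mul, mul_smul_comm, smul_mul_assoc, hint, hσ]
  obtain ⟨t, ht⟩ : ∃ t : ℝ, (P + (t : ℂ) • Q).det ≠ 0 := by
    by_contra! hcon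
    let q : Polynomial ℂ := (P.map (Polynomial.C (R := ℂ)) +
      Polynomial.X (R := ℂ) • Q.map (Polynomial.C (R := ℂ))).det
    have hq : ∀ z : ℂ, q.eval z = (P + z • Q).det := by
      intro z
      simp only [q]
      rw [← Polynomial.coe_evalRingHom, RingHom.map_det]
      congr 1
      ext i j
      simp [mul_comm z]
    have hq0 : q = 0 := by
      refine Polynomial.eq_zero_of_infinite_isRoot q
        ((Set.infinite_range_of_injective Complex.ofReal_injective).mono ?_)
      rintro _ ⟨t, rfl⟩
      exact (hq t).trans (hcon t)
    have h1 := hq (-Complex.I)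
    have h2 : P + (-Complex.I) • Q = (2 : ℂ) • U := by
      rw [hP, hQ, hσI, smul_add, smul_neg, smul_smul, smul_smul]
      simp only [neg_mul, Complex.I_mul_I, neg_neg, one_smul]
      rw [two_smul]
      abel
    have h3 : U.det ≠ 0 := by
      intro h0
      have := congrArg Matrix.det hUU
      rw [Matrix.det_mul, h0, mul_zero, Matrix.det_one] at this
      exact zero_ne_one this
    rw [hq0, h2, Matrix.det_smul, Polynomial.eval_zero] at h1
    exact mul_ne_zero (pow_ne_zero _ two_ne_zero) h3 h1.symm
  obtain ⟨B, hB⟩ : ∃ B, B = P + (t : ℂ) • Q := ⟨_, rfl⟩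
  rw [← hB] at ht
  have hBK : B ∈ antilinearCentralizer K := by
    have h1 : (t : ℂ) • Q = t • Q := by ext i j; simp
    rw [hB, h1]
    exact add_mem hPK (Subalgebra.smul_mem _ hQK t)
  have hBi : X * B = B * Y := by
    rw [hB, mul_add, add_mul, hPi, mul_smul_comm, hQi, smul_mul_assoc]
  have hBi' : Bᴴ * X = Y * Bᴴ := by
    have := congrArg Matrix.conjTranspose hBi
    rw [Matrix.conjTranspose_mul, Matrix.conjTranspose_mul, hX, hY] at this
    simpa using this
  -- Polar decomposition of the invertible intertwiner `B`. Since `R` is a real polynomial in `BᴴB`,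
  -- it is compatible with `K` and commutes with `Y`, so the unitary factor `B * R⁻¹` is still a
  -- compatible intertwiner.
  obtain ⟨R, hR, hRH, hRR⟩ := exists_sqrt_mem_adjoin (Matrix.posSemidef_conjTranspose_mul_self B)
  have hRK : R ∈ antilinearCentralizer K := by
    refine Algebra.adjoin_le (S := antilinearCentralizer K) ?_ hR
    rw [Set.singleton_subset_iff]
    exact mul_mem (conjTranspose_mem_antilinearCentralizer hε hKK hKs hBK) hBK
  have hRY : Y * R = R * Y := by
    have : R ∈ Subalgebra.centralizer ℝ {Y} := by
      refine Algebra.adjoin_le ?_ hR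
      rw [Set.singleton_subset_iff, SetLike.mem_coe, Subalgebra.mem_centralizer_iff]
      rintro _ rfl
      rw [mul_assoc, ← hBi, ← mul_assoc, ← mul_assoc, hBi']
    exact (Subalgebra.mem_centralizer_iff ℝ).1 this Y rfl
  have hRdet : IsUnit R.det := by
    rw [isUnit_iff_ne_zero]
    intro h0
    have h1 := congrArg Matrix.det hRR
    rw [Matrix.det_mul, Matrix.det_mul, h0, Matrix.det_conjTranspose, mul_zero] at h1
    exact mul_ne_zero (star_ne_zero.2 ht) ht h1.symm
  have hR1 : R * R⁻¹ = 1 := Matrix.mul_nonsing_inv R hRdet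
  have hR2 : R⁻¹ * R = 1 := Matrix.nonsing_inv_mul R hRdet
  have hRiH : (R⁻¹)ᴴ = R⁻¹ := by rw [Matrix.conjTranspose_nonsing_inv, hRH]
  have hRiY : R⁻¹ * Y = Y * R⁻¹ := by
    calc R⁻¹ * Y = R⁻¹ * (Y * R) * R⁻¹ := by rw [mul_assoc, mul_assoc, hR1, mul_one]
      _ = Y * R⁻¹ := by rw [hRY, ← mul_assoc, hR2, one_mul]
  have hO : star (B * R⁻¹) * (B * R⁻¹) = 1 := by
    rw [Matrix.star_eq_conjTranspose, Matrix.conjTranspose_mul, hRiH, mul_assoc, ← mul_assoc Bᴴ,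
      ← hRR, mul_assoc R, hR1, mul_one, hR2]
  have hOi : X * (B * R⁻¹) = B * R⁻¹ * Y := by
    rw [mul_assoc B, hRiY, ← mul_assoc, hBi, mul_assoc]
  refine ⟨B * R⁻¹, mul_mem hBK (inv_mem_antilinearCentralizer hR1 hRK),
    Matrix.mem_unitaryGroup_iff'.2 hO, ?_⟩
  rw [← hOi, mul_assoc, mul_eq_one_comm.1 hO, mul_one]

end Structure

/-- A closed set of unitary matrices is compact. -/
theorem isCompact_of_isClosed_of_unitary {𝕜 : Type*} [RCLike 𝕜] {S : Set (Matrix ι ι 𝕜)}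
    (hS : IsClosed S) (hU : ∀ A ∈ S, A ∈ Matrix.unitaryGroup ι 𝕜) : IsCompact S := by
  have hc : IsCompact (Set.univ.pi fun _ : ι => Set.univ.pi fun _ : ι =>
      Metric.closedBall (0 : 𝕜) 1) :=
    isCompact_univ_pi fun _ => isCompact_univ_pi fun _ => isCompact_closedBall 0 1
  refine IsCompact.of_isClosed_subset hc hS fun A hA => ?_
  intro i _ j _
  simpa using entry_norm_bound_of_unitary (hU A hA) i j

end Conjugacy

/-! ### Tools for explicit witnesses and for counting equations. -/

section Evaluation

variable {ι α β : Type*} [Fintype ι] [Fintype α] [Fintype β] {𝕜 : Type*} [RCLike 𝕜]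

/-- Extension of a square matrix by zero. -/
def blockEmbed (e : ι ≃ α ⊕ β) (M : Matrix α α 𝕜) : Matrix ι ι 𝕜 :=
  (Matrix.fromBlocks M 0 0 0).submatrix e e

theorem blockEmbed_mul (e : ι ≃ α ⊕ β) (M N : Matrix α α 𝕜) :
    blockEmbed e M * blockEmbed e N = blockEmbed e (M * N) := by
  simp [blockEmbed, Matrix.submatrix_mul_equiv, Matrix.fromBlocks_multiply]

omit [Fintype ι] [Fintype α] [Fintype β] in
theorem blockEmbed_add (e : ι ≃ α ⊕ β) (M N : Matrix α α 𝕜) :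
    blockEmbed e M + blockEmbed e N = blockEmbed e (M + N) := by
  change (Matrix.fromBlocks M 0 0 0 + Matrix.fromBlocks N 0 0 0).submatrix e e = _
  rw [Matrix.fromBlocks_add, add_zero, add_zero, add_zero, blockEmbed]

omit [Fintype ι] [Fintype α] [Fintype β] in
theorem blockEmbed_sub (e : ι ≃ α ⊕ β) (M N : Matrix α α 𝕜) :
    blockEmbed e M - blockEmbed e N = blockEmbed e (M - N) := by
  rw [sub_eq_iff_eq_add, blockEmbed_add, sub_add_cancel]

theorem trace_blockEmbed (e : ι ≃ α ⊕ β) (M : Matrix α α 𝕜) :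
    (blockEmbed e M).trace = M.trace := by
  have h : (blockEmbed e M).trace = ∑ i : α ⊕ β, Matrix.fromBlocks M 0 0 0 i i :=
    Equiv.sum_comp e fun i => Matrix.fromBlocks M 0 0 0 i i
  rw [h, Fintype.sum_sum_type]
  simp [Matrix.trace]

omit [Fintype ι] [Fintype α] [Fintype β] in
theorem transpose_blockEmbed (e : ι ≃ α ⊕ β) (M : Matrix α α 𝕜) :
    (blockEmbed e M)ᵀ = blockEmbed e Mᵀ := by
  simp [blockEmbed, Matrix.transpose_submatrix, Matrix.fromBlocks_transpose]

omit [Fintype ι] [Fintype α] [Fintype β] in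
theorem neg_blockEmbed (e : ι ≃ α ⊕ β) (M : Matrix α α 𝕜) :
    -blockEmbed e M = blockEmbed e (-M) := by
  rw [neg_eq_iff_add_eq_zero, blockEmbed_add, add_neg_cancel]
  simp [blockEmbed]

omit [Fintype ι] [Fintype α] [Fintype β] in
theorem conjTranspose_blockEmbed (e : ι ≃ α ⊕ β) (M : Matrix α α 𝕜) :
    (blockEmbed e M)ᴴ = blockEmbed e Mᴴ := by
  simp [blockEmbed, Matrix.conjTranspose_submatrix, Matrix.fromBlocks_conjTranspose]

theorem oddInv_blockEmbed (e : ι ≃ α ⊕ β) (M N : Matrix α α 𝕜) :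
    oddInv (blockEmbed e M) (blockEmbed e N) = oddInv M N := by
  simp only [oddInv, blockEmbed_mul, trace_blockEmbed]

theorem reflInv_blockEmbed (e : ι ≃ α ⊕ β) (M N : Matrix α α 𝕜) :
    reflInv (blockEmbed e M) (blockEmbed e N) = reflInv M N := by
  simp only [reflInv, blockEmbed_mul, blockEmbed_add, blockEmbed_sub, trace_blockEmbed]

theorem trace_mapMatrix {R S : Type*} [Ring R] [Ring S] [DecidableEq ι] (f : R →+* S)
    (M : Matrix ι ι R) : (f.mapMatrix M).trace = f M.trace :=
  (AddMonoidHom.map_trace f M).symm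

/-- Transfers the evaluation to a ring with decidable equality, such as the integers or Gaussian
integers. -/
theorem oddInv_mapMatrix {R : Type*} [CommRing R] [DecidableEq ι] (f : R →+* 𝕜)
    (X Y : Matrix ι ι R) : oddInv (f.mapMatrix X) (f.mapMatrix Y) =
      RCLike.re (f (X * Y * (X * X) * (Y * Y * Y)).trace) := by
  simp only [oddInv, ← map_mul, trace_mapMatrix]

theorem reflInv_mapMatrix {R : Type*} [CommRing R] [DecidableEq ι] (f : R →+* 𝕜)
    (X Y : Matrix ι ι R) : reflInv (f.mapMatrix X) (f.mapMatrix Y) =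
      RCLike.re (f ((X * Y + Y * X) * ((X * Y - Y * X) * (X * Y - Y * X))).trace) *
        (RCLike.re (f (X * X).trace) - RCLike.re (f (Y * Y).trace)) -
      2 * RCLike.re (f (X * Y).trace) *
        (RCLike.re (f (X * X * ((X * Y - Y * X) * (X * Y - Y * X))).trace) -
          RCLike.re (f (Y * Y * ((X * Y - Y * X) * (X * Y - Y * X))).trace)) := by
  simp only [reflInv, ← map_mul, ← map_add, ← map_sub, trace_mapMatrix]

theorem charpoly_coeff_eq_zero_of_odd [DecidableEq ι] {M : Matrix ι ι 𝕜}
    (h : (-M).charpoly = M.charpoly) {k : ℕ} (hk : k ≤ Fintype.card ι) (hodd : Odd k) :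
    M.charpoly.coeff (Fintype.card ι - k) = 0 := by
  have h1 := charpoly_neg_coeff M hk
  rw [h, hodd.neg_one_pow, neg_one_mul] at h1
  exact self_eq_neg.1 h1

theorem card_sigma_fin (n : ℕ) : Fintype.card (Σ i : Fin n, Fin i) * 2 = n * (n - 1) := by
  rw [Fintype.card_sigma]
  simp only [Fintype.card_fin]
  rw [Fin.sum_univ_eq_sum_range (fun i => i) n, Finset.sum_range_id_mul_two]

/-- The count of equations when only even degrees occur: `3 + 5 + ... + (2m + 1)`. -/
theorem sum_image_two_mul (m : ℕ) :
    ∑ k ∈ (Finset.Icc 1 m).image (2 * ·), (k + 1) = m * (m + 2) := by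
  rw [Finset.sum_image (by intro a _ b _ h; simpa using h)]
  induction m with
  | zero => simp
  | succ m ih =>
    rw [Finset.sum_Icc_succ_top (by omega), ih]
    ring

theorem odd_of_notMem_image {N m k : ℕ} (hN : N / 2 ≤ m) (h0 : 0 < k) (hk : k ≤ N)
    (h : k ∉ (Finset.Icc 1 m).image (2 * ·)) : Odd k := by
  by_contra hodd
  obtain ⟨r, rfl⟩ := Nat.not_odd_iff_even.1 hodd
  exact h (Finset.mem_image.2 ⟨r, by simp; omega, by omega⟩)

end Evaluation

/-! ### The orthogonal algebras. -/

section Orthogonal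

open LieAlgebra.Orthogonal

variable {n : ℕ}

theorem finrank_so_ge (n : ℕ) :
    n * (n - 1) ≤ Module.finrank ℝ (so (Fin n) ℝ) * 2 := by
  rw [← card_sigma_fin]
  refine Nat.mul_le_mul_right 2 ?_
  let f : ((Σ i : Fin n, Fin i) → ℝ) →ₗ[ℝ] Matrix (Fin n) (Fin n) ℝ :=
    { toFun := fun v => Matrix.of fun i j =>
        if h : j < i then v ⟨i, ⟨j, h⟩⟩ else if h : i < j then -v ⟨j, ⟨i, h⟩⟩ else 0
      map_add' := fun v w => by
        ext i j
        simp only [Matrix.of_apply, Matrix.add_apply, Pi.add_apply]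
        split_ifs <;> ring
      map_smul' := fun c v => by
        ext i j
        simp only [Matrix.of_apply, Matrix.smul_apply, Pi.smul_apply, smul_eq_mul,
          RingHom.id_apply]
        split_ifs <;> ring }
  have hf : ∀ v, f v ∈ (so (Fin n) ℝ).toSubmodule := by
    intro v
    refine (mem_so _ _ _).2 ?_
    ext i j
    simp only [f, LinearMap.coe_mk, AddHom.coe_mk, Matrix.transpose_apply, Matrix.neg_apply,
      Matrix.of_apply]
    rcases lt_trichotomy i j with h | h | h
    · simp [h, h.not_gt]
    · simp [h]
    · simp [h, h.not_gt]
  have hinj : Function.Injective (LinearMap.codRestrict _ f hf) := by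
    intro v w hvw
    have h : f v = f w := congrArg Subtype.val hvw
    ext ⟨i, j⟩
    have h1 := congrFun (congrFun h i) ⟨j, j.2.trans i.2⟩
    have h2 : (⟨j, j.2.trans i.2⟩ : Fin n) < i := j.2
    simpa [f, h2] using h1
  have := LinearMap.finrank_le_finrank_of_injective hinj
  rwa [Module.finrank_fintype_fun_eq_card] at this

/-- The equivariant projection of real matrices onto skew-symmetric matrices. -/
noncomputable def soProj (n : ℕ) : Matrix (Fin n) (Fin n) ℝ →ₗ[ℝ] Matrix (Fin n) (Fin n) ℝ :=
  (1 / 2 : ℝ) • (LinearMap.id - (Matrix.transposeLinearEquiv (Fin n) (Fin n) ℝ ℝ).toLinearMap)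

theorem soProj_apply (B : Matrix (Fin n) (Fin n) ℝ) : soProj n B = (1 / 2 : ℝ) • (B - Bᵀ) := rfl

/-- For the structure `K = 1`, `ε = 1`, the compatible matrices are the real ones. -/
theorem exists_orthogonal_conj {X Y : Matrix (Fin n) (Fin n) ℝ} (hX : Xᵀ = -X) (hY : Yᵀ = -Y)
    (h : X.charpoly = Y.charpoly) :
    ∃ O : Matrix (Fin n) (Fin n) ℝ, O * Oᵀ = 1 ∧ X = O * Y * Oᵀ := by
  let c := Complex.ofRealHom.mapMatrix (m := Fin n)
  have hc : Function.Injective c := Matrix.map_injective Complex.ofReal_injective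
  have hct : ∀ Z, (c Z)ᴴ = c Zᵀ := fun Z => by
    ext i j
    simp [c]
  have hcT : ∀ Z, c Z ∈ antilinearCentralizer (1 : Matrix (Fin n) (Fin n) ℂ) := fun Z => by
    rw [mem_antilinearCentralizer, one_mul, mul_one]
    ext i j
    simp [c]
  obtain ⟨O, hOT, hOu, hO⟩ := exists_compatible_unitary_conj (K := (1 : Matrix (Fin n) (Fin n) ℂ))
    (ε := 1) (X := c X) (Y := c Y) (one_mul 1)
    (by
      ext i j
      by_cases hij : i = j
      · subst hij
        simp
      · simp [hij])
    (by simp) (by simp) (by rw [hct, hX, map_neg]) (by rw [hct, hY, map_neg]) (hcT X) (hcT Y)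
    (by
      simp only [c, RingHom.mapMatrix_apply, Matrix.charpoly_map, h])
  have hOr : O = c (O.map Complex.re) := by
    rw [mem_antilinearCentralizer, one_mul, mul_one] at hOT
    ext i j
    have := congrFun (congrFun hOT i) j
    exact (Complex.conj_eq_iff_re.1 this).symm
  obtain ⟨R, hR⟩ : ∃ R, R = O.map Complex.re := ⟨_, rfl⟩
  rw [← hR] at hOr
  rw [Matrix.mem_unitaryGroup_iff, Matrix.star_eq_conjTranspose, hOr, hct, ← map_mul,
    ← map_one c] at hOu
  rw [Matrix.star_eq_conjTranspose, hOr, hct, ← map_mul, ← map_mul] at hO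
  exact ⟨R, hc hOu, hc hO⟩

theorem mem_specialOrthogonalGroup_iff_transpose {A : Matrix (Fin n) (Fin n) ℝ} :
    A ∈ Matrix.specialOrthogonalGroup (Fin n) ℝ ↔ A * Aᵀ = 1 ∧ A.det = 1 :=
  Matrix.mem_specialOrthogonalGroup_iff.trans
    (and_congr (Matrix.mem_orthogonalGroup_iff _ _) Iff.rfl)

theorem isCompact_orthogonal_det (δ : ℝ) :
    IsCompact {A : Matrix (Fin n) (Fin n) ℝ | A * Aᵀ = 1 ∧ A.det = δ} := by
  refine isCompact_of_isClosed_of_unitary (IsClosed.inter ?_ ?_) fun A hA => ?_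
  · exact isClosed_eq (by fun_prop) continuous_const
  · exact isClosed_eq (Continuous.matrix_det continuous_id) continuous_const
  · rw [Matrix.mem_unitaryGroup_iff, Matrix.star_eq_conjTranspose,
      Matrix.conjTranspose_eq_transpose_of_trivial]
    exact hA.1

/-- On a connected set of skew-symmetric matrices with constant characteristic polynomial,
all matrices are conjugate under the special orthogonal group. -/
theorem exists_specialOrthogonal_conj {S : Set (Matrix (Fin n) (Fin n) ℝ)} (hS : IsPreconnected S)
    (hskew : ∀ X ∈ S, Xᵀ = -X) (hchar : ∀ X ∈ S, ∀ Y ∈ S, X.charpoly = Y.charpoly)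
    {X Y : Matrix (Fin n) (Fin n) ℝ} (hX : X ∈ S) (hY : Y ∈ S) :
    ∃ A : Matrix (Fin n) (Fin n) ℝ, (A * Aᵀ = 1 ∧ A.det = 1) ∧ X = A * Y * Aᵀ := by
  let C : ℝ → Set (Matrix (Fin n) (Fin n) ℝ) := fun δ => {A | A * Aᵀ = 1 ∧ A.det = δ}
  let orb : ℝ → Set (Matrix (Fin n) (Fin n) ℝ) := fun δ => (fun A => A * Y * Aᵀ) '' C δ
  have hclosed : ∀ δ, IsClosed (orb δ) := fun δ =>
    ((isCompact_orthogonal_det δ).image (by fun_prop)).isClosed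
  -- The full orthogonal orbit of `Y` is a union of two compact pieces according to the determinant.
  -- If connected `S` meets both, they meet within `S`, which produces an orthogonal matrix of
  -- determinant `-1` fixing `Y`; composing with it corrects the determinant.
  have hcover : S ⊆ orb 1 ∪ orb (-1) := by
    intro Z hZ
    obtain ⟨O, hO, hOZ⟩ := exists_orthogonal_conj (hskew Z hZ) (hskew Y hY) (hchar Z hZ Y hY)
    have hdet : O.det * O.det = 1 := by
      have := congrArg Matrix.det hO
      rwa [Matrix.det_mul, Matrix.det_transpose, Matrix.det_one] at this
    rcases mul_self_eq_one_iff.1 hdet with h | h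
    · exact Or.inl ⟨O, ⟨hO, h⟩, hOZ.symm⟩
    · exact Or.inr ⟨O, ⟨hO, h⟩, hOZ.symm⟩
  suffices h : X ∈ orb 1 by
    obtain ⟨A, hA, hAX⟩ := h
    exact ⟨A, hA, hAX.symm⟩
  rcases hcover hX with h | h
  · exact h
  obtain ⟨Z, -, ⟨A, ⟨hA, hAd⟩, hAZ⟩, ⟨B, ⟨hB, hBd⟩, hBZ⟩⟩ := isPreconnected_closed_iff.1 hS (orb 1)
    (orb (-1)) (hclosed 1) (hclosed (-1)) hcover
    ⟨Y, hY, 1, ⟨by simp, by simp⟩, by simp⟩ ⟨X, hX, h⟩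
  obtain ⟨D, ⟨hD, hDd⟩, rfl⟩ := h
  have hB' : Bᵀ * B = 1 := mul_eq_one_comm.1 hB
  have hfix : Bᵀ * A * Y * (Bᵀ * A)ᵀ = Y := by
    have h1 : Bᵀ * (A * Y * Aᵀ) * B = Bᵀ * (B * Y * Bᵀ) * B := by
      beta_reduce at hAZ hBZ
      rw [hAZ, hBZ]
    calc Bᵀ * A * Y * (Bᵀ * A)ᵀ = Bᵀ * (A * Y * Aᵀ) * B := by
          simp only [Matrix.transpose_mul, Matrix.transpose_transpose, mul_assoc]
      _ = (Bᵀ * B) * Y * (Bᵀ * B) := by rw [h1]; simp only [mul_assoc]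
      _ = Y := by rw [hB', one_mul, mul_one]
  refine ⟨D * (Bᵀ * A), ⟨?_, ?_⟩, ?_⟩
  · calc D * (Bᵀ * A) * (D * (Bᵀ * A))ᵀ = D * (Bᵀ * (A * Aᵀ) * B) * Dᵀ := by
          simp only [Matrix.transpose_mul, Matrix.transpose_transpose, mul_assoc]
      _ = 1 := by rw [hA, mul_one, hB', mul_one, hD]
  · rw [Matrix.det_mul, Matrix.det_mul, Matrix.det_transpose, hAd, hBd, hDd]
    norm_num
  · calc D * (Bᵀ * A) * Y * (D * (Bᵀ * A))ᵀ = D * (Bᵀ * A * Y * (Bᵀ * A)ᵀ) * Dᵀ := by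
          simp only [Matrix.transpose_mul, mul_assoc]
      _ = _ := by rw [hfix]

/-- The skew-symmetric matrix of an oriented path. -/
def pathMatrix (m : ℕ) : Matrix (Fin (m + 3)) (Fin (m + 3)) ℝ := Matrix.of fun i k =>
  if i.val = k.val + 1 then 1 else if k.val = i.val + 1 then -1 else 0

/-- The skew-symmetric matrix of the first edge of a path. -/
def edgeMatrix (m : ℕ) : Matrix (Fin (m + 3)) (Fin (m + 3)) ℝ :=
  Matrix.single 1 0 1 - Matrix.single 0 1 1

/-- Commuting with the edge constrains the first two columns, and one entry of the path relation
completes the case that `A` is scalar there. The path then propagates this to every further column.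
-/
theorem eq_smul_one_of_commute_path {m : ℕ} {A : Matrix (Fin (m + 3)) (Fin (m + 3)) ℝ}
    (hP : A * pathMatrix m = pathMatrix m * A) (hE : A * edgeMatrix m = edgeMatrix m * A) :
    ∃ c : ℝ, A = c • 1 := by
  have h01 : (0 : Fin (m + 3)) ≠ 1 := by simp
  have hE' : ∀ i k, (A * edgeMatrix m) i k = (edgeMatrix m * A) i k := fun i k => by rw [hE]
  simp only [edgeMatrix, mul_sub, sub_mul, Matrix.sub_apply] at hE'
  have hi0 : ∀ i, i ≠ 0 → i ≠ 1 → A i 1 = 0 := by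
    intro i h0 h1
    have := hE' i 0
    simpa [Matrix.mul_single_apply_of_ne, Matrix.single_mul_apply_of_ne, h0, h1, h01.symm, h01]
      using this
  have hi1 : ∀ i, i ≠ 0 → i ≠ 1 → A i 0 = 0 := by
    intro i h0 h1
    have := hE' i 1
    simpa [Matrix.mul_single_apply_of_ne, Matrix.single_mul_apply_of_ne, h0, h1, h01.symm, h01]
      using this
  have h00 : A 0 0 = A 1 1 := by
    have := hE' 0 1
    simpa [Matrix.mul_single_apply_of_ne, Matrix.single_mul_apply_of_ne, h01.symm, h01] using this
  have h10 : A 0 1 = -A 1 0 := by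
    have := hE' 0 0
    simpa [Matrix.mul_single_apply_of_ne, Matrix.single_mul_apply_of_ne, h01.symm, h01] using this
  have hP' : ∀ (B : Matrix (Fin (m + 3)) (Fin (m + 3)) ℝ), B * pathMatrix m = pathMatrix m * B →
      ∀ i k, ∑ j, B i j * pathMatrix m j k = ∑ j, pathMatrix m i j * B j k := fun B hB i k => by
    rw [← Matrix.mul_apply, hB, Matrix.mul_apply]
  have hA10 : A 1 0 = 0 := by
    obtain ⟨t, ht⟩ : ∃ t : Fin (m + 3), t.val = 2 := ⟨⟨2, by omega⟩, rfl⟩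
    have h := hP' A hP t 0
    have hne0 : t ≠ 0 := by simp [Fin.ext_iff, ht]
    have hne1 : t ≠ 1 := by simp [Fin.ext_iff, ht]
    rw [Finset.sum_eq_single 1, Finset.sum_eq_single 1, hi0 t hne0 hne1] at h
    · simpa [pathMatrix, ht] using h.symm
    · intro j _ hj
      by_cases hj0 : j = 0
      · simp [hj0, pathMatrix, ht]
      · rw [hi1 j hj0 hj, mul_zero]
    · simp
    · intro j _ hj
      have : j.val ≠ 1 := fun h => hj (Fin.ext (by simpa using h))
      simp [pathMatrix, this]
    · simp
  refine ⟨A 0 0, sub_eq_zero.1 ?_⟩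
  obtain ⟨B, hB⟩ : ∃ B, B = A - A 0 0 • (1 : Matrix (Fin (m + 3)) (Fin (m + 3)) ℝ) := ⟨_, rfl⟩
  rw [← hB]
  have hBP : B * pathMatrix m = pathMatrix m * B := by
    rw [hB, sub_mul, mul_sub, hP]
    simp
  have hcol0 : ∀ i, B i 0 = 0 := by
    intro i
    by_cases h0 : i = 0
    · simp [hB, h0]
    · by_cases h1 : i = 1
      · simp [hB, h1, hA10]
      · simp [hB, hi1 i h0 h1, h0]
  have hcol1 : ∀ i, B i 1 = 0 := by
    intro i
    by_cases h0 : i = 0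
    · simp [hB, h0, h10, hA10]
    · by_cases h1 : i = 1
      · simp [hB, h1, h00]
      · simp [hB, hi0 i h0 h1, h1]
  -- Column `l + 1` of `B * pathMatrix m` is column `l + 2` of `B` minus column `l`, while column `l
  -- + 1` of `pathMatrix m * B` vanishes with that of `B`.
  have key : ∀ l : ℕ, ∀ (k : Fin (m + 3)), k.val ≤ l + 1 → ∀ i, B i k = 0 := by
    intro l
    induction l with
    | zero =>
      intro k hk i
      have : k = 0 ∨ k = 1 := by
        rcases Nat.le_one_iff_eq_zero_or_eq_one.1 hk with h | h
        · exact Or.inl (Fin.ext h)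
        · exact Or.inr (Fin.ext (by simpa using h))
      rcases this with rfl | rfl
      · exact hcol0 i
      · exact hcol1 i
    | succ l ih =>
      intro k hk i
      rcases Nat.lt_or_ge k.val (l + 2) with h | h
      · exact ih k (by omega) i
      have hk2 : k.val = l + 1 + 1 := by omega
      have hl : l + 1 < m + 3 := by omega
      have h1 := hP' B hBP i ⟨l + 1, hl⟩
      rw [Finset.sum_eq_single k, Finset.sum_eq_zero] at h1
      · simpa [pathMatrix, hk2] using h1
      · intro j _
        rw [ih ⟨l + 1, hl⟩ le_rfl, mul_zero]
      · intro j _ hj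
        have hj1 : j.val ≠ l + 1 + 1 := fun h => hj (Fin.ext (by omega))
        by_cases hj2 : l + 1 = j.val + 1
        · rw [ih j (by omega), zero_mul]
        · simp only [pathMatrix, Matrix.of_apply, hj1, hj2, if_false, mul_zero]
      · simp
  ext i k
  exact key k.val k (by omega) i

theorem exists_so_oddInv_ne_zero : ∃ X Y : Matrix (Fin 5) (Fin 5) ℝ, Xᵀ = -X ∧ Yᵀ = -Y ∧
    oddInv X Y ≠ 0 ∧ reflInv X Y ≠ 0 := by
  let X : Matrix (Fin 5) (Fin 5) ℤ := !![0, 0, -1, 0, -1; 0, 0, 0, 1, 0; 1, 0, 0, 0, 0;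
    0, -1, 0, 0, 0; 1, 0, 0, 0, 0]
  let Y : Matrix (Fin 5) (Fin 5) ℤ := !![0, 0, 1, -1, 0; 0, 0, 0, 0, 0; -1, 0, 0, 0, 1;
    1, 0, 0, 0, 0; 0, 0, -1, 0, 0]
  let c := (Int.castRingHom ℝ).mapMatrix (m := Fin 5)
  have hc : ∀ Z : Matrix (Fin 5) (Fin 5) ℤ, Zᵀ = -Z → (c Z)ᵀ = -c Z := fun Z hZ => by
    rw [← map_neg, ← hZ]
    rfl
  refine ⟨c X, c Y, hc X (by decide), hc Y (by decide), ?_, ?_⟩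
  · have h : (X * Y * (X * X) * (Y * Y * Y)).trace = 1 := by decide +kernel
    rw [oddInv_mapMatrix, h]
    simp
  · have h1 : ((X * Y + Y * X) * ((X * Y - Y * X) * (X * Y - Y * X))).trace = -12 := by
      decide +kernel
    have h2 : (X * Y).trace = 2 := by decide +kernel
    have h3 : (X * X * ((X * Y - Y * X) * (X * Y - Y * X))).trace = 15 := by decide +kernel
    have h4 : (Y * Y * ((X * Y - Y * X) * (X * Y - Y * X))).trace = 17 := by decide +kernel
    have h5 : (X * X).trace = -6 := by decide +kernel
    have h6 : (Y * Y).trace = -6 := by decide +kernel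
    rw [reflInv_mapMatrix, h1, h2, h3, h4, h5, h6]
    norm_num

theorem exists_so_family (n : ℕ) (hn : n = 5 ∨ 7 ≤ n) : ∃ d : ℕ,
    (n : ℝ) * ((n : ℝ) - 1) / 2 - ((n / 2 : ℕ) : ℝ) * (((n / 2 : ℕ) : ℝ) + 2) ≤ (d : ℝ) ∧
    1 < d ∧
    ∀ (h : Type u) [NormedAddCommGroup h] [InnerProductSpace ℝ h], Module.finrank ℝ h = 2 →
      ∃ O : Set (h →ₗ[ℝ] so (Fin n) ℝ), O.Nonempty ∧ IsZariskiOpen O ∧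
        ∀ j₀ ∈ O, InIsospectralFamily (Matrix.specialOrthogonalGroup (Fin n) ℝ) d j₀ := by
  obtain ⟨m, hm⟩ : ∃ m, m = n / 2 := ⟨_, rfl⟩
  obtain ⟨q, hq⟩ : ∃ q, n * (n - 1) = q * 2 := by
    obtain ⟨q, hq⟩ := (Nat.even_mul_pred_self n).two_dvd
    exact ⟨q, by rw [hq, mul_comm]⟩
  have hqr : (n : ℝ) * ((n : ℝ) - 1) = q * 2 := by
    have := congrArg (Nat.cast (R := ℝ)) hq
    rwa [Nat.cast_mul, Nat.cast_sub (by omega), Nat.cast_mul, Nat.cast_one, Nat.cast_ofNat] at this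
  -- Two spare dimensions beyond the number of equations, with equality at `n = 5`. At `n = 6` both
  -- sides of the count are `15`, which is why that case is excluded.
  have hmq : m * (m + 2) + 2 ≤ q := by
    rcases hn with rfl | hn
    · subst hm
      norm_num at hq ⊢
      omega
    · have h1 : 2 * m ≤ n := by omega
      have h2 : n * 6 ≤ n * (n - 1) := Nat.mul_le_mul_left n (by omega)
      have h3 : (2 * m) * (2 * m - 1) ≤ n * (n - 1) := Nat.mul_le_mul h1 (by omega)
      have h4 : 3 ≤ m := by omega
      obtain ⟨r, rfl⟩ : ∃ r, m = r + 3 := ⟨m - 3, by omega⟩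
      have h5 : 2 * (r + 3) - 1 = 2 * r + 5 := by omega
      rw [h5] at h3
      rcases Nat.eq_zero_or_pos r with rfl | hr
      · omega
      · nlinarith
  refine ⟨q - m * (m + 2), ?_, by omega, fun h _ _ hh => ?_⟩
  · rw [hqr, ← hm, Nat.cast_sub (by omega)]
    push_cast
    linarith
  have : Nonempty (Fin n) := ⟨⟨0, by omega⟩⟩
  have hso : ∀ {Z : Matrix (Fin n) (Fin n) ℝ}, Z ∈ so (Fin n) ℝ ↔ Zᵀ = -Z := mem_so _ _ _
  obtain ⟨X₀, Y₀, hX₀, hY₀, hodd, hrefl⟩ := exists_so_oddInv_ne_zero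
  let e : Fin n ≃ Fin 5 ⊕ Fin (n - 5) := (finCongr (by omega)).trans finSumFinEquiv.symm
  have hemb : ∀ {Z : Matrix (Fin 5) (Fin 5) ℝ}, Zᵀ = -Z → blockEmbed e Z ∈ so (Fin n) ℝ :=
    fun hZ => hso.2 (by rw [transpose_blockEmbed, hZ, neg_blockEmbed])
  refine exists_isZariskiOpen_inIsospectralFamily (Matrix.specialOrthogonalGroup (Fin n) ℝ)
    ?_ ?_ (soProj n) ?_ ?_ ?_ ?_ ?_ ((Finset.Icc 1 m).image (2 * ·)) ?_ ?_ ?_ ?_ ?_ ?_ h hh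
  · convert isCompact_orthogonal_det (n := n) 1 using 1
    ext A
    exact mem_specialOrthogonalGroup_iff_transpose
  · intro A hA
    exact IsUnit.of_mul_eq_one _ (mem_specialOrthogonalGroup_iff_transpose.1 hA).1
  · intro B
    rw [hso, soProj_apply, Matrix.transpose_smul, Matrix.transpose_sub, Matrix.transpose_transpose,
      ← smul_neg, neg_sub]
  · intro Z hZ
    rw [soProj_apply, hso.1 hZ, sub_neg_eq_add, ← two_smul ℝ Z, smul_smul]
    norm_num
  · intro B X hX
    rw [soProj_apply, soProj_apply, Matrix.transpose_sub, Matrix.transpose_mul,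
      Matrix.transpose_mul, hso.1 hX, Matrix.smul_mul, Matrix.mul_smul, ← smul_sub]
    congr 1
    noncomm_ring
  · intro Z hZ
    have h1 := Matrix.trace_transpose Z
    rw [hso.1 hZ, Matrix.trace_neg] at h1
    exact neg_eq_self.1 h1
  · intro Z hZ
    rw [Matrix.conjTranspose_eq_transpose_of_trivial, hso.1 hZ]
  · intro X hX k hk0 hk hkD
    refine charpoly_coeff_eq_zero_of_odd ?_ hk
      (odd_of_notMem_image (by simp [hm]) hk0 hk hkD)
    rw [← hso.1 hX, Matrix.charpoly_transpose]
  · intro S hS hSg hchar X hX Y hY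
    obtain ⟨A, hA, hXY⟩ := exists_specialOrthogonal_conj hS (fun Z hZ => hso.1 (hSg Z hZ)) hchar hX hY
    exact ⟨A, mem_specialOrthogonalGroup_iff_transpose.2 hA, by
      rw [Matrix.inv_eq_right_inv hA.1, hXY]⟩
  · obtain ⟨r, rfl⟩ : ∃ r, n = r + 3 := ⟨n - 3, by omega⟩
    refine ⟨pathMatrix r, hso.2 ?_, edgeMatrix r, hso.2 ?_,
      fun A hP hE => eq_smul_one_of_commute_path hP hE⟩
    · ext i k
      simp only [pathMatrix, Matrix.transpose_apply, Matrix.neg_apply, Matrix.of_apply]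
      split_ifs <;> first | omega | simp
    · simp [edgeMatrix]
  · exact ⟨_, hemb hX₀, _, hemb hY₀, by rwa [reflInv_blockEmbed]⟩
  · exact ⟨_, hemb hX₀, _, hemb hY₀, by rwa [oddInv_blockEmbed]⟩
  · have := finrank_so_ge n
    rw [sum_image_two_mul]
    omega

end Orthogonal

/-! ### Projection to skew-Hermitian matrices, and centralizers of diagonal matrices. -/

section SkewHermitian

variable {ι 𝕜 : Type*} [Fintype ι] [DecidableEq ι] [RCLike 𝕜]

/-- The projection of matrices onto skew-Hermitian matrices. -/
noncomputable def skewProj (ι 𝕜 : Type*) [RCLike 𝕜] : Matrix ι ι 𝕜 →ₗ[ℝ] Matrix ι ι 𝕜 where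
  toFun B := (1 / 2 : ℝ) • (B - Bᴴ)
  map_add' B C := by
    rw [Matrix.conjTranspose_add, ← smul_add]
    congr 1
    abel
  map_smul' c B := by
    rw [Matrix.conjTranspose_smul, star_trivial, ← smul_sub, smul_comm, RingHom.id_apply]

omit [Fintype ι] [DecidableEq ι] in
theorem skewProj_apply (B : Matrix ι ι 𝕜) : skewProj ι 𝕜 B = (1 / 2 : ℝ) • (B - Bᴴ) := rfl

omit [Fintype ι] [DecidableEq ι] in
theorem conjTranspose_skewProj (B : Matrix ι ι 𝕜) : (skewProj ι 𝕜 B)ᴴ = -skewProj ι 𝕜 B := by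
  rw [skewProj_apply, Matrix.conjTranspose_smul, Matrix.conjTranspose_sub,
    Matrix.conjTranspose_conjTranspose, star_trivial, ← smul_neg, neg_sub]

omit [Fintype ι] [DecidableEq ι] in
theorem skewProj_of_skew {B : Matrix ι ι 𝕜} (hB : Bᴴ = -B) : skewProj ι 𝕜 B = B := by
  rw [skewProj_apply, hB, sub_neg_eq_add, ← two_smul ℝ B, smul_smul]
  norm_num

theorem skewProj_lie (B : Matrix ι ι 𝕜) {X : Matrix ι ι 𝕜} (hX : Xᴴ = -X) :
    skewProj ι 𝕜 (B * X - X * B) = skewProj ι 𝕜 B * X - X * skewProj ι 𝕜 B := by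
  rw [skewProj_apply, skewProj_apply, Matrix.conjTranspose_sub, Matrix.conjTranspose_mul,
    Matrix.conjTranspose_mul, hX, Matrix.smul_mul, Matrix.mul_smul, ← smul_sub]
  congr 1
  noncomm_ring

theorem apply_eq_zero_of_commute_diagonal {v : ι → 𝕜} (hv : Function.Injective v)
    {A : Matrix ι ι 𝕜} (h : A * Matrix.diagonal v = Matrix.diagonal v * A) {i k : ι}
    (hik : i ≠ k) : A i k = 0 := by
  have h1 := congrFun (congrFun h i) k
  rw [Matrix.mul_diagonal, Matrix.diagonal_mul, mul_comm, ← sub_eq_zero, ← sub_mul,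
    mul_eq_zero] at h1
  exact h1.resolve_left (sub_ne_zero.2 fun h2 => hik (hv h2).symm)

/-- The matrix `A` is diagonal, so each nonzero entry of `Y` links two of its diagonal entries; if
these links connect all indices, `A` is scalar. -/
theorem apply_eq_apply_of_commute {v : ι → 𝕜} (hv : Function.Injective v)
    {A Y : Matrix ι ι 𝕜} (h : A * Matrix.diagonal v = Matrix.diagonal v * A)
    (hY : A * Y = Y * A) {i k : ι} (hik : Y i k ≠ 0) : A i i = A k k := by
  have h1 := congrFun (congrFun hY i) k
  rw [Matrix.mul_apply, Matrix.mul_apply, Finset.sum_eq_single i, Finset.sum_eq_single k,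
    mul_comm] at h1
  · exact mul_left_cancel₀ hik h1
  · intro j _ hj
    rw [apply_eq_zero_of_commute_diagonal hv h hj, mul_zero]
  · simp
  · intro j _ hj
    rw [apply_eq_zero_of_commute_diagonal hv h hj.symm, zero_mul]
  · simp

theorem eq_smul_one_of_commute_diagonal {v : ι → 𝕜} (hv : Function.Injective v)
    {A : Matrix ι ι 𝕜} (h : A * Matrix.diagonal v = Matrix.diagonal v * A) {c : 𝕜}
    (hc : ∀ i, A i i = c) : A = c • 1 := by
  ext i k
  rcases eq_or_ne i k with rfl | hik
  · simp [hc]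
  · simp [apply_eq_zero_of_commute_diagonal hv h hik, hik]

end SkewHermitian

/-! ### The special unitary algebras. -/

section Unitary

variable {n : ℕ}

theorem mem_su {X : Matrix (Fin n) (Fin n) ℂ} : X ∈ su n ↔ Xᴴ = -X ∧ X.trace = 0 := Iff.rfl

/-- Traceless real matrices embed by `R ↦ (R - Rᵀ) + i (R + Rᵀ)`. A lower bound on the dimension is
all that the construction needs. -/
theorem finrank_su_ge (n : ℕ) : n * n ≤ Module.finrank ℝ (su n) + 1 := by
  let T := LinearMap.ker (Matrix.traceLinearMap (Fin n) ℝ ℝ)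
  have hT : n * n ≤ Module.finrank ℝ T + 1 := by
    have h1 := LinearMap.finrank_range_add_finrank_ker (Matrix.traceLinearMap (Fin n) ℝ ℝ)
    have h2 := Submodule.finrank_le (LinearMap.range (Matrix.traceLinearMap (Fin n) ℝ ℝ))
    rw [Module.finrank_self] at h2
    rw [Module.finrank_matrix, Module.finrank_self, Fintype.card_fin, mul_one] at h1
    change n * n ≤ Module.finrank ℝ (LinearMap.ker (Matrix.traceLinearMap (Fin n) ℝ ℝ)) + 1
    omega
  let f : Matrix (Fin n) (Fin n) ℝ →ₗ[ℝ] Matrix (Fin n) (Fin n) ℂ :=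
    { toFun := fun R => Matrix.of fun i j => ⟨R i j - R j i, R i j + R j i⟩
      map_add' := fun R S => by
        ext i j
        apply Complex.ext <;> simp <;> ring
      map_smul' := fun c R => by
        ext i j
        apply Complex.ext <;> simp <;> ring }
  have hf : ∀ R : T, (f ∘ₗ T.subtype) R ∈ (su n).toSubmodule := by
    rintro ⟨R, hR⟩
    have hR' : ∑ i, R i i = 0 := hR
    refine mem_su.2 ⟨?_, ?_⟩
    · ext i j
      apply Complex.ext
      · simp [f]
      · simp [f]
        ring
    · apply Complex.ext
      · simp [f, Matrix.trace]
      · simp [f, Matrix.trace, Finset.sum_add_distrib, hR']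
  have hinj : Function.Injective (LinearMap.codRestrict _ (f ∘ₗ T.subtype) hf) := by
    rintro ⟨R, hR⟩ ⟨S, hS⟩ h
    have h1 : f R = f S := congrArg Subtype.val h
    refine Subtype.ext ?_
    ext i j
    have h2 := congrFun (congrFun h1 i) j
    have h3 := congrArg Complex.re h2
    have h4 := congrArg Complex.im h2
    simp only [f, LinearMap.coe_mk, AddHom.coe_mk, Matrix.of_apply] at h3 h4
    linarith
  have := LinearMap.finrank_le_finrank_of_injective hinj
  exact hT.trans (Nat.add_le_add_right this 1)

/-- The equivariant projection of complex matrices onto `su(n)`. -/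
noncomputable def suProj (n : ℕ) : Matrix (Fin n) (Fin n) ℂ →ₗ[ℝ] Matrix (Fin n) (Fin n) ℂ where
  toFun B := skewProj (Fin n) ℂ B - ((n : ℂ)⁻¹ * (skewProj (Fin n) ℂ B).trace) • 1
  map_add' B C := by
    rw [map_add, Matrix.trace_add, mul_add, add_smul]
    abel
  map_smul' c B := by
    rw [map_smul, Matrix.trace_smul, mul_smul_comm, smul_assoc, ← smul_sub, RingHom.id_apply]

theorem suProj_apply (B : Matrix (Fin n) (Fin n) ℂ) : suProj n B =
    skewProj (Fin n) ℂ B - ((n : ℂ)⁻¹ * (skewProj (Fin n) ℂ B).trace) • 1 := rfl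

theorem star_trace_of_skew {B : Matrix (Fin n) (Fin n) ℂ} (hB : Bᴴ = -B) :
    star B.trace = -B.trace := by
  rw [← Matrix.trace_conjTranspose, hB, Matrix.trace_neg]

theorem suProj_mem (hn : n ≠ 0) (B : Matrix (Fin n) (Fin n) ℂ) : suProj n B ∈ su n := by
  have h := conjTranspose_skewProj B
  refine mem_su.2 ⟨?_, ?_⟩
  · rw [suProj_apply, Matrix.conjTranspose_sub, Matrix.conjTranspose_smul, h,
      Matrix.conjTranspose_one, StarMul.star_mul, star_trace_of_skew h]
    simp [mul_comm, sub_eq_add_neg, add_comm]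
  · rw [suProj_apply, Matrix.trace_sub, Matrix.trace_smul, Matrix.trace_one, Fintype.card_fin,
      smul_eq_mul]
    have : (n : ℂ) ≠ 0 := Nat.cast_ne_zero.2 hn
    field_simp
    ring

/-- A unitary conjugation may be rescaled by a unit scalar without changing its effect, and an
`n`-th root of the conjugate determinant normalizes the determinant to `1`. -/
theorem exists_specialUnitary_conj (hn : n ≠ 0) {X Y : Matrix (Fin n) (Fin n) ℂ} (hX : Xᴴ = -X)
    (hY : Yᴴ = -Y) (h : X.charpoly = Y.charpoly) :
    ∃ A ∈ Matrix.specialUnitaryGroup (Fin n) ℂ, X = A * Y * A⁻¹ := by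
  obtain ⟨U, hU, hUX⟩ := exists_unitary_conj hX hY h
  have hUU := Matrix.mem_unitaryGroup_iff.1 hU
  have hdet : U.det * star U.det = 1 := by
    have := congrArg Matrix.det hUU
    rwa [Matrix.det_mul, Matrix.star_eq_conjTranspose, Matrix.det_conjTranspose,
      Matrix.det_one] at this
  obtain ⟨c, hc⟩ := IsAlgClosed.exists_pow_nat_eq (star U.det) (Nat.pos_of_ne_zero hn)
  have hcn : ‖c‖ = 1 := by
    have h1 : ‖U.det‖ * ‖U.det‖ = 1 := by
      have := congrArg norm hdet
      rwa [norm_mul, norm_star, norm_one] at this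
    have h2 : ‖U.det‖ = 1 := by nlinarith [norm_nonneg U.det]
    have h3 := congrArg norm hc
    rw [norm_pow, norm_star, h2] at h3
    exact (pow_eq_one_iff_of_nonneg (norm_nonneg c) hn).1 h3
  have hcc : c * star c = 1 := by
    rw [Complex.star_def, Complex.mul_conj, Complex.normSq_eq_norm_sq, hcn]
    simp
  have hAu : (c • U) * star (c • U) = 1 := by
    rw [star_smul, Matrix.smul_mul, Matrix.mul_smul, smul_smul, hcc, hUU, one_smul]
  refine ⟨c • U, Matrix.mem_specialUnitaryGroup_iff.2
    ⟨Matrix.mem_unitaryGroup_iff.2 hAu, ?_⟩, ?_⟩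
  · rw [Matrix.det_smul, Fintype.card_fin, hc, mul_comm, hdet]
  · rw [Matrix.inv_eq_right_inv hAu, star_smul, Matrix.smul_mul, Matrix.smul_mul, Matrix.mul_smul,
      smul_smul, hcc, one_smul, hUX]

theorem conjTranspose_map_toComplex {ι : Type*} [Fintype ι] [DecidableEq ι]
    (Z : Matrix ι ι GaussianInt) :
    (GaussianInt.toComplex.mapMatrix Z)ᴴ = GaussianInt.toComplex.mapMatrix Zᴴ := by
  ext i j
  simp [GaussianInt.toComplex_star]

/-- The fourth coordinate only serves to make the trace of `Y` zero; `X` vanishes there. -/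
theorem exists_su_oddInv_ne_zero : ∃ X Y : Matrix (Fin 4) (Fin 4) ℂ,
    (Xᴴ = -X ∧ X.trace = 0) ∧ (Yᴴ = -Y ∧ Y.trace = 0) ∧ oddInv X Y ≠ 0 := by
  let i : GaussianInt := ⟨0, 1⟩
  let X : Matrix (Fin 4) (Fin 4) GaussianInt := !![i, 0, 0, 0; 0, 0, 0, 0; 0, 0, -i, 0; 0, 0, 0, 0]
  let Y : Matrix (Fin 4) (Fin 4) GaussianInt :=
    !![0, -i, 1, 0; -i, 0, i, 0; -1, i, i, 0; 0, 0, 0, -i]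
  refine ⟨GaussianInt.toComplex.mapMatrix X, GaussianInt.toComplex.mapMatrix Y, ⟨?_, ?_⟩,
    ⟨?_, ?_⟩, ?_⟩
  · rw [conjTranspose_map_toComplex, ← map_neg]
    congr 1
    decide +kernel
  · have h : X.trace = 0 := by decide +kernel
    rw [trace_mapMatrix, h, map_zero]
  · rw [conjTranspose_map_toComplex, ← map_neg]
    congr 1
    decide +kernel
  · have h : Y.trace = 0 := by decide +kernel
    rw [trace_mapMatrix, h, map_zero]
  · have h : (X * Y * (X * X) * (Y * Y * Y)).trace = ⟨2, 5⟩ := by decide +kernel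
    rw [oddInv_mapMatrix, h]
    simp [GaussianInt.toComplex_def]

theorem exists_su_reflInv_ne_zero : ∃ X Y : Matrix (Fin 4) (Fin 4) ℂ,
    (Xᴴ = -X ∧ X.trace = 0) ∧ (Yᴴ = -Y ∧ Y.trace = 0) ∧ reflInv X Y ≠ 0 := by
  let i : GaussianInt := ⟨0, 1⟩
  let X : Matrix (Fin 4) (Fin 4) GaussianInt := !![0, 0, 0, 0; 0, i, 0, 0; 0, 0, -i, 0; 0, 0, 0, 0]
  let Y : Matrix (Fin 4) (Fin 4) GaussianInt :=
    !![0, 0, -1, 0; 0, i, 0, 0; 1, 0, 0, 0; 0, 0, 0, -i]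
  refine ⟨GaussianInt.toComplex.mapMatrix X, GaussianInt.toComplex.mapMatrix Y, ⟨?_, ?_⟩,
    ⟨?_, ?_⟩, ?_⟩
  · rw [conjTranspose_map_toComplex, ← map_neg]
    congr 1
    decide +kernel
  · have h : X.trace = 0 := by decide +kernel
    rw [trace_mapMatrix, h, map_zero]
  · rw [conjTranspose_map_toComplex, ← map_neg]
    congr 1
    decide +kernel
  · have h : Y.trace = 0 := by decide +kernel
    rw [trace_mapMatrix, h, map_zero]
  · have h1 : ((X * Y + Y * X) * ((X * Y - Y * X) * (X * Y - Y * X))).trace = 0 := by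
      decide +kernel
    have h2 : (X * Y).trace = -1 := by decide +kernel
    have h3 : (X * X * ((X * Y - Y * X) * (X * Y - Y * X))).trace = 1 := by decide +kernel
    have h4 : (Y * Y * ((X * Y - Y * X) * (X * Y - Y * X))).trace = ⟨2, 0⟩ := by decide +kernel
    rw [reflInv_mapMatrix, h1, h2, h3, h4, GaussianInt.toComplex_def']
    norm_num

theorem sum_Icc_two (n : ℕ) : 2 * ∑ k ∈ Finset.Icc 2 (n + 1), (k + 1) + 4 =
    (n + 1) * (n + 1) + 3 * (n + 1) := by
  induction n with
  | zero => simp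
  | succ n ih =>
    rw [Finset.sum_Icc_succ_top (by omega)]
    linarith

theorem exists_su_family (n : ℕ) (hn : 4 ≤ n) : ∃ d : ℕ,
    (n : ℝ) ^ 2 - 1 - ((n : ℝ) ^ 2 + 3 * (n : ℝ)) / 2 ≤ (d : ℝ) ∧
    (n = 4 → d = 1) ∧ (5 ≤ n → 1 < d) ∧
    ∀ (h : Type u) [NormedAddCommGroup h] [InnerProductSpace ℝ h], Module.finrank ℝ h = 2 →
      ∃ O : Set (h →ₗ[ℝ] su n), O.Nonempty ∧ IsZariskiOpen O ∧
        ∀ j₀ ∈ O, InIsospectralFamily (Matrix.specialUnitaryGroup (Fin n) ℂ) d j₀ := by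
  have hn0 : n ≠ 0 := by omega
  obtain ⟨N, hN⟩ : ∃ N, N = ∑ k ∈ Finset.Icc 2 n, (k + 1) := ⟨_, rfl⟩
  have hN2 : 2 * N + 4 = n * n + 3 * n := by
    have := sum_Icc_two (n - 1)
    rw [Nat.sub_add_cancel (by omega)] at this
    rw [hN, this]
  -- The count would allow `d + N + 1 = n * n`. Two parameters are given up so that `d` equals the
  -- stated bound, in particular `1` for `n = 4`.
  have hd : ∃ d, d + N + 3 = n * n := ⟨n * n - N - 3, by
    have : 4 * n ≤ n * n := Nat.mul_le_mul_right n hn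
    omega⟩
  obtain ⟨d, hd⟩ := hd
  refine ⟨d, ?_, ?_, ?_, fun h _ _ hh => ?_⟩
  · have h1 : (2 : ℝ) * N + 4 = n * n + 3 * n := by exact_mod_cast hN2
    have h2 : (d : ℝ) + N + 3 = n * n := by exact_mod_cast hd
    rw [sq]
    linarith
  · rintro rfl
    omega
  · intro h5
    have : 5 * n ≤ n * n := Nat.mul_le_mul_right n h5
    omega
  have : Nonempty (Fin n) := ⟨⟨0, by omega⟩⟩
  let e : Fin n ≃ Fin 4 ⊕ Fin (n - 4) := (finCongr (by omega)).trans finSumFinEquiv.symm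
  have hemb : ∀ {Z : Matrix (Fin 4) (Fin 4) ℂ}, Zᴴ = -Z ∧ Z.trace = 0 → blockEmbed e Z ∈ su n :=
    fun hZ => mem_su.2 ⟨by rw [conjTranspose_blockEmbed, hZ.1, neg_blockEmbed],
      by rw [trace_blockEmbed, hZ.2]⟩
  refine exists_isZariskiOpen_inIsospectralFamily (Matrix.specialUnitaryGroup (Fin n) ℂ)
    ?_ ?_ (suProj n) (suProj_mem hn0) ?_ ?_ (fun Z hZ => hZ.2) (fun Z hZ => hZ.1)
    (Finset.Icc 2 n) ?_ ?_ ?_ ?_ ?_ ?_ h hh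
  · refine isCompact_of_isClosed_of_unitary ?_ fun A hA =>
      (Matrix.mem_specialUnitaryGroup_iff.1 hA).1
    have : ((Matrix.specialUnitaryGroup (Fin n) ℂ : Submonoid _) :
        Set (Matrix (Fin n) (Fin n) ℂ)) = {A | A * star A = 1} ∩ {A | A.det = 1} := by
      ext A
      exact Matrix.mem_specialUnitaryGroup_iff.trans
        (and_congr Matrix.mem_unitaryGroup_iff Iff.rfl)
    rw [this]
    exact (isClosed_eq (by fun_prop) continuous_const).inter
      (isClosed_eq (Continuous.matrix_det continuous_id) continuous_const)
  · intro A hA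
    exact IsUnit.of_mul_eq_one _
      (Matrix.mem_unitaryGroup_iff.1 (Matrix.mem_specialUnitaryGroup_iff.1 hA).1)
  · intro Z hZ
    rw [suProj_apply, skewProj_of_skew hZ.1, hZ.2, mul_zero, zero_smul, sub_zero]
  · intro B X hX
    rw [suProj_apply, suProj_apply, skewProj_lie B hX.1, Matrix.trace_sub, Matrix.trace_mul_comm,
      sub_self, mul_zero, zero_smul, sub_zero, sub_mul, mul_sub, Matrix.smul_mul, Matrix.mul_smul,
      one_mul, mul_one, sub_sub_sub_cancel_right]
  · intro X hX k hk0 hk hkD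
    rw [Fintype.card_fin] at hk
    have hk1 : k = 1 := by
      by_contra hk1
      exact hkD (Finset.mem_Icc.2 ⟨by omega, hk⟩)
    have := Matrix.trace_eq_neg_charpoly_coeff X
    rw [hX.2] at this
    rw [hk1]
    exact neg_eq_zero.1 this.symm
  · intro S _ hSg hchar X hX Y hY
    exact exists_specialUnitary_conj hn0 (hSg X hX).1 (hSg Y hY).1 (hchar X hX Y hY)
  · let a : ℝ := (n : ℝ)⁻¹ * ∑ k : Fin n, (k.val : ℝ)
    let v : Fin n → ℂ := fun k => Complex.I * (((k.val : ℝ) - a : ℝ) : ℂ)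
    have hv : Function.Injective v := by
      intro k l hkl
      have h1 := mul_left_cancel₀ Complex.I_ne_zero hkl
      have h2 := Complex.ofReal_injective h1
      exact Fin.ext (by exact_mod_cast sub_left_injective h2)
    refine ⟨Matrix.diagonal v, mem_su.2 ⟨?_, ?_⟩, Matrix.of fun k l => if k = l then 0 else
      Complex.I, mem_su.2 ⟨?_, ?_⟩, fun A hA hA' => ⟨A ⟨0, by omega⟩ ⟨0, by omega⟩,
      eq_smul_one_of_commute_diagonal hv hA fun k => ?_⟩⟩
    · rw [Matrix.diagonal_conjTranspose, Matrix.diagonal_neg]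
      congr 1
      ext k
      simp [v]
    · rw [Matrix.trace_diagonal, ← Finset.mul_sum, ← Complex.ofReal_sum, Finset.sum_sub_distrib]
      have : (n : ℝ) ≠ 0 := Nat.cast_ne_zero.2 hn0
      simp [a, this]
    · ext k l
      by_cases hkl : k = l
      · simp [hkl]
      · simp [hkl, Ne.symm hkl]
    · simp [Matrix.trace]
    · by_cases hk : k = ⟨0, by omega⟩
      · rw [hk]
      · exact apply_eq_apply_of_commute hv hA hA' (by simp [hk])
  · obtain ⟨X, Y, hX, hY, hXY⟩ := exists_su_reflInv_ne_zero
    exact ⟨_, hemb hX, _, hemb hY, by rwa [reflInv_blockEmbed]⟩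
  · obtain ⟨X, Y, hX, hY, hXY⟩ := exists_su_oddInv_ne_zero
    exact ⟨_, hemb hX, _, hemb hY, by rwa [oddInv_blockEmbed]⟩
  · have := finrank_su_ge n
    rw [← hN]
    omega

end Unitary

/-! ### The compact symplectic algebras. -/

section Symplectic

variable {n : ℕ}

/-- The standard symplectic form on `ℂ ^ (2 * n)`. -/
abbrev symplecticForm (n : ℕ) : Matrix (Fin n ⊕ Fin n) (Fin n ⊕ Fin n) ℂ := Matrix.J (Fin n) ℂ

theorem symplecticForm_map_conj : (symplecticForm n).map (starRingEnd ℂ) = symplecticForm n :=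
  Matrix.map_J _ (starRingEnd ℂ)

theorem symplecticForm_mul_self : symplecticForm n * symplecticForm n = -1 :=
  Matrix.J_squared _ _

theorem conjTranspose_symplecticForm : (symplecticForm n)ᴴ = -symplecticForm n := by
  have h : (symplecticForm n)ᴴ = ((symplecticForm n).map (starRingEnd ℂ))ᵀ := rfl
  rw [h, symplecticForm_map_conj, Matrix.J_transpose]

theorem mem_sp_iff_transpose {X : Matrix (Fin n ⊕ Fin n) (Fin n ⊕ Fin n) ℂ} :
    X ∈ sp n ↔ Xᴴ = -X ∧ Xᵀ * symplecticForm n = symplecticForm n * -X :=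
  Iff.and Iff.rfl (mem_skewAdjointMatricesSubmodule _ _)

/-- For skew-Hermitian matrices the symplectic condition says exactly that they commute with the
quaternionic structure `v ↦ J (conj v)`, so the general conjugacy theorem applies with `ε = -1`. -/
theorem mem_sp_iff {X : Matrix (Fin n ⊕ Fin n) (Fin n ⊕ Fin n) ℂ} :
    X ∈ sp n ↔ Xᴴ = -X ∧ X ∈ antilinearCentralizer (symplecticForm n) := by
  rw [mem_sp_iff_transpose]
  refine and_congr_right fun h => ?_
  rw [mem_antilinearCentralizer, map_conj_eq, h, Matrix.transpose_neg]
  have hJ := symplecticForm_mul_self (n := n)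
  constructor
  · intro h1
    have h2 : symplecticForm n * (Xᵀ * symplecticForm n) * symplecticForm n =
        symplecticForm n * (symplecticForm n * -X) * symplecticForm n := by rw [h1]
    rw [← mul_assoc _ Xᵀ, mul_assoc _ _ (symplecticForm n), ← mul_assoc _ _ (-X), hJ] at h2
    simpa using h2
  · intro h1
    have h2 : symplecticForm n * (symplecticForm n * -Xᵀ) * symplecticForm n =
        symplecticForm n * (X * symplecticForm n) * symplecticForm n := by rw [h1]
    rw [← mul_assoc _ _ (-Xᵀ), ← mul_assoc _ X, mul_assoc _ (symplecticForm n) (symplecticForm n),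
      hJ] at h2
    simpa using h2

theorem mem_Sp_iff {A : Matrix (Fin n ⊕ Fin n) (Fin n ⊕ Fin n) ℂ} :
    A ∈ Sp n ↔ A * star A = 1 ∧ A * symplecticForm n * Aᵀ = symplecticForm n :=
  and_congr Matrix.mem_unitaryGroup_iff SymplecticGroup.mem_iff

theorem mem_Sp_of_mem_antilinearCentralizer {A : Matrix (Fin n ⊕ Fin n) (Fin n ⊕ Fin n) ℂ}
    (hA : A * star A = 1) (hA' : A ∈ antilinearCentralizer (symplecticForm n)) : A ∈ Sp n := by
  refine mem_Sp_iff.2 ⟨hA, ?_⟩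
  have h : Aᴴᵀ * Aᵀ = 1 := by
    rw [← Matrix.transpose_mul, ← Matrix.star_eq_conjTranspose, hA, Matrix.transpose_one]
  rw [← mem_antilinearCentralizer.1 hA', map_conj_eq, mul_assoc, h, mul_one]

/-- The conjugation `Z ↦ J (conj Z) J⁻¹`, whose fixed points are the quaternionic matrices. -/
noncomputable def quaternionicConj (n : ℕ) : Matrix (Fin n ⊕ Fin n) (Fin n ⊕ Fin n) ℂ →ₗ[ℝ]
    Matrix (Fin n ⊕ Fin n) (Fin n ⊕ Fin n) ℂ where
  toFun Z := -(symplecticForm n * Z.map (starRingEnd ℂ) * symplecticForm n)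
  map_add' Y Z := by
    rw [Matrix.map_add _ (map_add _), mul_add, add_mul, neg_add]
  map_smul' c Z := by
    have : (c • Z).map (starRingEnd ℂ) = c • Z.map (starRingEnd ℂ) := by
      ext i j
      simp
    rw [this, Matrix.mul_smul, Matrix.smul_mul, ← smul_neg, RingHom.id_apply]

theorem quaternionicConj_apply (Z : Matrix (Fin n ⊕ Fin n) (Fin n ⊕ Fin n) ℂ) :
    quaternionicConj n Z = -(symplecticForm n * Z.map (starRingEnd ℂ) * symplecticForm n) := rfl

theorem quaternionicConj_eq_iff {Z : Matrix (Fin n ⊕ Fin n) (Fin n ⊕ Fin n) ℂ} :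
    quaternionicConj n Z = Z ↔ Z ∈ antilinearCentralizer (symplecticForm n) := by
  have hJ := symplecticForm_mul_self (n := n)
  rw [quaternionicConj_apply, mem_antilinearCentralizer]
  constructor
  · intro h
    have h1 := congrArg (· * symplecticForm n) h
    simpa [mul_assoc, hJ] using h1
  · intro h
    rw [h, mul_assoc, hJ]
    simp

theorem quaternionicConj_quaternionicConj (Z : Matrix (Fin n ⊕ Fin n) (Fin n ⊕ Fin n) ℂ) :
    quaternionicConj n (quaternionicConj n Z) = Z := by
  have hJ := symplecticForm_mul_self (n := n)
  have h : (quaternionicConj n Z).map (starRingEnd ℂ) =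
      -(symplecticForm n * Z * symplecticForm n) := by
    rw [quaternionicConj_apply, Matrix.map_neg _ (map_neg _), map_conj_mul, map_conj_mul,
      map_conj_map_conj, symplecticForm_map_conj]
  rw [quaternionicConj_apply, h, mul_neg, neg_mul, neg_neg, mul_assoc, mul_assoc, mul_assoc, hJ,
    ← mul_assoc, hJ]
  simp

theorem quaternionicConj_mul (Y Z : Matrix (Fin n ⊕ Fin n) (Fin n ⊕ Fin n) ℂ) :
    quaternionicConj n (Y * Z) = quaternionicConj n Y * quaternionicConj n Z := by
  have hJ := symplecticForm_mul_self (n := n)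
  simp only [quaternionicConj_apply, map_conj_mul, neg_mul_neg]
  rw [← mul_assoc _ (symplecticForm n * _), ← mul_assoc _ (symplecticForm n),
    mul_assoc _ (symplecticForm n) (symplecticForm n), hJ]
  simp [mul_assoc]

theorem conjTranspose_quaternionicConj (Z : Matrix (Fin n ⊕ Fin n) (Fin n ⊕ Fin n) ℂ) :
    (quaternionicConj n Z)ᴴ = quaternionicConj n Zᴴ := by
  have h : (Z.map (starRingEnd ℂ))ᴴ = Zᴴ.map (starRingEnd ℂ) := by
    ext i j
    simp
  rw [quaternionicConj_apply, quaternionicConj_apply, Matrix.conjTranspose_neg,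
    Matrix.conjTranspose_mul, Matrix.conjTranspose_mul, conjTranspose_symplecticForm, h]
  simp [mul_assoc]

/-- The equivariant projection of complex matrices onto `sp(n)`. -/
noncomputable def spProj (n : ℕ) : Matrix (Fin n ⊕ Fin n) (Fin n ⊕ Fin n) ℂ →ₗ[ℝ]
    Matrix (Fin n ⊕ Fin n) (Fin n ⊕ Fin n) ℂ :=
  ((1 / 2 : ℝ) • (LinearMap.id + quaternionicConj n)) ∘ₗ skewProj _ ℂ

theorem spProj_apply (B : Matrix (Fin n ⊕ Fin n) (Fin n ⊕ Fin n) ℂ) : spProj n B =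
    (1 / 2 : ℝ) • (skewProj _ ℂ B + quaternionicConj n (skewProj _ ℂ B)) := rfl

theorem spProj_mem (B : Matrix (Fin n ⊕ Fin n) (Fin n ⊕ Fin n) ℂ) : spProj n B ∈ sp n := by
  refine mem_sp_iff.2 ⟨?_, quaternionicConj_eq_iff.1 ?_⟩
  · rw [spProj_apply, Matrix.conjTranspose_smul, Matrix.conjTranspose_add,
      conjTranspose_quaternionicConj, conjTranspose_skewProj, map_neg, star_trivial, ← smul_neg,
      neg_add]
  · rw [spProj_apply, map_smul, map_add, quaternionicConj_quaternionicConj, add_comm]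

theorem spProj_of_mem {Z : Matrix (Fin n ⊕ Fin n) (Fin n ⊕ Fin n) ℂ} (hZ : Z ∈ sp n) :
    spProj n Z = Z := by
  obtain ⟨h1, h2⟩ := mem_sp_iff.1 hZ
  rw [spProj_apply, skewProj_of_skew h1, quaternionicConj_eq_iff.2 h2, ← two_smul ℝ Z, smul_smul]
  norm_num

theorem spProj_lie (B : Matrix (Fin n ⊕ Fin n) (Fin n ⊕ Fin n) ℂ)
    {X : Matrix (Fin n ⊕ Fin n) (Fin n ⊕ Fin n) ℂ} (hX : X ∈ sp n) :
    spProj n (B * X - X * B) = spProj n B * X - X * spProj n B := by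
  obtain ⟨h1, h2⟩ := mem_sp_iff.1 hX
  rw [spProj_apply, spProj_apply, skewProj_lie B h1, map_sub, quaternionicConj_mul,
    quaternionicConj_mul, quaternionicConj_eq_iff.2 h2, Matrix.smul_mul, Matrix.mul_smul,
    ← smul_sub]
  congr 1
  noncomm_ring

theorem trace_eq_zero_of_mem_sp {X : Matrix (Fin n ⊕ Fin n) (Fin n ⊕ Fin n) ℂ}
    (hX : X ∈ sp n) : X.trace = 0 := by
  have h := (mem_sp_iff_transpose.1 hX).2
  have h1 : -X = -symplecticForm n * (Xᵀ * symplecticForm n) := by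
    rw [h, ← mul_assoc, neg_mul, symplecticForm_mul_self]
    simp
  have h2 := congrArg Matrix.trace h1
  rw [Matrix.trace_mul_comm, mul_assoc, mul_neg, symplecticForm_mul_self, neg_neg, mul_one,
    Matrix.trace_transpose, Matrix.trace_neg] at h2
  exact neg_eq_self.1 h2

/-- `-X` is similar to `Xᵀ` through `J`. Hence coefficients of odd degree vanish on `sp(n)`. -/
theorem charpoly_neg_of_mem_sp {X : Matrix (Fin n ⊕ Fin n) (Fin n ⊕ Fin n) ℂ}
    (hX : X ∈ sp n) : (-X).charpoly = X.charpoly := by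
  have h := (mem_sp_iff_transpose.1 hX).2
  have h1 : -X = -symplecticForm n * (Xᵀ * symplecticForm n) := by
    rw [h, ← mul_assoc, neg_mul, symplecticForm_mul_self]
    simp
  rw [h1, Matrix.charpoly_mul_comm, mul_assoc, mul_neg, symplecticForm_mul_self, neg_neg, mul_one,
    Matrix.charpoly_transpose]

theorem fromBlocks_mem_sp {A B : Matrix (Fin n) (Fin n) ℂ} (hA : Aᴴ = -A) (hB : Bᵀ = B) :
    Matrix.fromBlocks A B (-B.map (starRingEnd ℂ)) (A.map (starRingEnd ℂ)) ∈ sp n := by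
  refine mem_sp_iff.2 ⟨?_, mem_antilinearCentralizer.2 ?_⟩
  · have h1 : (B.map (starRingEnd ℂ))ᴴ = B := by
      conv_rhs => rw [← hB]
      ext i j
      simp
    have h2 : (A.map (starRingEnd ℂ))ᴴ = -(A.map (starRingEnd ℂ)) := by
      rw [← Matrix.map_neg _ (map_neg _), ← hA]
      ext i j
      simp
    have h3 : Bᴴ = B.map (starRingEnd ℂ) := by
      conv_rhs => rw [← hB]
      rfl
    rw [Matrix.fromBlocks_conjTranspose, Matrix.fromBlocks_neg, Matrix.conjTranspose_neg, h1, h2,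
      h3, hA, neg_neg]
  · rw [Matrix.fromBlocks_map, Matrix.map_neg _ (map_neg _), map_conj_map_conj, map_conj_map_conj,
      symplecticForm, Matrix.J, Matrix.fromBlocks_multiply, Matrix.fromBlocks_multiply]
    simp

theorem finrank_sp_ge (n : ℕ) : n * n + (n * n + n) ≤ Module.finrank ℝ (sp n) := by
  let fA : Matrix (Fin n) (Fin n) ℝ → Matrix (Fin n) (Fin n) ℂ := fun R =>
    Matrix.of fun i j => ⟨R i j - R j i, R i j + R j i⟩
  -- A symmetric complex matrix packed into real data: the lower triangle with diagonal holds the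
  -- real parts, the strict upper triangle the off-diagonal imaginary parts, and the vector the
  -- diagonal imaginary parts.
  let fB : Matrix (Fin n) (Fin n) ℝ × (Fin n → ℝ) → Matrix (Fin n) (Fin n) ℂ := fun p =>
    Matrix.of fun i j => ⟨p.1 (max i j) (min i j),
      if i = j then p.2 i else p.1 (min i j) (max i j)⟩
  let f : Matrix (Fin n) (Fin n) ℝ × (Matrix (Fin n) (Fin n) ℝ × (Fin n → ℝ)) →ₗ[ℝ]
      Matrix (Fin n ⊕ Fin n) (Fin n ⊕ Fin n) ℂ :=
    { toFun := fun p => Matrix.fromBlocks (fA p.1) (fB p.2) (-(fB p.2).map (starRingEnd ℂ))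
        ((fA p.1).map (starRingEnd ℂ))
      map_add' := fun p q => by
        have h1 : fA (p + q).1 = fA p.1 + fA q.1 := by
          ext i j
          apply Complex.ext
          · simp [fA]
            ring
          · simp [fA]
            ring
        have h2 : fB (p + q).2 = fB p.2 + fB q.2 := by
          ext i j
          apply Complex.ext
          · simp [fB]
          · simp only [fB, Matrix.of_apply, Matrix.add_apply, Complex.add_im, Prod.snd_add,
              Prod.fst_add, Pi.add_apply]
            split_ifs <;> rfl
        rw [h1, h2, Matrix.fromBlocks_add, Matrix.map_add _ (map_add _),
          Matrix.map_add _ (map_add _), neg_add]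
      map_smul' := fun c p => by
        have h1 : fA (c • p).1 = c • fA p.1 := by
          ext i j
          apply Complex.ext
          · simp [fA]
            ring
          · simp [fA]
            ring
        have h2 : fB (c • p).2 = c • fB p.2 := by
          ext i j
          apply Complex.ext
          · simp [fB]
          · simp only [fB, Matrix.of_apply, Matrix.smul_apply, Complex.smul_im, Prod.smul_snd,
              Prod.smul_fst, Pi.smul_apply]
            split_ifs <;> rfl
        have h3 : ∀ Z : Matrix (Fin n) (Fin n) ℂ,
            (c • Z).map (starRingEnd ℂ) = c • Z.map (starRingEnd ℂ) := fun Z => by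
          ext i j
          simp
        rw [h1, h2, h3, h3, ← smul_neg, RingHom.id_apply, Matrix.fromBlocks_smul] }
  have hf : ∀ p, f p ∈ (sp n).toSubmodule := fun p => by
    refine fromBlocks_mem_sp ?_ ?_
    · ext i j
      apply Complex.ext
      · simp [fA]
      · simp [fA]
        ring
    · ext i j
      simp only [fB, Matrix.transpose_apply, Matrix.of_apply, max_comm j i, min_comm j i]
      by_cases hij : i = j
      · simp [hij]
      · simp [hij, Ne.symm hij]
  have hinj : Function.Injective (LinearMap.codRestrict _ f hf) := by
    rintro ⟨R, S, v⟩ ⟨R', S', v'⟩ h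
    have h1 : f (R, S, v) = f (R', S', v') := congrArg Subtype.val h
    obtain ⟨hA, hB, -, -⟩ := Matrix.fromBlocks_inj.1 h1
    have hB1 : ∀ i j, S (max i j) (min i j) = S' (max i j) (min i j) := fun i j =>
      congrArg Complex.re (congrFun (congrFun hB i) j)
    have hB2 : ∀ i j, (if i = j then v i else S (min i j) (max i j)) =
        if i = j then v' i else S' (min i j) (max i j) := fun i j =>
      congrArg Complex.im (congrFun (congrFun hB i) j)
    refine Prod.ext ?_ (Prod.ext ?_ ?_)
    · ext i j
      have h2 := congrFun (congrFun hA i) j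
      have h3 := congrArg Complex.re h2
      have h4 := congrArg Complex.im h2
      simp only [fA, Matrix.of_apply] at h3 h4
      simp only
      linarith
    · ext i j
      rcases le_or_gt j i with hij | hij
      · simpa [max_eq_left hij, min_eq_right hij] using hB1 i j
      · simpa [max_eq_right hij.le, min_eq_left hij.le, hij.ne] using hB2 i j
    · ext i
      simpa using hB2 i i
  have := LinearMap.finrank_le_finrank_of_injective hinj
  rw [Module.finrank_prod, Module.finrank_prod, Module.finrank_matrix, Module.finrank_self,
    Module.finrank_fintype_fun_eq_card, Fintype.card_fin, mul_one] at this
  exact this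

/-- The embedding of `u(n)` into `sp(n)`. -/
def diagEmbed (A : Matrix (Fin n) (Fin n) ℂ) : Matrix (Fin n ⊕ Fin n) (Fin n ⊕ Fin n) ℂ :=
  Matrix.fromBlocks A 0 0 (A.map (starRingEnd ℂ))

theorem diagEmbed_mem_sp {A : Matrix (Fin n) (Fin n) ℂ} (hA : Aᴴ = -A) : diagEmbed A ∈ sp n := by
  have h := fromBlocks_mem_sp hA (B := 0) (by simp)
  rwa [Matrix.map_zero _ (map_zero _), neg_zero] at h

theorem diagEmbed_mul (A B : Matrix (Fin n) (Fin n) ℂ) :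
    diagEmbed A * diagEmbed B = diagEmbed (A * B) := by
  simp [diagEmbed, Matrix.fromBlocks_multiply]

theorem diagEmbed_add (A B : Matrix (Fin n) (Fin n) ℂ) :
    diagEmbed A + diagEmbed B = diagEmbed (A + B) := by
  simp [diagEmbed, Matrix.fromBlocks_add, Matrix.map_add]

theorem diagEmbed_sub (A B : Matrix (Fin n) (Fin n) ℂ) :
    diagEmbed A - diagEmbed B = diagEmbed (A - B) := by
  rw [sub_eq_iff_eq_add, diagEmbed_add, sub_add_cancel]

theorem re_trace_diagEmbed (A : Matrix (Fin n) (Fin n) ℂ) :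
    RCLike.re (diagEmbed A).trace = 2 * RCLike.re A.trace := by
  rw [diagEmbed, Matrix.trace, Fintype.sum_sum_type]
  simp [Matrix.trace, two_mul]

theorem oddInv_diagEmbed (A B : Matrix (Fin n) (Fin n) ℂ) :
    oddInv (diagEmbed A) (diagEmbed B) = 2 * oddInv A B := by
  simp only [oddInv, diagEmbed_mul, re_trace_diagEmbed]

theorem reflInv_diagEmbed (A B : Matrix (Fin n) (Fin n) ℂ) :
    reflInv (diagEmbed A) (diagEmbed B) = 4 * reflInv A B := by
  simp only [reflInv, diagEmbed_mul, diagEmbed_add, diagEmbed_sub, re_trace_diagEmbed]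
  ring

/-- No trace condition is imposed, since `diagEmbed` lands in `sp(n)` for every skew-Hermitian
matrix; this is why size `3` suffices. -/
theorem exists_skew_oddInv_ne_zero : ∃ X Y : Matrix (Fin 3) (Fin 3) ℂ,
    Xᴴ = -X ∧ Yᴴ = -Y ∧ oddInv X Y ≠ 0 := by
  let i : GaussianInt := ⟨0, 1⟩
  let X : Matrix (Fin 3) (Fin 3) GaussianInt := !![i, 0, 0; 0, 0, 0; 0, 0, -i]
  let Y : Matrix (Fin 3) (Fin 3) GaussianInt := !![0, -i, 1; -i, 0, i; -1, i, i]
  refine ⟨GaussianInt.toComplex.mapMatrix X, GaussianInt.toComplex.mapMatrix Y, ?_, ?_, ?_⟩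
  · rw [conjTranspose_map_toComplex, ← map_neg]
    congr 1
    decide +kernel
  · rw [conjTranspose_map_toComplex, ← map_neg]
    congr 1
    decide +kernel
  · have h : (X * Y * (X * X) * (Y * Y * Y)).trace = ⟨2, 5⟩ := by decide +kernel
    rw [oddInv_mapMatrix, h]
    simp [GaussianInt.toComplex_def]

theorem exists_skew_reflInv_ne_zero : ∃ X Y : Matrix (Fin 3) (Fin 3) ℂ,
    Xᴴ = -X ∧ Yᴴ = -Y ∧ reflInv X Y ≠ 0 := by
  let i : GaussianInt := ⟨0, 1⟩
  let X : Matrix (Fin 3) (Fin 3) GaussianInt := !![0, 0, 0; 0, i, 0; 0, 0, -i]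
  let Y : Matrix (Fin 3) (Fin 3) GaussianInt := !![0, 0, -1; 0, i, 0; 1, 0, 0]
  refine ⟨GaussianInt.toComplex.mapMatrix X, GaussianInt.toComplex.mapMatrix Y, ?_, ?_, ?_⟩
  · rw [conjTranspose_map_toComplex, ← map_neg]
    congr 1
    decide +kernel
  · rw [conjTranspose_map_toComplex, ← map_neg]
    congr 1
    decide +kernel
  · have h1 : ((X * Y + Y * X) * ((X * Y - Y * X) * (X * Y - Y * X))).trace = 0 := by
      decide +kernel
    have h2 : (X * Y).trace = -1 := by decide +kernel
    have h3 : (X * X * ((X * Y - Y * X) * (X * Y - Y * X))).trace = 1 := by decide +kernel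
    have h4 : (Y * Y * ((X * Y - Y * X) * (X * Y - Y * X))).trace = ⟨2, 0⟩ := by decide +kernel
    rw [reflInv_mapMatrix, h1, h2, h3, h4, GaussianInt.toComplex_def']
    norm_num

theorem exists_sp_family (n : ℕ) (hn : 3 ≤ n) : ∃ d : ℕ,
    (n : ℝ) ^ 2 - (n : ℝ) ≤ (d : ℝ) ∧ 1 < d ∧
    ∀ (h : Type u) [NormedAddCommGroup h] [InnerProductSpace ℝ h], Module.finrank ℝ h = 2 →
      ∃ O : Set (h →ₗ[ℝ] sp n), O.Nonempty ∧ IsZariskiOpen O ∧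
        ∀ j₀ ∈ O, InIsospectralFamily (Sp n) d j₀ := by
  have hnn : 3 * n ≤ n * n := Nat.mul_le_mul_right n hn
  obtain ⟨d, hd⟩ : ∃ d, d + n = n * n := ⟨n * n - n, by omega⟩
  refine ⟨d, ?_, by omega, fun h _ _ hh => ?_⟩
  · have : (d : ℝ) + n = n * n := by exact_mod_cast hd
    rw [sq]
    linarith
  have : Nonempty (Fin n ⊕ Fin n) := ⟨Sum.inl ⟨0, by omega⟩⟩
  have hcard : Fintype.card (Fin n ⊕ Fin n) = 2 * n := by simp [two_mul]
  let e : Fin n ≃ Fin 3 ⊕ Fin (n - 3) := (finCongr (by omega)).trans finSumFinEquiv.symm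
  have hemb : ∀ {Z : Matrix (Fin 3) (Fin 3) ℂ}, Zᴴ = -Z → diagEmbed (blockEmbed e Z) ∈ sp n :=
    fun hZ => diagEmbed_mem_sp (by rw [conjTranspose_blockEmbed, hZ, neg_blockEmbed])
  refine exists_isZariskiOpen_inIsospectralFamily (Sp n) ?_ ?_ (spProj n) spProj_mem
    (fun Z hZ => spProj_of_mem hZ) (fun B X hX => spProj_lie B hX)
    (fun Z hZ => trace_eq_zero_of_mem_sp hZ) (fun Z hZ => (mem_sp_iff.1 hZ).1)
    ((Finset.Icc 1 n).image (2 * ·)) ?_ ?_ ?_ ?_ ?_ ?_ h hh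
  · refine isCompact_of_isClosed_of_unitary ?_ fun A hA => hA.1
    have : (Sp n : Set (Matrix (Fin n ⊕ Fin n) (Fin n ⊕ Fin n) ℂ)) =
        {A | A * star A = 1} ∩ {A | A * symplecticForm n * Aᵀ = symplecticForm n} := by
      ext A
      exact mem_Sp_iff
    rw [this]
    exact (isClosed_eq (by fun_prop) continuous_const).inter
      (isClosed_eq (by fun_prop) continuous_const)
  · intro A hA
    exact IsUnit.of_mul_eq_one _ (mem_Sp_iff.1 hA).1
  · intro X hX k hk0 hk hkD
    exact charpoly_coeff_eq_zero_of_odd (charpoly_neg_of_mem_sp hX) hk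
      (odd_of_notMem_image (by rw [hcard]; omega) hk0 hk hkD)
  · intro S _ hSg hchar X hX Y hY
    obtain ⟨hX1, hX2⟩ := mem_sp_iff.1 (hSg X hX)
    obtain ⟨hY1, hY2⟩ := mem_sp_iff.1 (hSg Y hY)
    obtain ⟨A, hA, hAu, hXY⟩ := exists_compatible_unitary_conj (K := symplecticForm n) (ε := -1)
      (by norm_num) symplecticForm_map_conj (by rw [symplecticForm_mul_self, neg_one_smul])
      (by rw [conjTranspose_symplecticForm, neg_one_smul]) hX1 hY1 hX2 hY2 (hchar X hX Y hY)
    have hAA := Matrix.mem_unitaryGroup_iff.1 hAu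
    exact ⟨A, mem_Sp_of_mem_antilinearCentralizer hAA hA, by
      rw [Matrix.inv_eq_right_inv hAA, hXY]⟩
  · let w : Fin n → ℂ := fun k => Complex.I * ((k.val + 1 : ℝ) : ℂ)
    let v : Fin n ⊕ Fin n → ℂ := Sum.elim w fun k => starRingEnd ℂ (w k)
    have hw : ∀ k, (w k).im = k.val + 1 := fun k => by simp [w]
    have hv : Function.Injective v := by
      rintro (k | k) (l | l) hkl
      · have := congrArg Complex.im hkl
        simp only [v, Sum.elim_inl, hw, add_left_inj, Nat.cast_inj] at this
        exact congrArg _ (Fin.ext this)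
      · have := congrArg Complex.im hkl
        simp only [v, Sum.elim_inl, Sum.elim_inr, hw, Complex.conj_im] at this
        have h1 : (0 : ℝ) ≤ k.val := Nat.cast_nonneg _
        have h2 : (0 : ℝ) ≤ l.val := Nat.cast_nonneg _
        linarith
      · have := congrArg Complex.im hkl
        simp only [v, Sum.elim_inl, Sum.elim_inr, hw, Complex.conj_im] at this
        have h1 : (0 : ℝ) ≤ k.val := Nat.cast_nonneg _
        have h2 : (0 : ℝ) ≤ l.val := Nat.cast_nonneg _
        linarith
      · have := congrArg Complex.im hkl
        simp only [v, Sum.elim_inr, hw, Complex.conj_im, neg_inj, add_left_inj,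
          Nat.cast_inj] at this
        exact congrArg _ (Fin.ext this)
    have hdiag : Matrix.diagonal v = diagEmbed (Matrix.diagonal w) := by
      rw [diagEmbed, Matrix.diagonal_map (map_zero _), Matrix.fromBlocks_diagonal]
    refine ⟨Matrix.diagonal v, ?_, _, fromBlocks_mem_sp (A := 0) (B := Matrix.of fun _ _ => 1)
      (by simp) (by ext i j; simp), fun A hA hA' =>
      ⟨A (Sum.inl ⟨0, by omega⟩) (Sum.inl ⟨0, by omega⟩),
      eq_smul_one_of_commute_diagonal hv hA fun k => ?_⟩⟩
    · rw [hdiag]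
      refine diagEmbed_mem_sp ?_
      rw [Matrix.diagonal_conjTranspose, Matrix.diagonal_neg]
      congr 1
      ext k
      simp [w]
    · have hk : ∀ k l, A (Sum.inl k) (Sum.inl k) = A (Sum.inr l) (Sum.inr l) := fun k l =>
        apply_eq_apply_of_commute hv hA hA' (by simp)
      rcases k with k | k
      · rw [hk k ⟨0, by omega⟩, hk ⟨0, by omega⟩ ⟨0, by omega⟩]
      · exact (hk _ _).symm
  · obtain ⟨X, Y, hX, hY, hXY⟩ := exists_skew_reflInv_ne_zero
    exact ⟨_, hemb hX, _, hemb hY, by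
      rw [reflInv_diagEmbed, reflInv_blockEmbed]
      exact mul_ne_zero (by norm_num) hXY⟩
  · obtain ⟨X, Y, hX, hY, hXY⟩ := exists_skew_oddInv_ne_zero
    exact ⟨_, hemb hX, _, hemb hY, by
      rw [oddInv_diagEmbed, oddInv_blockEmbed]
      exact mul_ne_zero (by norm_num) hXY⟩
  · have := finrank_sp_ge n
    rw [sum_image_two_mul, mul_add]
    omega

end Symplectic

end IsospectralMaps

theorem mainTheorem2 :
    (∀ n : ℕ, n = 5 ∨ 7 ≤ n →
      ∃ d : ℕ,
        (n : ℝ) * ((n : ℝ) - 1) / 2 - ((n / 2 : ℕ) : ℝ) * (((n / 2 : ℕ) : ℝ) + 2) ≤ (d : ℝ) ∧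
        1 < d ∧
        ∀ (h : Type u) [NormedAddCommGroup h] [InnerProductSpace ℝ h], Module.finrank ℝ h = 2 →
          ∃ O : Set (h →ₗ[ℝ] LieAlgebra.Orthogonal.so (Fin n) ℝ),
            O.Nonempty ∧ IsospectralMaps.IsZariskiOpen O ∧
            ∀ j₀ ∈ O, IsospectralMaps.InIsospectralFamily
              (Matrix.specialOrthogonalGroup (Fin n) ℝ) d j₀) ∧
    (∀ n : ℕ, 4 ≤ n →
      ∃ d : ℕ,
        (n : ℝ) ^ 2 - 1 - ((n : ℝ) ^ 2 + 3 * (n : ℝ)) / 2 ≤ (d : ℝ) ∧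
        (n = 4 → d = 1) ∧ (5 ≤ n → 1 < d) ∧
        ∀ (h : Type u) [NormedAddCommGroup h] [InnerProductSpace ℝ h], Module.finrank ℝ h = 2 →
          ∃ O : Set (h →ₗ[ℝ] IsospectralMaps.su n),
            O.Nonempty ∧ IsospectralMaps.IsZariskiOpen O ∧
            ∀ j₀ ∈ O, IsospectralMaps.InIsospectralFamily
              (Matrix.specialUnitaryGroup (Fin n) ℂ) d j₀) ∧
    (∀ n : ℕ, 3 ≤ n →
      ∃ d : ℕ,
        (n : ℝ) ^ 2 - (n : ℝ) ≤ (d : ℝ) ∧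
        1 < d ∧
        ∀ (h : Type u) [NormedAddCommGroup h] [InnerProductSpace ℝ h], Module.finrank ℝ h = 2 →
          ∃ O : Set (h →ₗ[ℝ] IsospectralMaps.sp n),
            O.Nonempty ∧ IsospectralMaps.IsZariskiOpen O ∧
            ∀ j₀ ∈ O, IsospectralMaps.InIsospectralFamily
              (IsospectralMaps.Sp n) d j₀) :=
  ⟨IsospectralMaps.exists_so_family, IsospectralMaps.exists_su_family,
    IsospectralMaps.exists_sp_family⟩
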